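/- Let $N\ge 1$ and $1=\nu_1<\nu_2<\dots<\nu_N$ be real numbers, let $\boldsymbol\Pi(t)=(t^{\nu_1},\dots,t^{\nu_N})$ for $t\in[0,1]$ (with $0^{\nu}=0$), and let $\mathcal H$ be the convex hull of $\{\boldsymbol\Pi(t):t\in[0,1]\}$. For $\boldsymbol\lambda\in\mathbb R^N$ consider the inequality $\boldsymbol\lambda\cdot\boldsymbol x\le\sup_{t\in[0,1]}\boldsymbol\lambda\cdot\boldsymbol\Pi(t)$. Let $L(s)$ be the cone of all $\boldsymbol\lambda$ for which $t\mapsto\boldsymbol\lambda\cdot\boldsymbol\Pi(t)$ attains its maximum over $[0,1]$ at $t=s$, and let $\Lambda=\bigcup_{s\in[0,1]}\operatorname{Ext}L(s)$, where $\operatorname{Ext}$ denotes the set of nonzero vectors on extreme rays (normal vectors of tight inequalities). Notation. $\Delta\boldsymbol\Pi(t,t')=\boldsymbol\Pi(t)-\boldsymbol\Pi(t')$. For $v_1,\dots,v_{N-1}\in\mathbb R^N$, $\star(v_1\wedge\dots\wedge v_{N-1})$ is the vector $w$ with $w\cdot x=\det(x,v_1,\dots,v_{N-1})$ for all $x$ (rows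 in this order). $\boldsymbol t_l$ denotes a sequence $0\le t_1\le\dots\le t_l\le1$, $\mathcal U$ a set of indices of its distinct values in increasing order, $\omega_k$ the multiplicity of $t_k$ in $\boldsymbol t_l$, and $\delta_{a,b}$ the Kronecker delta. $\partial^j\Delta\boldsymbol\Pi(t,t')$ is the $j$-th derivative in $t$; at $t=0$ and $j\ge2$, where it need not exist, it is replaced by the $j$-th standard basis vector $\boldsymbol e_j$. All vectors $\boldsymbol\lambda$ below are understood up to a positive normalization factor. Plain forms. For $N=2m+1$ and $\tau\in\{0,1\}$: $$\boldsymbol\lambda(\boldsymbol t_m;\tau)=(-1)^{\tau+1}\star\bigwedge_{k=1}^m\Delta\boldsymbol\Pi(t_k,\tau)\wedge\dot{\boldsymbol\Pi}(t_k).$$ For $N=2m$, $m\ge1$: $$\boldsymbol\lambda(\boldsymbol t_m)=\star\Big(\bigwedge_{k=2}^m\Delta\boldsymbol\Pi(t_k,t_1)\wedge\dot{\boldsymbol\Pi}(t_k)\Big)\wedge\dot{\boldsymbol\Pi}(t_1),\qquad \boldsymbol\lambda(\boldsymbol t_{m-1};0,1)=-\star\Big(\bigwedge_{k=1}^{m-1}\Delta\boldsymbol\Pi(t_k,0)\wedge\dot{\boldsymbol\Pi}(t_k)\Big)\wedge\Delta\boldsymbol\Pi(1,0),$$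 the star being applied to the whole wedge product. General forms. Respectively, $$(-1)^{\tau+1}\star\bigwedge_{k\in\mathcal U}\ \bigwedge_{j=\delta_{t_k,\tau}}^{2\omega_k-1+\delta_{t_k,\tau}}\partial^j\Delta\boldsymbol\Pi(t_k,\tau),\qquad \star\bigwedge_{k\in\mathcal U}\ \bigwedge_{j=\delta_{t_k,t_1}}^{2\omega_k-1}\partial^j\Delta\boldsymbol\Pi(t_k,t_1),$$ $$-\star\Big(\Delta\boldsymbol\Pi(1,0)\wedge\bigwedge_{k\in\mathcal U}\ \bigwedge_{j=\delta_{t_k,0}+\delta_{t_k,1}}^{2\omega_k-1+\delta_{t_k,0}+\delta_{t_k,1}}\partial^j\Delta\boldsymbol\Pi(t_k,0)\Big).$$ Claim. (1) If the $t_k$ are distinct (and moreover different from $\tau$ in the case of $\boldsymbol\lambda(\boldsymbol t_m;\tau)$, and from $0$ and $1$ in the case of $\boldsymbol\lambda(\boldsymbol t_{m-1};0,1)$), the general form coincides with the plain form. For every $\boldsymbol t_l$, the Euclidean-normalized general form at $\boldsymbol t_l$ is the limit of the Euclidean-normalized plain forms at $\boldsymbol s$ as $\boldsymbol s\to\boldsymbol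 t_l$ with $0<s_1<\dots<s_l<1$. (2) Consider the family of all general forms: $\boldsymbol\lambda(\boldsymbol t_m;\tau)$, $\tau\in\{0,1\}$, for $N=2m+1$; all $\boldsymbol\lambda(\boldsymbol t_m)$ and $\boldsymbol\lambda(\boldsymbol t_{m-1};0,1)$ for $N=2m$. Then $\Lambda$ consists exactly of the positive multiples of the members of this family. The family is complete: $\boldsymbol x\in\mathcal H$ if and only if $\boldsymbol x$ satisfies the inequality of every member. It is independent: for every member and every finite set of other members (members being indexed by their parameters) there is a point $\boldsymbol x\in\mathbb R^N$ that satisfies the inequalities of the finite set but violates the inequality of the given member. (3) The right-hand sides, which are attained maxima, are, for all $\boldsymbol t_l$ and in both the plain and the general form: for $\boldsymbol\lambda(\boldsymbol t_m;\tau)$, $(-1)^{\tau+1}$ times the determinant with first row $(\tau,\dots,\tau)$ followed by the vectors of the wedge product; for $\boldsymbol\lambda(\boldsymbol t_m)$, the determinant with first row $(t_1^{\nu_1},\dots,t_1^{\nu_N})$ followed by the vectors of the wedge product; for $\boldsymbol\lambda(\boldsymbol t_{m-1};0,1)$, zero. (4) If $\nu_i=i$ for all $i$ (that is, $\eta_i=i/N$),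 then for the plain forms $$\sup_{t\in[0,1]}\boldsymbol\lambda(\boldsymbol t_m;\tau)\cdot\boldsymbol\Pi(t)=\tau f(\boldsymbol t_m;0)f(\boldsymbol t_m;1)g(\boldsymbol t_m),\qquad \sup_{t\in[0,1]}\boldsymbol\lambda(\boldsymbol t_m)\cdot\boldsymbol\Pi(t)=f(\boldsymbol t_m;0)g(\boldsymbol t_m),$$ where $f(\boldsymbol t_l;a)=\prod_{k=1}^l(t_k-a)^2$ and $g(\boldsymbol t_l)=\prod_{i<j}(t_i-t_j)^4$. -/

import Mathlib

open Set Filter Topology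

namespace NoClick

noncomputable section

/-! ### The curve, its convex hull and the inequalities -/

/-- The vector `Π(t) = (t^{ν_1}, …, t^{ν_N})`; the index `i : Fin N` stands for the paper's
`i + 1`. -/
def curve {N : ℕ} (ν : Fin N → ℝ) (t : ℝ) : Fin N → ℝ := fun i => t ^ ν i

/-- The classical region: the convex hull of the curve `t ↦ Π(t)`, `t ∈ [0,1]`. -/
def hull {N : ℕ} (ν : Fin N → ℝ) : Set (Fin N → ℝ) :=
  convexHull ℝ (curve ν '' Icc 0 1)

/-- The values `λ · Π(t)` for `t ∈ [0,1]`. -/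
def values {N : ℕ} (ν lam : Fin N → ℝ) : Set ℝ :=
  (fun t : ℝ => lam ⬝ᵥ curve ν t) '' Icc 0 1

/-- The right-hand side `sup_{t ∈ [0,1]} λ · Π(t)` of the inequality with normal vector `λ`
(the set of values is nonempty and, for exponents `ν_i ≥ 1`, compact). -/
def bound {N : ℕ} (ν lam : Fin N → ℝ) : ℝ := sSup (values ν lam)

/-- The point `x` satisfies the inequality `λ · x ≤ sup_{t ∈ [0,1]} λ · Π(t)`. -/
def Satisfies {N : ℕ} (ν lam x : Fin N → ℝ) : Prop := lam ⬝ᵥ x ≤ bound ν lam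

/-- The cone `L(s)` of all `λ` for which `t ↦ λ · Π(t)` attains its maximum over `[0,1]`
at `t = s`. -/
def normalCone {N : ℕ} (ν : Fin N → ℝ) (s : ℝ) : Set (Fin N → ℝ) :=
  {lam | IsMaxOn (fun t : ℝ => lam ⬝ᵥ curve ν t) (Icc 0 1) s}

/-- The ray spanned by `v`. -/
def ray {N : ℕ} (v : Fin N → ℝ) : Set (Fin N → ℝ) := {w | ∃ c : ℝ, 0 ≤ c ∧ w = c • v}

/-- The nonzero vectors on the extreme rays of a cone `L`. -/
def extremeRays {N : ℕ} (L : Set (Fin N → ℝ)) : Set (Fin N → ℝ) :=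
  {v | v ≠ 0 ∧ IsExtreme ℝ L (ray v)}

/-- The set `Λ = ⋃_{s ∈ [0,1]} Ext L(s)` of normal vectors of tight inequalities. -/
def tightSet {N : ℕ} (ν : Fin N → ℝ) : Set (Fin N → ℝ) :=
  ⋃ s ∈ Icc (0 : ℝ) 1, extremeRays (normalCone ν s)

/-- A family of normal vectors represents `Λ`: the elements of `Λ` are exactly the positive
multiples of its members. -/
def IsTightFamily {N : ℕ} {ι : Type} (ν : Fin N → ℝ) (lam : ι → Fin N → ℝ) : Prop :=
  tightSet ν = {v | ∃ p : ι, ∃ c : ℝ, 0 < c ∧ v = c • lam p}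

/-- Completeness: the inequalities of the family describe the convex hull. -/
def IsCompleteFamily {N : ℕ} {ι : Type} (ν : Fin N → ℝ) (lam : ι → Fin N → ℝ) : Prop :=
  hull ν = {x | ∀ p : ι, Satisfies ν (lam p) x}

/-- Independence: no inequality of the family is a consequence of finitely many others (in
particular it is not a conic combination of others, and distinct parameters give distinct
inequalities). -/
def IsIndependentFamily {N : ℕ} {ι : Type} (ν : Fin N → ℝ) (lam : ι → Fin N → ℝ) : Prop :=
  ∀ (p : ι) (F : Finset ι), p ∉ F →
    ∃ x : Fin N → ℝ, (∀ q ∈ F, Satisfies ν (lam q) x) ∧ ¬ Satisfies ν (lam p) x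

/-! ### Hodge star and rows -/

/-- The determinant with first row `x` and remaining rows `v`. -/
def borderedDet {n : ℕ} (x : Fin (n + 1) → ℝ) (v : Fin n → Fin (n + 1) → ℝ) : ℝ :=
  Matrix.det (Matrix.of (Fin.cons x v : Fin (n + 1) → Fin (n + 1) → ℝ))

/-- The Hodge star `⋆ (v_1 ∧ … ∧ v_n)` of `n` vectors of `ℝ^{n+1}`: the formal determinant whose
first row consists of the standard basis vectors. -/
def hodgeStar {n : ℕ} (v : Fin n → Fin (n + 1) → ℝ) : Fin (n + 1) → ℝ :=
  fun i => borderedDet (Pi.single i 1) v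

/-- The `j`-th derivative `Π^{(j)}(t)`, with one exception: at `t = 0`, orders `j ≥ 2`, where
`t ^ ν` need not be `j` times differentiable, the `j`-th standard basis vector is used instead.
It is the limiting direction: the normalized `Π̇(t) ∧ … ∧ Π^{(j)}(t)` tends to
`e_1 ∧ … ∧ e_j` as `t → 0+`. -/
def curveDeriv {N : ℕ} (ν : Fin N → ℝ) (j : ℕ) (t : ℝ) : Fin N → ℝ := fun i =>
  if t = 0 ∧ 2 ≤ j then (if (i : ℕ) + 1 = j then 1 else 0)
  else iteratedDeriv j (fun s : ℝ => s ^ ν i) t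

/-- The `j`-th derivative in `t` of `ΔΠ(t, t') = Π(t) - Π(t')`. -/
def deltaDeriv {N : ℕ} (ν : Fin N → ℝ) (j : ℕ) (t t' : ℝ) : Fin N → ℝ :=
  if j = 0 then curve ν t - curve ν t' else curveDeriv ν j t

/-- `a_1, b_1, a_2, b_2, …, a_m, b_m`. -/
def interleave {N m : ℕ} (a b : Fin m → Fin N → ℝ) : Fin (2 * m) → Fin N → ℝ := fun i =>
  if (i : ℕ) % 2 = 0 then a ⟨i / 2, by omega⟩ else b ⟨i / 2, by omega⟩

/-- The number of earlier occurrences of the value `t_k` in the sequence `t`. For a nondecreasing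
sequence, listing for every `k` the orders `2 r_k + d, 2 r_k + 1 + d`, with `r_k` this number,
lists for every distinct value of multiplicity `ω` the orders `d, …, 2 ω - 1 + d`. -/
def earlier {m : ℕ} (t : Fin m → ℝ) (k : Fin m) : ℕ :=
  (Finset.univ.filter fun i => i < k ∧ t i = t k).card

/-- Kronecker delta of real numbers. -/
def kron (a b : ℝ) : ℕ := if a = b then 1 else 0

/-- Nondecreasing sequences `0 ≤ t_1 ≤ … ≤ t_m ≤ 1`. -/
def closedSimplex (m : ℕ) : Set (Fin m → ℝ) := {t | Monotone t ∧ ∀ k, t k ∈ Icc (0 : ℝ) 1}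

/-- Strictly increasing sequences `0 < t_1 < … < t_m < 1`. -/
def openSimplex (m : ℕ) : Set (Fin m → ℝ) := {t | StrictMono t ∧ ∀ k, t k ∈ Ioo (0 : ℝ) 1}

/-- The Euclidean normalization `v / |v|`. -/
def normalized {N : ℕ} (v : Fin N → ℝ) : Fin N → ℝ := ‖WithLp.toLp 2 v‖⁻¹ • v

/-! ### Odd number of settings, `N = 2 m + 1` -/

/-- `ΔΠ(t_1,τ), Π̇(t_1), …, ΔΠ(t_m,τ), Π̇(t_m)`. -/
def oddRows {m : ℕ} (ν : Fin (2 * m + 1) → ℝ) (t : Fin m → ℝ) (τ : Fin 2) :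
    Fin (2 * m) → Fin (2 * m + 1) → ℝ :=
  interleave (fun k => curve ν (t k) - curve ν (τ : ℕ)) (fun k => curveDeriv ν 1 (t k))

/-- `λ(t_m; τ)` in the plain form, up to a positive normalization factor. -/
def lamOdd {m : ℕ} (ν : Fin (2 * m + 1) → ℝ) (t : Fin m → ℝ) (τ : Fin 2) :
    Fin (2 * m + 1) → ℝ :=
  (-1 : ℝ) ^ ((τ : ℕ) + 1) • hodgeStar (oddRows ν t τ)

/-- For every distinct value `t_k`, of multiplicity `ω`, the derivatives of `ΔΠ(t_k,τ)` of orders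
`δ_{t_k,τ}, …, 2 ω - 1 + δ_{t_k,τ}`. -/
def oddRowsGen {m : ℕ} (ν : Fin (2 * m + 1) → ℝ) (t : Fin m → ℝ) (τ : Fin 2) :
    Fin (2 * m) → Fin (2 * m + 1) → ℝ :=
  interleave
    (fun k => deltaDeriv ν (2 * earlier t k + kron (t k) (τ : ℕ)) (t k) (τ : ℕ))
    (fun k => deltaDeriv ν (2 * earlier t k + 1 + kron (t k) (τ : ℕ)) (t k) (τ : ℕ))

/-- `λ(t_m; τ)` in the general form, up to a positive normalization factor. -/
def lamOddGen {m : ℕ} (ν : Fin (2 * m + 1) → ℝ) (t : Fin m → ℝ) (τ : Fin 2) :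
    Fin (2 * m + 1) → ℝ :=
  (-1 : ℝ) ^ ((τ : ℕ) + 1) • hodgeStar (oddRowsGen ν t τ)

/-- All vectors `λ(t_m; τ)`, `τ ∈ {0,1}`. -/
def oddFamily {m : ℕ} (ν : Fin (2 * m + 1) → ℝ) :
    closedSimplex m × Fin 2 → Fin (2 * m + 1) → ℝ :=
  fun p => lamOddGen ν p.1 p.2

/-! ### Even number of settings, `N = 2 m` with `m = l + 1` -/

/-- `ΔΠ(t_2,t_1), Π̇(t_2), …, ΔΠ(t_m,t_1), Π̇(t_m), Π̇(t_1)`. -/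
def evenRows {l : ℕ} (ν : Fin (2 * l + 2) → ℝ) (t : Fin (l + 1) → ℝ) :
    Fin (2 * l + 1) → Fin (2 * l + 2) → ℝ :=
  Fin.snoc
    (interleave (fun k : Fin l => curve ν (t k.succ) - curve ν (t 0))
      (fun k : Fin l => curveDeriv ν 1 (t k.succ)))
    (curveDeriv ν 1 (t 0))

/-- `λ(t_m)` in the plain form, up to a positive normalization factor. -/
def lamEven {l : ℕ} (ν : Fin (2 * l + 2) → ℝ) (t : Fin (l + 1) → ℝ) : Fin (2 * l + 2) → ℝ :=
  hodgeStar (evenRows ν t)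

/-- For the value `t_1`, of multiplicity `ω`, the derivatives of `Π(t_1)` of orders
`1, …, 2 ω - 1`; for every other distinct value `t_k`, of multiplicity `ω`, the derivatives of
`Π(t_k) - Π(t_1)` of orders `0, …, 2 ω - 1`. The row `Π̇(t_1)` is put last; moving it past the
other `2 (m - 1)` rows does not change the sign. -/
def evenRowsGen {l : ℕ} (ν : Fin (2 * l + 2) → ℝ) (t : Fin (l + 1) → ℝ) :
    Fin (2 * l + 1) → Fin (2 * l + 2) → ℝ :=
  Fin.snoc
    (interleave
      (fun k : Fin l => deltaDeriv ν (2 * earlier t k.succ) (t k.succ) (t 0))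
      (fun k : Fin l => deltaDeriv ν (2 * earlier t k.succ + 1) (t k.succ) (t 0)))
    (curveDeriv ν 1 (t 0))

/-- `λ(t_m)` in the general form, up to a positive normalization factor. -/
def lamEvenGen {l : ℕ} (ν : Fin (2 * l + 2) → ℝ) (t : Fin (l + 1) → ℝ) :
    Fin (2 * l + 2) → ℝ :=
  hodgeStar (evenRowsGen ν t)

/-- `ΔΠ(t_1,0), Π̇(t_1), …, ΔΠ(t_{m-1},0), Π̇(t_{m-1}), ΔΠ(1,0)`. -/
def evenEndRows {l : ℕ} (ν : Fin (2 * l + 2) → ℝ) (t : Fin l → ℝ) :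
    Fin (2 * l + 1) → Fin (2 * l + 2) → ℝ :=
  Fin.snoc
    (interleave (fun k => curve ν (t k) - curve ν 0) (fun k => curveDeriv ν 1 (t k)))
    (curve ν 1 - curve ν 0)

/-- `λ(t_{m-1}; 0,1)` in the plain form, up to a positive normalization factor. -/
def lamEvenEnd {l : ℕ} (ν : Fin (2 * l + 2) → ℝ) (t : Fin l → ℝ) : Fin (2 * l + 2) → ℝ :=
  - hodgeStar (evenEndRows ν t)

/-- For every distinct value `t_k`, of multiplicity `ω`, the derivatives of `ΔΠ(t_k,0)` of orders
`d, …, 2 ω - 1 + d` with `d = δ_{t_k,0} + δ_{t_k,1}`; finally `ΔΠ(1,0)`. -/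
def evenEndRowsGen {l : ℕ} (ν : Fin (2 * l + 2) → ℝ) (t : Fin l → ℝ) :
    Fin (2 * l + 1) → Fin (2 * l + 2) → ℝ :=
  Fin.snoc
    (interleave
      (fun k => deltaDeriv ν (2 * earlier t k + (kron (t k) 0 + kron (t k) 1)) (t k) 0)
      (fun k => deltaDeriv ν (2 * earlier t k + 1 + (kron (t k) 0 + kron (t k) 1)) (t k) 0))
    (curve ν 1 - curve ν 0)

/-- `λ(t_{m-1}; 0,1)` in the general form, up to a positive normalization factor. -/
def lamEvenEndGen {l : ℕ} (ν : Fin (2 * l + 2) → ℝ) (t : Fin l → ℝ) : Fin (2 * l + 2) → ℝ :=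
  - hodgeStar (evenEndRowsGen ν t)

/-- All vectors `λ(t_m)` and `λ(t_{m-1}; 0,1)`. -/
def evenFamily {l : ℕ} (ν : Fin (2 * l + 2) → ℝ) :
    closedSimplex (l + 1) ⊕ closedSimplex l → Fin (2 * l + 2) → ℝ :=
  Sum.elim (fun t => lamEvenGen ν t) (fun t => lamEvenEndGen ν t)

/-! ### The polynomials of the equidistant case -/

/-- `f(t; a) = ∏_k (t_k - a)²`. -/
def fPoly {l : ℕ} (t : Fin l → ℝ) (a : ℝ) : ℝ := ∏ k, (t k - a) ^ 2

/-- `g(t) = ∏_{i<j} (t_i - t_j)⁴`. -/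
def gPoly {l : ℕ} (t : Fin l → ℝ) : ℝ := ∏ i, ∏ j ∈ Finset.Ioi i, (t i - t j) ^ 4

end

end NoClick

open NoClick

/-!
Put `μ = (0, ν_1, …, ν_N)`. The slack `λ · Π(b) - λ · Π(t)` of an inequality along the curve is a
generalized polynomial `∑ c_i t ^ μ_i` with `N + 1` terms, and everything follows from counting its
zeros. By Rolle's theorem (applied to derivatives that are rescaled by powers of `t` after each
differentiation) a nonzero generalized polynomial with `n` terms has fewer than `n` zeros on
`[0, ∞)`. At `t = 0` the derivatives need not exist; there a zero of order `j` means that the first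
`j` coefficients vanish, which is what the basis vectors in the general form express. With this
convention, rows of derivatives at nodes in nondecreasing order, with multiplicities, have positive
determinant (`det_gen_pos`), so that the expansion of such a determinant along a free row is the
generalized polynomial with prescribed zeros, and its sign is known (`borderedDet_sign`).

An inequality of the family has a slack whose `N` zeros are the `t_k`, each of them twice, together
with `τ`, or with `0` and `1` (`Touches`). Since all zeros in `(0,1)` are even, the slack is
nonnegative on `[0,1]`, which gives the right-hand sides. Since `N` zeros determine a generalized
polynomial with `N + 1` terms up to a factor, the ray of `λ` is extreme. Conversely, if the slack
of a vector on an extreme ray had fewer than `N` zeros, it could be perturbed in both directions by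
a generalized polynomial with the same zeros (`exists_abs_le`). Hence its zeros are `N` in number
with even multiplicities in `(0,1)`, and such lists are exactly those of the family
(`isTightFamily_of_touches`).

Completeness: a point outside the hull is separated from it by a vector in some normal cone; a
compact base of that cone is the convex hull of its extreme points, so a vector on an extreme ray
separates, too (`isCompleteFamily_of_tight`). Independence: the slack of a member is extreme in the
cone of nonnegative generalized polynomials and is not a multiple of finitely many others; so it
lies outside the closed cone generated by these and by the constant `1`, and a separating functional
is the required point (`isIndependentFamily_of_touches`). Limits: the normalized vectors lie on a
compact sphere, zeros with multiplicity survive in the limit, and they determine it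
(`tendsto_normalized_of_touches`). For integer exponents the right-hand sides are Vandermonde
determinants with double nodes, the limits of ordinary ones (`det_confluent_one`,
`det_confluent_two`).
-/

namespace NoClick

noncomputable section

/-! ### Multiplicities in finite sequences -/

/-- The number of times the value `a` occurs in the sequence `z`. -/
def mult {n : ℕ} (z : Fin n → ℝ) (a : ℝ) : ℕ := (Finset.univ.filter fun k => z k = a).card

lemma mult_eq_sum {n : ℕ} (z : Fin n → ℝ) (a : ℝ) :
    mult z a = ∑ k, if z k = a then 1 else 0 := Finset.card_filter _ _

lemma earlier_eq_sum {n : ℕ} (z : Fin n → ℝ) (k : Fin n) :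
    earlier z k = ∑ i, if i < k ∧ z i = z k then 1 else 0 := Finset.card_filter _ _

lemma mult_insertNth {n : ℕ} (z : Fin n → ℝ) (p : Fin (n + 1)) (x a : ℝ) :
    mult (p.insertNth x z : Fin (n + 1) → ℝ) a = (if x = a then 1 else 0) + mult z a := by
  simp [mult_eq_sum, Fin.sum_univ_succAbove _ p]

lemma mult_castSucc {n : ℕ} (z : Fin (n + 1) → ℝ) (a : ℝ) :
    mult z a = mult (fun k : Fin n => z k.castSucc) a + if z (Fin.last n) = a then 1 else 0 := by
  simp only [mult_eq_sum, Fin.sum_univ_castSucc]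

lemma mult_pos_iff {n : ℕ} {z : Fin n → ℝ} {a : ℝ} : 0 < mult z a ↔ ∃ k, z k = a := by
  simp [mult, Finset.card_pos, Finset.Nonempty]

lemma earlier_castSucc {n : ℕ} (z : Fin (n + 1) → ℝ) (k : Fin n) :
    earlier z k.castSucc = earlier (fun k : Fin n => z k.castSucc) k := by
  simp only [earlier_eq_sum, Fin.sum_univ_castSucc, Fin.castSucc_lt_castSucc_iff]
  simp [(Fin.castSucc_lt_last k).not_gt]

lemma earlier_last {n : ℕ} (z : Fin (n + 1) → ℝ) :
    earlier z (Fin.last n) = mult (fun k : Fin n => z k.castSucc) (z (Fin.last n)) := by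
  simp only [earlier_eq_sum, mult_eq_sum, Fin.sum_univ_castSucc, Fin.castSucc_lt_last, true_and,
    lt_self_iff_false, false_and, if_false, add_zero]

lemma earlier_lt_mult {n : ℕ} (z : Fin n → ℝ) (k : Fin n) : earlier z k < mult z (z k) := by
  apply Finset.card_lt_card
  refine ⟨fun i hi => ?_, fun h => ?_⟩
  · simp_all
  · simpa using h (show k ∈ _ by simp)

lemma exists_earlier_eq {n : ℕ} {z : Fin n → ℝ} {a : ℝ} {j : ℕ} (hj : j < mult z a) :
    ∃ k, z k = a ∧ earlier z k = j := by
  have key := Finset.surjOn_of_injOn_of_card_le (s := Finset.univ.filter fun k => z k = a)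
    (t := Finset.range (mult z a)) (earlier z) ?_ ?_ (by simp [mult])
  · obtain ⟨k, hk, h⟩ := key (by simpa using hj : j ∈ _)
    exact ⟨k, by simpa using hk, h⟩
  · intro k hk
    have hk : z k = a := by simpa using hk
    simpa [hk] using earlier_lt_mult z k
  · intro k hk l hl h
    have hk : z k = a := by simpa using hk
    have hl : z l = a := by simpa using hl
    have aux : ∀ k l : Fin n, z k = a → z l = a → k < l → earlier z k < earlier z l := by
      intro k l hk hl hkl
      apply Finset.card_lt_card
      refine ⟨fun i hi => ?_, fun h => ?_⟩
      · simp only [Finset.mem_filter, Finset.mem_univ, true_and] at hi ⊢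
        exact ⟨hi.1.trans hkl, by rw [hi.2, hk, hl]⟩
      · simpa using h (show k ∈ _ by simp [hkl, hk, hl])
    rcases lt_trichotomy k l with h' | h' | h'
    · exact absurd h (aux k l hk hl h').ne
    · exact h'
    · exact absurd h.symm (aux l k hl hk h').ne

/-- The number of entries of `z` below `a`. -/
def numBelow {n : ℕ} (z : Fin n → ℝ) (a : ℝ) : ℕ := (Finset.univ.filter fun k => z k < a).card

lemma numBelow_eq_sum {n : ℕ} (z : Fin n → ℝ) (a : ℝ) :
    numBelow z a = ∑ k, if z k < a then 1 else 0 := Finset.card_filter _ _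

lemma numBelow_insertNth {n : ℕ} (z : Fin n → ℝ) (p : Fin (n + 1)) (x a : ℝ) :
    numBelow (p.insertNth x z : Fin (n + 1) → ℝ) a = (if x < a then 1 else 0) + numBelow z a := by
  simp [numBelow_eq_sum, Fin.sum_univ_succAbove _ p]

/-- The position at which `a` has to be inserted into the nondecreasing sequence `z`: before all
entries `≥ a`. -/
def insertPos {n : ℕ} (z : Fin n → ℝ) (a : ℝ) : Fin (n + 1) :=
  ⟨numBelow z a, Nat.lt_succ_of_le ((Finset.card_filter_le _ _).trans (by simp))⟩

lemma castSucc_lt_insertPos {n : ℕ} {z : Fin n → ℝ} (hz : Monotone z) (a : ℝ) (i : Fin n) :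
    i.castSucc < insertPos z a ↔ z i < a :=
  Tuple.lt_card_lt_iff_apply_lt_of_monotone (j := i) (a := a) hz

lemma monotone_insertNth {n : ℕ} {z : Fin n → ℝ} (hz : Monotone z) {a : ℝ} {p : Fin (n + 1)}
    (h₁ : ∀ i : Fin n, i.castSucc < p → z i ≤ a) (h₂ : ∀ i : Fin n, p ≤ i.castSucc → a ≤ z i) :
    Monotone (p.insertNth a z : Fin (n + 1) → ℝ) := by
  intro i j hij
  induction i using Fin.succAboveCases p with
  | x =>
    induction j using Fin.succAboveCases p with
    | x => simp
    | p j =>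
      rw [Fin.insertNth_apply_same, Fin.insertNth_apply_succAbove]
      rcases lt_or_ge j.castSucc p with h | h
      · rw [Fin.succAbove_of_castSucc_lt _ _ h] at hij
        exact absurd hij (not_le.2 h)
      · exact h₂ j h
  | p i =>
    induction j using Fin.succAboveCases p with
    | x =>
      rw [Fin.insertNth_apply_same, Fin.insertNth_apply_succAbove]
      rcases lt_or_ge i.castSucc p with h | h
      · exact h₁ i h
      · rw [Fin.succAbove_of_le_castSucc _ _ h] at hij
        exact absurd (Fin.castSucc_lt_succ.trans_le hij) (not_lt.2 h)
    | p j =>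
      rw [Fin.insertNth_apply_succAbove, Fin.insertNth_apply_succAbove]
      exact hz ((Fin.succAbove_le_succAbove_iff).1 hij)

lemma monotone_insertPos {n : ℕ} {z : Fin n → ℝ} (hz : Monotone z) (a : ℝ) :
    Monotone ((insertPos z a).insertNth a z : Fin (n + 1) → ℝ) :=
  monotone_insertNth hz (fun i hi => ((castSucc_lt_insertPos hz a i).1 hi).le)
    fun i hi => not_lt.1 fun h => not_lt.2 hi ((castSucc_lt_insertPos hz a i).2 h)

lemma earlier_insertPos_same {n : ℕ} {z : Fin n → ℝ} (hz : Monotone z) (a : ℝ) :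
    earlier ((insertPos z a).insertNth a z : Fin (n + 1) → ℝ) (insertPos z a) = 0 := by
  rw [earlier_eq_sum, Fin.sum_univ_succAbove _ (insertPos z a)]
  simp only [lt_self_iff_false, false_and, if_false, Fin.insertNth_apply_succAbove,
    Fin.insertNth_apply_same, zero_add, Finset.sum_eq_zero_iff, Finset.mem_univ, true_implies]
  intro i
  rw [if_neg]
  rintro ⟨h, h'⟩
  rw [Fin.succAbove_lt_iff_castSucc_lt, castSucc_lt_insertPos hz] at h
  exact h.ne h'

lemma earlier_insertPos_succAbove {n : ℕ} {z : Fin n → ℝ} (hz : Monotone z) (a : ℝ) (i : Fin n) :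
    earlier ((insertPos z a).insertNth a z : Fin (n + 1) → ℝ) ((insertPos z a).succAbove i)
      = earlier z i + if z i = a then 1 else 0 := by
  rw [earlier_eq_sum, Fin.sum_univ_succAbove _ (insertPos z a), earlier_eq_sum, add_comm]
  simp only [Fin.insertNth_apply_succAbove, Fin.insertNth_apply_same,
    Fin.succAbove_lt_succAbove_iff]
  congr 1
  refine if_congr ⟨fun h => h.2.symm, fun h => ⟨?_, h.symm⟩⟩ rfl rfl
  rw [Fin.lt_succAbove_iff_le_castSucc]
  exact not_lt.1 fun h' => ((castSucc_lt_insertPos hz a i).1 h').ne h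

/-- Two nondecreasing sequences with the same multiplicities are equal. -/
lemma eq_of_mult_eq {n : ℕ} {s t : Fin n → ℝ} (hs : Monotone s) (ht : Monotone t)
    (h : ∀ a, mult s a = mult t a) : s = t := by
  have count : ∀ (s : Fin n → ℝ) (a : ℝ), (List.ofFn s).count a = mult s a := by
    intro s a
    rw [mult, List.ofFn_eq_map, ← Multiset.coe_count, ← Multiset.map_coe, Multiset.count_map]
    change Multiset.card _ = Multiset.card _
    congr 1
    exact Multiset.filter_congr fun k _ => eq_comm
  apply List.ofFn_injective
  refine List.Perm.eq_of_sortedLE ?_ ?_ (List.perm_iff_count.2 fun a => by rw [count, count, h])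
  · exact hs.sortedLE_ofFn
  · exact ht.sortedLE_ofFn

/-- A finite multiset of reals can be listed as a nondecreasing sequence. -/
lemma exists_monotone_mult_eq {n : ℕ} (M : Multiset ℝ) (hM : M.card = n) :
    ∃ t : Fin n → ℝ, Monotone t ∧ ∀ a, mult t a = M.count a := by
  subst hM
  induction M using Multiset.induction with
  | empty => exact ⟨fun _ => 0, monotone_const, fun a => rfl⟩
  | cons x M ih =>
    obtain ⟨t, ht, h⟩ := ih
    rw [Multiset.card_cons]
    refine ⟨_, monotone_insertPos ht x, fun a => ?_⟩
    rw [mult_insertNth, h, Multiset.count_cons, add_comm]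
    simp [eq_comm]

lemma sum_mult {n : ℕ} (z : Fin n → ℝ) {S : Finset ℝ} (hS : ∀ k, z k ∈ S) :
    ∑ a ∈ S, mult z a = n := by
  have := Finset.card_eq_sum_card_fiberwise (f := z) (s := Finset.univ) (t := S)
    (fun k _ => hS k)
  simpa [mult] using this.symm

/-! ### Doubled sequences -/

/-- The sequence `t_1, t_1, t_2, t_2, …`. -/
def dbl {m : ℕ} (t : Fin m → ℝ) : Fin (2 * m) → ℝ := fun i => t ⟨i / 2, by omega⟩

lemma monotone_dbl {m : ℕ} {t : Fin m → ℝ} (ht : Monotone t) : Monotone (dbl t) :=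
  fun i j h => ht (by simp only [Fin.le_def] at h ⊢; omega)

@[to_additive]
lemma prod_dbl {m : ℕ} {M : Type*} [CommMonoid M] (f : Fin (2 * m) → M) :
    ∏ i, f i = ∏ k : Fin m, (f ⟨2 * k, by omega⟩ * f ⟨2 * k + 1, by omega⟩) := by
  induction m with
  | zero => rfl
  | succ m ih =>
    have h : ∏ i, f i = f ⟨0, by omega⟩ * (f ⟨1, by omega⟩ *
        ∏ i : Fin (2 * m), f ⟨i + 2, by omega⟩) := by
      rw [show (∏ i, f i) = ∏ i : Fin (2 * m + 2), f i from rfl, Fin.prod_univ_succ,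
        Fin.prod_univ_succ]
      rfl
    rw [h, ih, Fin.prod_univ_succ, ← mul_assoc]
    congr 1

lemma dbl_even {m : ℕ} (t : Fin m → ℝ) (k : Fin m) (h : 2 * (k : ℕ) < 2 * m) :
    dbl t ⟨2 * k, h⟩ = t k := by
  unfold dbl; congr 1; ext; simp

lemma dbl_odd {m : ℕ} (t : Fin m → ℝ) (k : Fin m) (h : 2 * (k : ℕ) + 1 < 2 * m) :
    dbl t ⟨2 * k + 1, h⟩ = t k := by
  unfold dbl; congr 1; ext; simp; omega

lemma mult_dbl {m : ℕ} (t : Fin m → ℝ) (a : ℝ) : mult (dbl t) a = 2 * mult t a := by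
  rw [mult_eq_sum, sum_dbl, mult_eq_sum, Finset.mul_sum]
  refine Finset.sum_congr rfl fun k _ => ?_
  rw [dbl_even, dbl_odd, two_mul]

lemma numBelow_dbl {m : ℕ} (t : Fin m → ℝ) (a : ℝ) : numBelow (dbl t) a = 2 * numBelow t a := by
  rw [numBelow_eq_sum, sum_dbl, numBelow_eq_sum, Finset.mul_sum]
  refine Finset.sum_congr rfl fun k _ => ?_
  rw [dbl_even, dbl_odd, two_mul]

lemma earlier_dbl_even {m : ℕ} (t : Fin m → ℝ) (k : Fin m) (h : 2 * (k : ℕ) < 2 * m) :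
    earlier (dbl t) ⟨2 * k, h⟩ = 2 * earlier t k := by
  rw [earlier_eq_sum, sum_dbl, earlier_eq_sum, Finset.mul_sum]
  refine Finset.sum_congr rfl fun i _ => ?_
  rw [dbl_even, dbl_odd, dbl_even]
  simp only [Fin.lt_def]
  refine Eq.trans ?_ (two_mul _).symm
  congr 1
  · exact if_congr (and_congr_left fun _ => by omega) rfl rfl
  · exact if_congr (and_congr_left fun _ => by omega) rfl rfl

lemma earlier_dbl_odd {m : ℕ} (t : Fin m → ℝ) (k : Fin m) (h : 2 * (k : ℕ) + 1 < 2 * m) :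
    earlier (dbl t) ⟨2 * k + 1, h⟩ = 2 * earlier t k + 1 := by
  rw [earlier_eq_sum, sum_dbl, earlier_eq_sum, Finset.mul_sum,
    ← Finset.sum_erase_add _ _ (Finset.mem_univ k),
    ← Finset.sum_erase_add (f := fun i => 2 * _) _ (Finset.mem_univ k), add_assoc]
  congr 1
  · refine Finset.sum_congr rfl fun i hi => ?_
    have hi : (i : ℕ) ≠ k := fun h => (Finset.mem_erase.1 hi).1 (Fin.ext h)
    rw [dbl_even, dbl_odd, dbl_odd]
    simp only [Fin.lt_def]
    refine Eq.trans ?_ (two_mul _).symm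
    congr 1
    · exact if_congr (and_congr_left fun _ => by omega) rfl rfl
    · exact if_congr (and_congr_left fun _ => by omega) rfl rfl
  · simp [dbl_even, dbl_odd]

/-! ### Chains of generalized derivatives -/

/-- A sequence of functions on `[0, ∞)`, each of which has the sign of the derivative of the
preceding one on `(0, ∞)`. The positive factor is arbitrary, so that derivatives may be rescaled
to be continuous at `0`. -/
def IsChain (F : ℕ → ℝ → ℝ) : Prop :=
  (∀ j, ContinuousOn (F j) (Ici 0)) ∧
    ∀ j t, 0 < t → ∃ w, 0 < w ∧ HasDerivAt (F j) (w * F (j + 1) t) t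

/-- At every point `a` the functions `F 0, …, F (ω - 1)` vanish, `ω` being the multiplicity of `a`
in `z`: the first function has the zeros `z`, counted with multiplicity. -/
def VanishesAt {n : ℕ} (F : ℕ → ℝ → ℝ) (z : Fin n → ℝ) : Prop :=
  ∀ a j, j < mult z a → F j a = 0

lemma IsChain.shift {F : ℕ → ℝ → ℝ} (hF : IsChain F) : IsChain fun j => F (j + 1) :=
  ⟨fun j => hF.1 (j + 1), fun j => hF.2 (j + 1)⟩

lemma IsChain.neg {F : ℕ → ℝ → ℝ} (hF : IsChain F) : IsChain fun j t => -F j t := by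
  refine ⟨fun j => (hF.1 j).neg, fun j t ht => ?_⟩
  obtain ⟨w, hw, h⟩ := hF.2 j t ht
  exact ⟨w, hw, by rw [mul_neg]; exact h.neg⟩

lemma IsChain.strictMonoOn {F : ℕ → ℝ → ℝ} (hF : IsChain F) {j : ℕ} {a b : ℝ} (ha : 0 ≤ a)
    (h : ∀ t ∈ Ioo a b, 0 < F (j + 1) t) : StrictMonoOn (F j) (Icc a b) := by
  apply strictMonoOn_of_deriv_pos (convex_Icc a b)
  · exact (hF.1 j).mono fun t ht => ha.trans ht.1
  · intro t ht
    rw [interior_Icc] at ht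
    obtain ⟨w, hw, hd⟩ := hF.2 j t (ha.trans_lt ht.1)
    rw [hd.deriv]
    exact mul_pos hw (h t ht)

lemma mult_of_interlacing {n : ℕ} {z : Fin (n + 1) → ℝ} (hz : Monotone z) {w : Fin n → ℝ}
    (hw : ∀ k, z k.castSucc ≤ w k ∧ w k ≤ z k.succ)
    (hs : ∀ k, z k.castSucc < z k.succ → z k.castSucc < w k ∧ w k < z k.succ) {a : ℝ}
    (ha : 0 < mult z a) : mult w a + 1 = mult z a := by
  obtain ⟨i₀, hi₀, hmin⟩ := Finset.exists_min_image (Finset.univ.filter fun k => z k = a) id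
    (Finset.card_pos.1 ha)
  simp only [Finset.mem_filter, Finset.mem_univ, true_and, id] at hi₀ hmin
  have key : (Finset.univ.filter fun k => w k = a).map (Fin.succEmb n) =
      (Finset.univ.filter fun k => z k = a).erase i₀ := by
    ext i
    simp only [Finset.mem_map, Finset.mem_filter, Finset.mem_univ, true_and, Finset.mem_erase,
      Fin.coe_succEmb]
    constructor
    · rintro ⟨k, hk, rfl⟩
      have heq : z k.castSucc = z k.succ := by
        by_contra hne
        have h := hs k (lt_of_le_of_ne (hz Fin.castSucc_lt_succ.le) hne)
        rcases le_or_gt i₀ k.castSucc with h' | h'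
        · linarith [hz h', h.1]
        · linarith [hz (Fin.castSucc_lt_iff_succ_le.1 h'), h.2]
      have hka : z k.castSucc = a := by linarith [(hw k).1, (hw k).2]
      exact ⟨((hmin _ hka).trans_lt Fin.castSucc_lt_succ).ne', by rw [← heq, hka]⟩
    · rintro ⟨hne, hi⟩
      have hlt : i₀ < i := lt_of_le_of_ne (hmin i hi) (Ne.symm hne)
      obtain ⟨k, rfl⟩ := Fin.exists_succ_eq.2 (Fin.ne_zero_of_lt hlt)
      refine ⟨k, le_antisymm ((hw k).2.trans hi.le) ?_, rfl⟩
      rw [← hi₀]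
      exact (hz (Fin.le_castSucc_iff.2 hlt)).trans (hw k).1
  have hc := congrArg Finset.card key
  rw [Finset.card_map, Finset.card_erase_of_mem (by simpa using hi₀)] at hc
  change mult w a = mult z a - 1 at hc
  omega

/-- Rolle's theorem with multiplicities. -/
lemma IsChain.exists_interlacing {F : ℕ → ℝ → ℝ} (hF : IsChain F) {n : ℕ} {z : Fin (n + 1) → ℝ}
    (hz : Monotone z) (h0 : ∀ k, 0 ≤ z k) (hv : VanishesAt F z) :
    ∃ w : Fin n → ℝ, Monotone w ∧ (∀ k, z k.castSucc ≤ w k ∧ w k ≤ z k.succ) ∧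
      (∀ k, z k.castSucc < z k.succ → z k.castSucc < w k ∧ w k < z k.succ) ∧
      VanishesAt (fun j => F (j + 1)) w := by
  have key : ∀ k : Fin n, ∃ x, (z k.castSucc ≤ x ∧ x ≤ z k.succ) ∧
      (z k.castSucc < z k.succ → (z k.castSucc < x ∧ x < z k.succ) ∧ F 1 x = 0) := by
    intro k
    have hle : z k.castSucc ≤ z k.succ := hz Fin.castSucc_lt_succ.le
    rcases hle.eq_or_lt with h | h
    · exact ⟨z k.castSucc, ⟨le_rfl, hle⟩, fun h' => absurd h h'.ne⟩
    · obtain ⟨x, hx, hd⟩ := exists_deriv_eq_zero h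
        ((hF.1 0).mono fun t ht => (h0 _).trans ht.1)
        ((hv _ 0 (mult_pos_iff.2 ⟨_, rfl⟩)).trans (hv _ 0 (mult_pos_iff.2 ⟨_, rfl⟩)).symm)
      obtain ⟨w, hw, h1⟩ := hF.2 0 x ((h0 _).trans_lt hx.1)
      rw [h1.deriv] at hd
      exact ⟨x, ⟨hx.1.le, hx.2.le⟩, fun _ => ⟨hx, (mul_eq_zero.1 hd).resolve_left hw.ne'⟩⟩
  choose w hw hs using key
  refine ⟨w, ?_, hw, fun k hk => (hs k hk).1, ?_⟩
  · intro k l hkl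
    rcases hkl.eq_or_lt with rfl | hkl
    · exact le_rfl
    · exact (hw k).2.trans ((hz (Fin.succ_le_castSucc_iff.2 hkl)).trans (hw l).1)
  · intro a j hj
    rcases Nat.eq_zero_or_pos (mult z a) with h | h
    · obtain ⟨k, rfl⟩ := mult_pos_iff.1 ((Nat.zero_le j).trans_lt hj)
      have hnot : ∀ i, z i ≠ w k := fun i hi => (mult_pos_iff.2 ⟨i, hi⟩).ne' h
      have hlt : ∀ l, w l = w k → z l.castSucc < z l.succ := by
        intro l hl
        refine lt_of_le_of_ne (hz Fin.castSucc_lt_succ.le) fun he => hnot l.succ ?_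
        linarith [(hw l).1, (hw l).2]
      have hone : ∀ l, w l = w k → l = k := by
        have aux : ∀ l l', w l = w k → w l' = w k → ¬ l < l' := by
          intro l l' hl hl' hlt'
          have h1 := (hs l (hlt l hl)).1.2
          have h2 := hz (Fin.succ_le_castSucc_iff.2 hlt')
          linarith [(hw l').1]
        intro l hl
        exact le_antisymm (not_lt.1 (aux k l rfl hl)) (not_lt.1 (aux l k hl rfl))
      have : mult w (w k) ≤ 1 := Finset.card_le_one.2 fun x hx y hy => by
        rw [hone x (by simpa using hx), hone y (by simpa using hy)]
      obtain rfl : j = 0 := by omega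
      exact (hs k (hlt k rfl)).2
    · have := mult_of_interlacing hz hw (fun k hk => (hs k hk).1) h
      exact hv a (j + 1) (by omega)

/-- If the `n`-th function of a chain is positive and the first one has `n` zeros, counted with
multiplicity, then it is positive behind the last zero, where the first nonvanishing function of
the chain is positive too. -/
lemma IsChain.pos {n : ℕ} : ∀ {F : ℕ → ℝ → ℝ}, IsChain F → (∀ t, 0 ≤ t → 0 < F n t) →
    ∀ {z : Fin n → ℝ}, Monotone z → (∀ k, 0 ≤ z k) → VanishesAt F z →
    ∀ t, 0 ≤ t → (∀ k, z k ≤ t) → 0 < F (mult z t) t := by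
  induction n with
  | zero => intro F _ hn z _ _ _ t ht _; exact hn t ht
  | succ n ih =>
    intro F hF hn z hz h0 hv t ht hzt
    obtain ⟨w, hwm, hw, hs, hwv⟩ := hF.exists_interlacing hz h0 hv
    have hw0 : ∀ k, 0 ≤ w k := fun k => (h0 _).trans (hw k).1
    have key := ih hF.shift hn hwm hw0 hwv
    rcases Nat.eq_zero_or_pos (mult z t) with h | h
    · have hlast : z (Fin.last n) < t := lt_of_le_of_ne (hzt _) fun he =>
        (mult_pos_iff.2 ⟨_, he⟩).ne' h
      have hwl : ∀ k, w k ≤ z (Fin.last n) := fun k => (hw k).2.trans (hz (Fin.le_last _))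
      have hmono := hF.strictMonoOn (j := 0) (h0 (Fin.last n)) (b := t) fun s hs => by
        have := key s ((h0 _).trans hs.1.le) fun k => (hwl k).trans hs.1.le
        rwa [show mult w s = 0 from Nat.eq_zero_of_not_pos fun hp => by
          obtain ⟨k, hk⟩ := mult_pos_iff.1 hp
          linarith [hwl k, hs.1]] at this
      rw [h, ← hv (z (Fin.last n)) 0 (mult_pos_iff.2 ⟨_, rfl⟩)]
      exact hmono ⟨le_rfl, hlast.le⟩ ⟨hlast.le, le_rfl⟩ hlast
    · rw [← mult_of_interlacing hz hw hs h]
      exact key t ht fun k => (hw k).2.trans (hzt _)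

/-- Zeros of convergent chains converge to zeros, with multiplicities. -/
lemma VanishesAt.of_tendsto {α : Type*} {U : Ultrafilter α} {n : ℕ} :
    ∀ {F : α → ℕ → ℝ → ℝ} {F₀ : ℕ → ℝ → ℝ}, (∀ s, IsChain (F s)) →
    (∀ j (p : α → ℝ) p₀, (∀ᶠ s in U, 0 ≤ p s) → Tendsto p U (𝓝 p₀) →
      Tendsto (fun s => F s j (p s)) U (𝓝 (F₀ j p₀))) →
    ∀ {z : α → Fin n → ℝ} {z₀ : Fin n → ℝ},
    (∀ᶠ s in U, Monotone (z s) ∧ (∀ k, 0 ≤ z s k) ∧ VanishesAt (F s) (z s)) →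
    Tendsto z U (𝓝 z₀) → VanishesAt F₀ z₀ := by
  induction n with
  | zero => intro F F₀ _ _ z z₀ _ _ a j hj; simp [mult] at hj
  | succ n ih =>
    intro F F₀ hF hlim z z₀ hz hzt a j hj
    have hzk : ∀ k, Tendsto (fun s => z s k) U (𝓝 (z₀ k)) := tendsto_pi_nhds.1 hzt
    cases j with
    | zero =>
      obtain ⟨k, rfl⟩ := mult_pos_iff.1 hj
      have h1 := hlim 0 (fun s => z s k) _ (hz.mono fun s hs => hs.2.1 k) (hzk k)
      refine tendsto_nhds_unique (h1.congr' (hz.mono fun s hs => ?_)) tendsto_const_nhds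
      exact hs.2.2 _ 0 (mult_pos_iff.2 ⟨k, rfl⟩)
    | succ j =>
      obtain ⟨w, hw⟩ := (hz.mono fun s hs =>
        (hF s).exists_interlacing hs.1 hs.2.1 hs.2.2).choice
      have hlimw : ∀ k, ∃ x, Tendsto (fun s => w s k) U (𝓝 x) := by
        intro k
        have hmem : ∀ᶠ s in (U : Filter α), w s k ∈ Icc (z₀ k.castSucc - 1) (z₀ k.succ + 1) := by
          filter_upwards [hw, (hzk k.castSucc).eventually (lt_mem_nhds (sub_one_lt _)),
            (hzk k.succ).eventually (gt_mem_nhds (lt_add_one _))] with s hs h1 h2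
          exact ⟨h1.le.trans (hs.2.1 k).1, (hs.2.1 k).2.trans h2.le⟩
        obtain ⟨x, _, hx⟩ := (isCompact_Icc (a := z₀ k.castSucc - 1)
          (b := z₀ k.succ + 1)).ultrafilter_le_nhds (U.map fun s => w s k)
          (le_principal_iff.2 hmem)
        exact ⟨x, hx⟩
      choose w₀ hw₀ using hlimw
      have hvan : VanishesAt (fun j => F₀ (j + 1)) w₀ := by
        refine ih (F := fun s j => F s (j + 1)) (fun s => (hF s).shift) (fun j => hlim (j + 1))
          (z := w) ?_ (tendsto_pi_nhds.2 hw₀)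
        filter_upwards [hw, hz] with s hs hs'
        exact ⟨hs.1, fun k => (hs'.2.1 _).trans (hs.2.1 k).1, hs.2.2.2⟩
      have hz₀ : Monotone z₀ := fun k l hkl =>
        le_of_tendsto_of_tendsto (hzk k) (hzk l) (hz.mono fun s hs => hs.1 hkl)
      refine hvan a j ?_
      -- a gap of length `0` of `z₀` contains the limit of the interlacing point
      obtain ⟨i₀, hi₀, hmin⟩ := Finset.exists_min_image (Finset.univ.filter fun k => z₀ k = a) id
        (Finset.card_pos.1 ((Nat.zero_le _).trans_lt hj))
      simp only [Finset.mem_filter, Finset.mem_univ, true_and, id] at hi₀ hmin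
      have hsub : (Finset.univ.filter fun k => z₀ k = a).erase i₀ ⊆
          (Finset.univ.filter fun k => w₀ k = a).map (Fin.succEmb n) := by
        intro i hi
        simp only [Finset.mem_map, Finset.mem_filter, Finset.mem_univ, true_and, Finset.mem_erase,
          Fin.coe_succEmb] at hi ⊢
        have hlt : i₀ < i := lt_of_le_of_ne (hmin i hi.2) (Ne.symm hi.1)
        obtain ⟨k, rfl⟩ := Fin.exists_succ_eq.2 (Fin.ne_zero_of_lt hlt)
        have h1 : z₀ k.castSucc ≤ w₀ k :=
          le_of_tendsto_of_tendsto (hzk _) (hw₀ k) (hw.mono fun s hs => (hs.2.1 k).1)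
        have h2 : w₀ k ≤ z₀ k.succ :=
          le_of_tendsto_of_tendsto (hw₀ k) (hzk _) (hw.mono fun s hs => (hs.2.1 k).2)
        refine ⟨k, le_antisymm (h2.trans hi.2.le) ?_, rfl⟩
        rw [← hi₀]
        exact (hz₀ (Fin.le_castSucc_iff.2 hlt)).trans h1
      have hc := Finset.card_le_card hsub
      rw [Finset.card_map, Finset.card_erase_of_mem (by simpa using hi₀)] at hc
      change mult z₀ a - 1 ≤ mult w₀ a at hc
      omega

/-! ### Signs near a zero -/

lemma IsChain.eventually_pos_right {j : ℕ} : ∀ {F : ℕ → ℝ → ℝ}, IsChain F → ∀ {a : ℝ}, 0 ≤ a →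
    (∀ i < j, F i a = 0) → 0 < F j a → ∀ᶠ t in 𝓝[>] a, 0 < F 0 t := by
  induction j with
  | zero =>
    intro F hF a ha _ hpos
    have h := ((hF.1 0) a ha).eventually (lt_mem_nhds hpos)
    exact h.filter_mono (nhdsWithin_mono _ fun t ht => ha.trans (le_of_lt ht))
  | succ j ih =>
    intro F hF a ha h0 hpos
    have h := ih hF.shift ha (fun i hi => h0 (i + 1) (by omega)) hpos
    obtain ⟨b, hb, hab⟩ := mem_nhdsGT_iff_exists_Ioo_subset.1 h
    have hmono := hF.strictMonoOn (j := 0) (b := b) ha fun t ht => hab ht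
    filter_upwards [Ioo_mem_nhdsGT (show a < b from hb)] with t ht
    rw [← h0 0 (by omega)]
    exact hmono ⟨le_rfl, le_of_lt hb⟩ ⟨ht.1.le, ht.2.le⟩ ht.1

lemma IsChain.eventually_pos_left {j : ℕ} : ∀ {F : ℕ → ℝ → ℝ}, IsChain F → ∀ {a : ℝ}, 0 < a →
    (∀ i < j, F i a = 0) → 0 < (-1) ^ j * F j a → ∀ᶠ t in 𝓝[<] a, 0 < F 0 t := by
  induction j with
  | zero =>
    intro F hF a ha _ hpos
    have hc : ContinuousAt (F 0) a := (hF.1 0).continuousAt (Ici_mem_nhds ha)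
    exact (hc.eventually (lt_mem_nhds (by simpa using hpos))).filter_mono nhdsWithin_le_nhds
  | succ j ih =>
    intro F hF a ha h0 hpos
    have h := ih hF.shift.neg ha (fun i hi => by simp [h0 (i + 1) (by omega)])
      (by rw [pow_succ] at hpos; linarith)
    obtain ⟨b, hb, hab⟩ := mem_nhdsLT_iff_exists_Ioo_subset.1
      (inter_mem h (Ioo_mem_nhdsLT ha))
    have hb0 : 0 ≤ b := by
      by_contra hneg
      have := (hab (⟨not_le.1 hneg, ha⟩ : (0 : ℝ) ∈ Ioo b a)).2.1
      exact lt_irrefl _ this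
    have hmono := hF.neg.strictMonoOn (j := 0) (b := a) hb0 fun t ht => (hab ht).1
    filter_upwards [Ioo_mem_nhdsLT (show b < a from hb)] with t ht
    have := hmono ⟨ht.1.le, ht.2.le⟩ ⟨le_of_lt hb, le_rfl⟩ ht.2
    simp only [h0 0 (by omega)] at this
    linarith

/-- At a point `a` of `[0,1]` before which all functions of index `< j` vanish, the function `F j`
has the sign that makes `F 0` positive on both sides of `a` in `[0,1]`. -/
def PosSign (F : ℕ → ℝ → ℝ) (j : ℕ) (a : ℝ) : Prop :=
  (a < 1 → 0 < F j a) ∧ (0 < a → 0 < (-1) ^ j * F j a)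

lemma IsChain.nonneg_right {F : ℕ → ℝ → ℝ} (hF : IsChain F) {a : ℝ} {j : ℕ} (ha : 0 ≤ a)
    (ha1 : a < 1) (h0 : ∀ i < j, F i a = 0) (hnn : ∀ t ∈ Icc (0 : ℝ) 1, 0 ≤ F 0 t) :
    0 ≤ F j a := by
  by_contra hneg
  have h := hF.neg.eventually_pos_right ha (fun i hi => by simp [h0 i hi]) (j := j)
    (by linarith)
  obtain ⟨t, ht, ht'⟩ := (h.and (Ioo_mem_nhdsGT ha1)).exists
  linarith [hnn t ⟨ha.trans ht'.1.le, ht'.2.le⟩]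

lemma IsChain.nonneg_left {F : ℕ → ℝ → ℝ} (hF : IsChain F) {a : ℝ} {j : ℕ} (ha : 0 < a)
    (ha1 : a ≤ 1) (h0 : ∀ i < j, F i a = 0) (hnn : ∀ t ∈ Icc (0 : ℝ) 1, 0 ≤ F 0 t) :
    0 ≤ (-1) ^ j * F j a := by
  by_contra hneg
  have h := hF.neg.eventually_pos_left ha (fun i hi => by simp [h0 i hi]) (j := j)
    (by linarith)
  obtain ⟨t, ht, ht'⟩ := (h.and (Ioo_mem_nhdsLT ha)).exists
  linarith [hnn t ⟨ht'.1.le, ht'.2.le.trans ha1⟩]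

lemma IsChain.posSign {F : ℕ → ℝ → ℝ} (hF : IsChain F) {a : ℝ} {j : ℕ} (ha : a ∈ Icc (0 : ℝ) 1)
    (h0 : ∀ i < j, F i a = 0) (hj : F j a ≠ 0) (hnn : ∀ t ∈ Icc (0 : ℝ) 1, 0 ≤ F 0 t) :
    PosSign F j a :=
  ⟨fun h => lt_of_le_of_ne (hF.nonneg_right ha.1 h h0 hnn) hj.symm, fun h =>
    lt_of_le_of_ne (hF.nonneg_left h ha.2 h0 hnn)
      (mul_ne_zero (pow_ne_zero _ (by norm_num)) hj).symm⟩

lemma PosSign.eventually_nonneg {F : ℕ → ℝ → ℝ} (hF : IsChain F) {a : ℝ} {j : ℕ}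
    (ha : a ∈ Icc (0 : ℝ) 1) (h0 : ∀ i < j, F i a = 0) (h : PosSign F j a) :
    ∀ᶠ t in 𝓝[Icc 0 1] a, 0 ≤ F 0 t := by
  have ha0 : 0 ≤ F 0 a := by
    rcases Nat.eq_zero_or_pos j with rfl | hj
    · rcases ha.1.eq_or_lt with h' | h'
      · exact (h.1 (by linarith)).le
      · simpa using (h.2 h').le
    · exact (h0 0 hj).ge
  have hr : ∀ᶠ t in 𝓝[>] a, t ∈ Icc (0 : ℝ) 1 → 0 ≤ F 0 t := by
    rcases ha.2.eq_or_lt with h' | h'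
    · filter_upwards [self_mem_nhdsWithin] with t ht ht'
      exact absurd ht'.2 (not_le.2 (h' ▸ ht))
    · exact (hF.eventually_pos_right ha.1 h0 (h.1 h')).mono fun t ht _ => ht.le
  have hl : ∀ᶠ t in 𝓝[<] a, t ∈ Icc (0 : ℝ) 1 → 0 ≤ F 0 t := by
    rcases ha.1.eq_or_lt with h' | h'
    · filter_upwards [self_mem_nhdsWithin] with t ht ht'
      exact absurd ht'.1 (not_le.2 (h' ▸ ht))
    · exact (hF.eventually_pos_left h' h0 (h.2 h')).mono fun t ht _ => ht.le
  rw [eventually_nhdsWithin_iff] at hr hl ⊢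
  filter_upwards [hr, hl] with t h1 h2 ht
  rcases lt_trichotomy t a with h' | h' | h'
  · exact h2 h' ht
  · rw [h']; exact ha0
  · exact h1 h' ht

lemma IsChain.even_of_nonneg {F : ℕ → ℝ → ℝ} (hF : IsChain F) {a : ℝ} {j : ℕ}
    (ha : a ∈ Ioo (0 : ℝ) 1) (h0 : ∀ i < j, F i a = 0) (hj : F j a ≠ 0)
    (hnn : ∀ t ∈ Icc (0 : ℝ) 1, 0 ≤ F 0 t) : Even j := by
  have h := hF.posSign ⟨ha.1.le, ha.2.le⟩ h0 hj hnn
  by_contra hodd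
  have h1 := h.1 ha.2
  have h2 := h.2 ha.1
  rw [(Nat.not_even_iff_odd.1 hodd).neg_one_pow] at h2
  linarith

/-! ### Generalized polynomials -/

/-- The `j`-th generalized derivative of `t ^ x` with respect to the exponents `μ`: the result of
`j` times differentiating and dividing by a power of `t`, chosen so that the derivative of
`t ^ μ j` becomes constant. It annihilates `t ^ μ 0, …, t ^ μ (j - 1)` and, unlike the ordinary
derivative, is continuous at `0` on the other powers. -/
def gpow (μ : ℕ → ℝ) (j : ℕ) (t x : ℝ) : ℝ := (∏ l ∈ Finset.range j, (x - μ l)) * t ^ (x - μ j)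

/-- The `j`-th generalized derivative of the generalized polynomial `∑ i, c i * t ^ μ i`. -/
def gder (μ : ℕ → ℝ) {n : ℕ} (c : Fin n → ℝ) (j : ℕ) (t : ℝ) : ℝ := ∑ i : Fin n, c i * gpow μ j t (μ i)

lemma gpow_of_lt {μ : ℕ → ℝ} {i j : ℕ} (h : i < j) (t : ℝ) : gpow μ j t (μ i) = 0 := by
  rw [gpow, Finset.prod_eq_zero (Finset.mem_range.2 h) (sub_self _), zero_mul]

lemma continuous_gpow {μ : ℕ → ℝ} (hμ : StrictMono μ) (j i : ℕ) :
    Continuous fun t => gpow μ j t (μ i) := by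
  rcases lt_or_ge i j with h | h
  · simpa only [gpow_of_lt h] using continuous_const
  · exact continuous_const.mul
      (continuous_id.rpow_const fun _ => Or.inr (sub_nonneg.2 (hμ.monotone h)))

lemma gpow_self {μ : ℕ → ℝ} (j : ℕ) (t : ℝ) :
    gpow μ j t (μ j) = ∏ l ∈ Finset.range j, (μ j - μ l) := by
  rw [gpow, sub_self, Real.rpow_zero, mul_one]

lemma prod_sub_pos {μ : ℕ → ℝ} (hμ : StrictMono μ) (j : ℕ) :
    0 < ∏ l ∈ Finset.range j, (μ j - μ l) :=
  Finset.prod_pos fun _ hl => sub_pos.2 (hμ (Finset.mem_range.1 hl))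

lemma hasDerivAt_gpow (μ : ℕ → ℝ) (j : ℕ) (x : ℝ) {t : ℝ} (ht : 0 < t) :
    HasDerivAt (fun t => gpow μ j t x) (t ^ (μ (j + 1) - μ j - 1) * gpow μ (j + 1) t x) t := by
  have h := (Real.hasDerivAt_rpow_const (x := t) (p := x - μ j) (Or.inl ht.ne')).const_mul
    (∏ l ∈ Finset.range j, (x - μ l))
  refine h.congr_deriv ?_
  rw [gpow, Finset.prod_range_succ, show x - μ j - 1 = (μ (j + 1) - μ j - 1) + (x - μ (j + 1)) by
    ring, Real.rpow_add ht]
  ring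

lemma isChain_gder {μ : ℕ → ℝ} (hμ : StrictMono μ) {n : ℕ} (c : Fin n → ℝ) :
    IsChain (gder μ c) := by
  refine ⟨fun j => Continuous.continuousOn ?_, fun j t ht => ⟨t ^ (μ (j + 1) - μ j - 1),
    Real.rpow_pos_of_pos ht _, ?_⟩⟩
  · exact continuous_finsetSum _ fun i _ => continuous_const.mul (continuous_gpow hμ j i)
  · have h := HasDerivAt.fun_sum fun (i : Fin n) (_ : i ∈ Finset.univ) =>
      (hasDerivAt_gpow μ j (μ i) ht).const_mul (c i)
    refine h.congr_deriv ?_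
    rw [gder, Finset.mul_sum]
    exact Finset.sum_congr rfl fun i _ => by ring

lemma tendsto_gder {μ : ℕ → ℝ} (hμ : StrictMono μ) {n : ℕ} {α : Type*} {l : Filter α}
    {c : α → Fin n → ℝ} {c₀ : Fin n → ℝ} (hc : Tendsto c l (𝓝 c₀)) (j : ℕ) {p : α → ℝ} {p₀ : ℝ}
    (hp : Tendsto p l (𝓝 p₀)) : Tendsto (fun s => gder μ (c s) j (p s)) l (𝓝 (gder μ c₀ j p₀)) :=
  tendsto_finsetSum _ fun i _ => (tendsto_pi_nhds.1 hc i).mul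
    (((continuous_gpow hμ j i).tendsto p₀).comp hp)

lemma gder_smul (μ : ℕ → ℝ) {n : ℕ} (k : ℝ) (c : Fin n → ℝ) (j : ℕ) (t : ℝ) :
    gder μ (k • c) j t = k * gder μ c j t := by
  simp only [gder, Finset.mul_sum, Pi.smul_apply, smul_eq_mul, mul_assoc]

lemma gder_add (μ : ℕ → ℝ) {n : ℕ} (c d : Fin n → ℝ) (j : ℕ) (t : ℝ) :
    gder μ (c + d) j t = gder μ c j t + gder μ d j t := by
  simp only [gder, Pi.add_apply, add_mul, Finset.sum_add_distrib]

lemma gder_sub (μ : ℕ → ℝ) {n : ℕ} (c d : Fin n → ℝ) (j : ℕ) (t : ℝ) :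
    gder μ (c - d) j t = gder μ c j t - gder μ d j t := by
  simp only [gder, Pi.sub_apply, sub_mul, Finset.sum_sub_distrib]

lemma gder_castSucc (μ : ℕ → ℝ) {n : ℕ} {c : Fin (n + 1) → ℝ} (h : c (Fin.last n) = 0) (j : ℕ)
    (t : ℝ) : gder μ c j t = gder μ (fun i : Fin n => c i.castSucc) j t := by
  simp [gder, Fin.sum_univ_castSucc, h]

lemma gder_top (μ : ℕ → ℝ) {n : ℕ} (c : Fin (n + 1) → ℝ) (t : ℝ) :
    gder μ c n t = c (Fin.last n) * ∏ l ∈ Finset.range n, (μ n - μ l) := by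
  rw [gder, Fin.sum_univ_castSucc, Finset.sum_eq_zero fun i _ => ?_, zero_add, Fin.val_last,
    gpow_self]
  rw [Fin.val_castSucc, gpow_of_lt i.2, mul_zero]

lemma VanishesAt.smul {μ : ℕ → ℝ} {n k : ℕ} {c : Fin n → ℝ} {z : Fin k → ℝ}
    (h : VanishesAt (gder μ c) z) (r : ℝ) : VanishesAt (gder μ (r • c)) z := fun a j hj => by
  rw [gder_smul, h a j hj, mul_zero]

lemma VanishesAt.sub {μ : ℕ → ℝ} {n k : ℕ} {c d : Fin n → ℝ} {z : Fin k → ℝ}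
    (hc : VanishesAt (gder μ c) z) (hd : VanishesAt (gder μ d) z) :
    VanishesAt (gder μ (c - d)) z := fun a j hj => by
  rw [gder_sub, hc a j hj, hd a j hj, sub_zero]

/-- The first nonvanishing generalized derivative behind `n` zeros has the sign of the leading
coefficient. -/
lemma gder_pos {μ : ℕ → ℝ} (hμ : StrictMono μ) {n : ℕ} {c : Fin (n + 1) → ℝ}
    (hc : 0 < c (Fin.last n)) {z : Fin n → ℝ} (hz : Monotone z) (h0 : ∀ k, 0 ≤ z k)
    (hv : VanishesAt (gder μ c) z) {t : ℝ} (ht : 0 ≤ t) (hzt : ∀ k, z k ≤ t) :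
    0 < gder μ c (mult z t) t :=
  (isChain_gder hμ c).pos (fun s _ => by
    rw [gder_top]; exact mul_pos hc (prod_sub_pos hμ n)) hz h0 hv t ht hzt

/-- A generalized polynomial with `n` terms and `n` zeros in `[0, ∞)` is zero. -/
lemma eq_zero_of_vanishesAt {μ : ℕ → ℝ} (hμ : StrictMono μ) {n : ℕ} : ∀ {c : Fin n → ℝ}
    {y : Fin n → ℝ}, Monotone y → (∀ k, 0 ≤ y k) → VanishesAt (gder μ c) y → c = 0 := by
  induction n with
  | zero => intro c _ _ _ _; exact Subsingleton.elim _ _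
  | succ n ih =>
    intro c y hy h0 hv
    have hy' : Monotone fun k : Fin n => y k.castSucc := fun i j h => hy h
    have hlast : c (Fin.last n) = 0 := by
      have aux : ∀ d : Fin (n + 1) → ℝ, VanishesAt (gder μ d) y → ¬ 0 < d (Fin.last n) := by
        intro d hd hpos
        have h := gder_pos hμ hpos hy' (fun k => h0 _)
          (fun a j hj => hd a j (hj.trans_le (by rw [mult_castSucc]; omega)))
          (h0 (Fin.last n)) (fun k => hy (Fin.le_last _))
        rw [hd _ _ (by rw [mult_castSucc y, if_pos rfl]; omega)] at h
        exact lt_irrefl _ h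
      refine le_antisymm (not_lt.1 (aux c hv)) (not_lt.1 fun h => ?_)
      refine aux ((-1 : ℝ) • c) (hv.smul _) ?_
      simpa using h
    have hzero := ih hy' (fun k => h0 _) (c := fun i => c i.castSucc) fun a j hj => by
      rw [← gder_castSucc μ hlast]
      exact hv a j (hj.trans_le (by rw [mult_castSucc y]; omega))
    funext i
    refine Fin.lastCases hlast (fun i => ?_) i
    exact congrFun hzero i

lemma last_ne_zero {μ : ℕ → ℝ} (hμ : StrictMono μ) {n : ℕ} {c : Fin (n + 1) → ℝ} {z : Fin n → ℝ}
    (hz : Monotone z) (h0 : ∀ k, 0 ≤ z k) (hc : c ≠ 0) (hv : VanishesAt (gder μ c) z) :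
    c (Fin.last n) ≠ 0 := by
  intro hlast
  have hzero := eq_zero_of_vanishesAt hμ hz h0 (c := fun i => c i.castSucc) fun a j hj => by
    rw [← gder_castSucc μ hlast]
    exact hv a j hj
  refine hc (funext fun i => ?_)
  refine Fin.lastCases hlast (fun i => ?_) i
  exact congrFun hzero i

/-- The maximal number of zeros determines a generalized polynomial up to a factor. -/
lemma exists_eq_smul {μ : ℕ → ℝ} (hμ : StrictMono μ) {n : ℕ} {c d : Fin (n + 1) → ℝ}
    {z : Fin n → ℝ} (hz : Monotone z) (h0 : ∀ k, 0 ≤ z k) (hc : c ≠ 0)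
    (hv : VanishesAt (gder μ c) z) (hd : VanishesAt (gder μ d) z) : ∃ r : ℝ, d = r • c := by
  have hne := last_ne_zero hμ hz h0 hc hv
  refine ⟨d (Fin.last n) / c (Fin.last n), ?_⟩
  by_contra h
  refine last_ne_zero hμ hz h0 (sub_ne_zero.2 h) (hd.sub (hv.smul _)) ?_
  simp [hne]

lemma gder_mult_ne_zero {μ : ℕ → ℝ} (hμ : StrictMono μ) {n : ℕ} {c : Fin (n + 1) → ℝ}
    {z : Fin n → ℝ} (hz : Monotone z) (h0 : ∀ k, 0 ≤ z k) (hc : c ≠ 0)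
    (hv : VanishesAt (gder μ c) z) {a : ℝ} (ha : 0 ≤ a) : gder μ c (mult z a) a ≠ 0 := by
  intro h
  refine hc (eq_zero_of_vanishesAt hμ (monotone_insertPos hz a) ?_ fun b j hj => ?_)
  · intro k
    induction k using Fin.succAboveCases (insertPos z a) with
    | x => simpa using ha
    | p k => simpa using h0 k
  · rw [mult_insertNth] at hj
    split_ifs at hj with hab
    · subst hab
      rcases Nat.lt_succ_iff_lt_or_eq.1 (by omega : j < mult z a + 1) with hj | rfl
      · exact hv a j hj
      · exact h
    · exact hv b j (by omega)

/-- On `[0,1]`, the zeros of a majorant of a nonnegative generalized polynomial are inherited,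
with multiplicities. -/
lemma vanishesAt_of_le {μ : ℕ → ℝ} (hμ : StrictMono μ) {n k : ℕ} {c d : Fin n → ℝ}
    {z : Fin k → ℝ} (hz : ∀ k, z k ∈ Icc (0 : ℝ) 1) (hd : VanishesAt (gder μ d) z)
    (hc : ∀ t ∈ Icc (0 : ℝ) 1, 0 ≤ gder μ c 0 t)
    (hcd : ∀ t ∈ Icc (0 : ℝ) 1, gder μ c 0 t ≤ gder μ d 0 t) : VanishesAt (gder μ c) z := by
  intro a j
  induction j using Nat.strong_induction_on with
  | _ j ih =>
    intro hj
    obtain ⟨i, rfl⟩ := mult_pos_iff.1 ((Nat.zero_le j).trans_lt hj)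
    have h0 : ∀ l < j, gder μ c l (z i) = 0 := fun l hl => ih l hl (hl.trans hj)
    have h0' : ∀ l < j, gder μ (d - c) l (z i) = 0 := fun l hl => by
      rw [gder_sub, h0 l hl, hd _ l (hl.trans hj), sub_zero]
    have hdc : ∀ t ∈ Icc (0 : ℝ) 1, 0 ≤ gder μ (d - c) 0 t := fun t ht => by
      rw [gder_sub]; exact sub_nonneg.2 (hcd t ht)
    have hsub : gder μ (d - c) j (z i) = - gder μ c j (z i) := by
      rw [gder_sub, hd _ j hj, zero_sub]
    rcases (hz i).2.lt_or_eq with h1 | h1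
    · have e1 := (isChain_gder hμ c).nonneg_right (hz i).1 h1 h0 hc
      have e2 := (isChain_gder hμ (d - c)).nonneg_right (hz i).1 h1 h0' hdc
      linarith
    · have hpos : 0 < z i := by rw [h1]; exact one_pos
      have e1 := (isChain_gder hμ c).nonneg_left hpos (hz i).2 h0 hc
      have e2 := (isChain_gder hμ (d - c)).nonneg_left hpos (hz i).2 h0' hdc
      rw [hsub] at e2
      have : (-1 : ℝ) ^ j * gder μ c j (z i) = 0 := by linarith
      exact (mul_eq_zero.1 this).resolve_left (pow_ne_zero _ (by norm_num))

/-- If `P ≥ 0` on `[0,1]` has exactly the zeros `z` and `Q` vanishes at `z`, both counted with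
multiplicity, then `|Q| ≤ C P` on `[0,1]`. -/
lemma exists_abs_le {μ : ℕ → ℝ} (hμ : StrictMono μ) {n k : ℕ} {c d : Fin n → ℝ} {z : Fin k → ℝ}
    (hc : VanishesAt (gder μ c) z) (hne : ∀ a ∈ Icc (0 : ℝ) 1, gder μ c (mult z a) a ≠ 0)
    (hnn : ∀ t ∈ Icc (0 : ℝ) 1, 0 ≤ gder μ c 0 t) (hd : VanishesAt (gder μ d) z) :
    ∃ C, 0 < C ∧ ∀ t ∈ Icc (0 : ℝ) 1, |gder μ d 0 t| ≤ C * gder μ c 0 t := by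
  suffices h : ∃ C, 0 < C ∧ ∀ t ∈ Icc (0 : ℝ) 1, t ∈ Icc (0 : ℝ) 1 →
      |gder μ d 0 t| ≤ C * gder μ c 0 t by
    obtain ⟨C, hC, h⟩ := h
    exact ⟨C, hC, fun t ht => h t ht ht⟩
  refine isCompact_Icc.induction_on (p := fun s => ∃ C, 0 < C ∧ ∀ t ∈ s, t ∈ Icc (0 : ℝ) 1 →
    |gder μ d 0 t| ≤ C * gder μ c 0 t) ⟨1, one_pos, by simp⟩ ?_ ?_ ?_
  · rintro s s' hs ⟨C, hC, h⟩
    exact ⟨C, hC, fun t ht => h t (hs ht)⟩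
  · rintro s s' ⟨C, hC, h⟩ ⟨C', hC', h'⟩
    refine ⟨C + C', add_pos hC hC', ?_⟩
    rintro t (ht | ht) ht1
    · nlinarith [h t ht ht1, hnn t ht1]
    · nlinarith [h' t ht ht1, hnn t ht1]
  · intro a ha
    set r := mult z a
    have hF0 : ∀ i < r, gder μ c i a = 0 := fun i hi => hc a i hi
    have hs := (isChain_gder hμ c).posSign ha hF0 (hne a ha) hnn
    set C := 1 + |gder μ d r a| / |gder μ c r a| with hC
    have hCpos : 0 < C := by positivity
    have hlt : |gder μ d r a| < C * |gder μ c r a| := by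
      rw [hC, add_mul, div_mul_cancel₀ _ (abs_ne_zero.2 (hne a ha))]
      have := abs_pos.2 (hne a ha)
      linarith
    have key : ∀ e : ℝ, |e| = 1 → ∀ᶠ t in 𝓝[Icc 0 1] a, 0 ≤ gder μ (C • c + e • d) 0 t := by
      intro e he
      refine PosSign.eventually_nonneg (isChain_gder hμ _) ha (j := r) (fun i hi => ?_) ⟨?_, ?_⟩
      · rw [gder_add, gder_smul, gder_smul, hF0 i hi, hd a i hi, mul_zero, mul_zero, add_zero]
      · intro h1
        rw [gder_add, gder_smul, gder_smul]
        rw [abs_of_pos (hs.1 h1)] at hlt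
        have := neg_abs_le (e * gder μ d r a)
        rw [abs_mul, he, one_mul] at this
        linarith
      · intro h1
        have h2 := hs.2 h1
        have habs : |gder μ c r a| = (-1) ^ r * gder μ c r a := by
          rw [← abs_of_pos h2, abs_mul, abs_pow, abs_neg, abs_one, one_pow, one_mul]
        rw [habs] at hlt
        rw [gder_add, gder_smul, gder_smul]
        have := neg_abs_le ((-1) ^ r * (e * gder μ d r a))
        rw [abs_mul, abs_mul, he, abs_pow, abs_neg, abs_one, one_pow, one_mul, one_mul] at this
        linarith
    have hboth := (key 1 (by simp)).and (key (-1) (by simp))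
    refine ⟨_, hboth, C, hCpos, ?_⟩
    rintro t ⟨h1, h2⟩ -
    simp only [gder_add, gder_smul] at h1 h2
    rw [abs_le]
    constructor <;> linarith

/-! ### Determinants of generalized derivatives -/

/-- The entries of the vector of `j`-th derivatives at `t` of the powers `t ^ μ i`; at `t = 0` the
`j`-th standard basis vector, counted from `0`. -/
def gen (μ : ℕ → ℝ) (j : ℕ) (t : ℝ) (i : ℕ) : ℝ :=
  if t = 0 then (if i = j then 1 else 0) else (descPochhammer ℝ j).eval (μ i) * t ^ (μ i - j)

/-- The falling factorial of degree `j` in the Newton basis `∏_{l<i} (x - μ l)`. -/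
lemma exists_descPochhammer_eq (μ : ℕ → ℝ) (j : ℕ) : ∃ b : ℕ → ℝ, ∀ x : ℝ,
    (descPochhammer ℝ j).eval x = ∏ l ∈ Finset.range j, (x - μ l) +
      ∑ i ∈ Finset.range j, b i * ∏ l ∈ Finset.range i, (x - μ l) := by
  induction j with
  | zero => exact ⟨0, fun x => by simp⟩
  | succ j ih =>
    obtain ⟨b, hb⟩ := ih
    refine ⟨fun i => (if i = j then μ j - j else b i * (μ i - j)) +
      (if i = 0 then 0 else b (i - 1)), fun x => ?_⟩
    have h1 : ∑ i ∈ Finset.range (j + 1), (if i = j then μ j - j else b i * (μ i - j)) *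
        ∏ l ∈ Finset.range i, (x - μ l) = (μ j - j) * ∏ l ∈ Finset.range j, (x - μ l) +
        ∑ i ∈ Finset.range j, b i * (μ i - j) * ∏ l ∈ Finset.range i, (x - μ l) := by
      rw [Finset.sum_range_succ, if_pos rfl, add_comm]
      congr 1
      refine Finset.sum_congr rfl fun i hi => ?_
      rw [if_neg (Finset.mem_range.1 hi).ne]
    have h2 : ∑ i ∈ Finset.range (j + 1), (if i = 0 then 0 else b (i - 1)) *
        ∏ l ∈ Finset.range i, (x - μ l) =
        ∑ i ∈ Finset.range j, b i * ((∏ l ∈ Finset.range i, (x - μ l)) * (x - μ i)) := by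
      rw [Finset.sum_range_succ', if_pos rfl, zero_mul, add_zero]
      exact Finset.sum_congr rfl fun i _ => by
        rw [if_neg (Nat.succ_ne_zero i), Nat.add_sub_cancel, Finset.prod_range_succ]
    simp only [add_mul, Finset.sum_add_distrib]
    rw [h1, h2, descPochhammer_succ_right, Polynomial.eval_mul, hb, Finset.prod_range_succ]
    simp only [Polynomial.eval_sub, Polynomial.eval_X, Polynomial.eval_natCast]
    rw [add_mul, Finset.sum_mul, add_assoc (_ * _), ← Finset.sum_add_distrib, ← add_assoc,
      add_assoc]
    have h3 : ∀ i, b i * (∏ l ∈ Finset.range i, (x - μ l)) * (x - j) =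
        b i * (μ i - j) * ∏ l ∈ Finset.range i, (x - μ l) +
        b i * ((∏ l ∈ Finset.range i, (x - μ l)) * (x - μ i)) := fun i => by ring
    simp only [h3]
    ring

lemma gpow_zero_left {μ : ℕ → ℝ} (hμ : StrictMono μ) (j i : ℕ) :
    gpow μ j 0 (μ i) = if i = j then ∏ l ∈ Finset.range j, (μ j - μ l) else 0 := by
  rcases lt_trichotomy i j with h | rfl | h
  · rw [gpow_of_lt h, if_neg h.ne]
  · rw [gpow_self, if_pos rfl]
  · rw [gpow, Real.zero_rpow (sub_pos.2 (hμ h)).ne', mul_zero, if_neg h.ne']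

/-- Derivatives and generalized derivatives are related by a triangular transformation with
positive diagonal. -/
lemma exists_gen_eq {μ : ℕ → ℝ} (hμ : StrictMono μ) (j : ℕ) {t : ℝ} (ht : 0 ≤ t) :
    ∃ a : ℝ, 0 < a ∧ ∃ b : ℕ → ℝ, ∀ i, gen μ j t i =
      a * gpow μ j t (μ i) + ∑ l ∈ Finset.range j, b l * gpow μ l t (μ i) := by
  rcases ht.eq_or_lt with rfl | ht
  · refine ⟨(∏ l ∈ Finset.range j, (μ j - μ l))⁻¹, inv_pos.2 (prod_sub_pos hμ j), 0, fun i => ?_⟩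
    rw [gen, if_pos rfl, gpow_zero_left hμ]
    simp only [Pi.zero_apply, zero_mul, Finset.sum_const_zero, add_zero]
    split_ifs
    · rw [inv_mul_cancel₀ (prod_sub_pos hμ j).ne']
    · rw [mul_zero]
  · obtain ⟨b, hb⟩ := exists_descPochhammer_eq μ j
    refine ⟨t ^ (μ j - j), Real.rpow_pos_of_pos ht _, fun l => b l * t ^ (μ l - j), fun i => ?_⟩
    rw [gen, if_neg ht.ne', hb, add_mul, Finset.sum_mul]
    have h : ∀ l, t ^ (μ i - j) = t ^ (μ l - j) * t ^ (μ i - μ l) := fun l => by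
      rw [← Real.rpow_add ht]; congr 1; ring
    congr 1
    · rw [gpow, h j]; ring
    · refine Finset.sum_congr rfl fun l _ => ?_
      rw [gpow, h l]; ring

lemma exists_sum_gen_eq {μ : ℕ → ℝ} (hμ : StrictMono μ) {n : ℕ} (c : Fin n → ℝ) (j : ℕ) {t : ℝ}
    (ht : 0 ≤ t) (h0 : ∀ l < j, gder μ c l t = 0) :
    ∃ a : ℝ, 0 < a ∧ ∑ i : Fin n, c i * gen μ j t i = a * gder μ c j t := by
  obtain ⟨a, ha, b, h⟩ := exists_gen_eq hμ j ht
  refine ⟨a, ha, ?_⟩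
  simp only [h, mul_add, Finset.sum_add_distrib, Finset.mul_sum]
  rw [Finset.sum_comm (s := Finset.univ) (t := Finset.range j)]
  have : ∀ l ∈ Finset.range j, ∑ i : Fin n, c i * (b l * gpow μ l t (μ i)) = 0 := by
    intro l hl
    calc ∑ i : Fin n, c i * (b l * gpow μ l t (μ i)) = b l * gder μ c l t := by
          rw [gder, Finset.mul_sum]; exact Finset.sum_congr rfl fun i _ => by ring
      _ = 0 := by rw [h0 l (Finset.mem_range.1 hl), mul_zero]
  rw [Finset.sum_congr rfl this, Finset.sum_const_zero, add_zero, gder, Finset.mul_sum]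
  exact Finset.sum_congr rfl fun i _ => by ring

lemma vanishesAt_of_gen {μ : ℕ → ℝ} (hμ : StrictMono μ) {n k : ℕ} {c : Fin n → ℝ} {z : Fin k → ℝ}
    (h0 : ∀ k, 0 ≤ z k) (h : ∀ k, ∑ i : Fin n, c i * gen μ (earlier z k) (z k) i = 0) :
    VanishesAt (gder μ c) z := by
  intro a j
  induction j using Nat.strong_induction_on with
  | _ j ih =>
    intro hj
    obtain ⟨k, rfl, rfl⟩ := exists_earlier_eq hj
    obtain ⟨a, ha, he⟩ := exists_sum_gen_eq hμ c (earlier z k) (h0 k) fun l hl =>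
      ih l hl (hl.trans hj)
    rw [h k] at he
    exact (mul_eq_zero.1 he.symm).resolve_left ha.ne'

lemma det_insertNth {n : ℕ} (p : Fin (n + 1)) (x : Fin (n + 1) → ℝ)
    (v : Fin n → Fin (n + 1) → ℝ) :
    Matrix.det (Matrix.of (p.insertNth x v : Fin (n + 1) → Fin (n + 1) → ℝ)) =
      (-1) ^ (p : ℕ) * borderedDet x v := by
  rw [borderedDet, Matrix.det_succ_row _ p, Matrix.det_succ_row_zero, Finset.mul_sum]
  refine Finset.sum_congr rfl fun j _ => ?_
  have h : ((Matrix.of (p.insertNth x v : Fin (n + 1) → Fin (n + 1) → ℝ)).submatrix p.succAbove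
      j.succAbove) = (Matrix.of (Fin.cons x v : Fin (n + 1) → Fin (n + 1) → ℝ)).submatrix Fin.succ
      j.succAbove := by
    ext k l
    simp
  rw [h, pow_add]
  simp
  ring

lemma hodgeStar_dotProduct {n : ℕ} (v : Fin n → Fin (n + 1) → ℝ) (x : Fin (n + 1) → ℝ) :
    hodgeStar v ⬝ᵥ x = borderedDet x v := by
  have h : ∀ y : Fin (n + 1) → ℝ, borderedDet y v =
      ∑ j : Fin (n + 1), (-1) ^ (j : ℕ) * y j *
        Matrix.det (Matrix.of fun k l => v k (j.succAbove l)) := by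
    intro y
    rw [borderedDet, Matrix.det_succ_row_zero]
    rfl
  rw [h, dotProduct]
  refine Finset.sum_congr rfl fun i _ => ?_
  rw [hodgeStar, h, Finset.sum_eq_single i]
  · rw [Pi.single_eq_same]; ring
  · intro j _ hj
    rw [Pi.single_eq_of_ne hj]; ring
  · simp

lemma borderedDet_row {n : ℕ} (v : Fin n → Fin (n + 1) → ℝ) (k : Fin n) :
    borderedDet (v k) v = 0 := by
  rw [borderedDet]
  refine Matrix.det_zero_of_row_eq (i := 0) (j := k.succ) (Fin.succ_ne_zero k).symm ?_
  funext l
  simp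

/-- The rows of derivatives of the powers `t ^ μ i`, `i ≤ n`, at the entries of `z`, a value
occurring repeatedly giving rise to derivatives of increasing order. -/
def genRows (μ : ℕ → ℝ) {n : ℕ} (z : Fin n → ℝ) : Fin n → Fin (n + 1) → ℝ :=
  fun k i => gen μ (earlier z k) (z k) i

lemma vanishesAt_hodgeStar {μ : ℕ → ℝ} (hμ : StrictMono μ) {n : ℕ} {z : Fin n → ℝ}
    (h0 : ∀ k, 0 ≤ z k) : VanishesAt (gder μ (hodgeStar (genRows μ z))) z :=
  vanishesAt_of_gen hμ h0 fun k => by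
    have := hodgeStar_dotProduct (genRows μ z) (genRows μ z k)
    rw [borderedDet_row] at this
    exact this

/-- Total positivity, with confluent rows: by induction on the size, a determinant is the value of
a generalized polynomial in the last node, which is positive behind its zeros because its leading
coefficient is a smaller determinant of the same kind. -/
lemma det_gen_pos {μ : ℕ → ℝ} (hμ : StrictMono μ) {n : ℕ} : ∀ {z : Fin n → ℝ}, Monotone z →
    (∀ k, 0 ≤ z k) →
    0 < Matrix.det (Matrix.of fun k i : Fin n => gen μ (earlier z k) (z k) i) := by
  induction n with
  | zero => intro z _ _; simp
  | succ n ih =>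
    intro z hz h0
    set y : Fin n → ℝ := fun k => z k.castSucc with hy
    have hym : Monotone y := fun i j h => hz h
    have hrows : (Matrix.of fun k i : Fin (n + 1) => gen μ (earlier z k) (z k) i) =
        Matrix.of ((Fin.last n).insertNth (fun i => gen μ (mult y (z (Fin.last n)))
          (z (Fin.last n)) i) (genRows μ y) : Fin (n + 1) → Fin (n + 1) → ℝ) := by
      ext k i
      refine Fin.lastCases ?_ (fun k => ?_) k
      · simp only [Matrix.of_apply, Fin.insertNth_apply_same]
        rw [earlier_last]
      · simp only [Matrix.of_apply]
        rw [← Fin.succAbove_last_apply, Fin.insertNth_apply_succAbove, Fin.succAbove_last_apply,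
          earlier_castSucc]
        rfl
    set c : Fin (n + 1) → ℝ := ((-1 : ℝ) ^ n) • hodgeStar (genRows μ y) with hc
    have hlast : 0 < c (Fin.last n) := by
      have h : hodgeStar (genRows μ y) (Fin.last n) = (-1) ^ n *
          Matrix.det (Matrix.of fun k i : Fin n => gen μ (earlier y k) (y k) i) := by
        rw [hodgeStar, borderedDet, Matrix.det_succ_row_zero, Finset.sum_eq_single (Fin.last n)]
        · have : ((Matrix.of (Fin.cons (Pi.single (Fin.last n) 1) (genRows μ y) :
              Fin (n + 1) → Fin (n + 1) → ℝ)).submatrix Fin.succ (Fin.last n).succAbove) =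
              Matrix.of fun k i : Fin n => gen μ (earlier y k) (y k) i := by
            ext k l
            simp [genRows]
          rw [this]
          simp
        · intro j _ hj
          simp [hj]
        · simp
      rw [hc, Pi.smul_apply, h, smul_eq_mul, ← mul_assoc, ← mul_pow]
      simpa using ih hym fun k => h0 _
    have hv : VanishesAt (gder μ c) y := (vanishesAt_hodgeStar hμ fun k => h0 _).smul _
    have hpos := gder_pos hμ hlast hym (fun k => h0 _) hv (h0 (Fin.last n))
      fun k => hz (Fin.le_last _)
    obtain ⟨a, ha, he⟩ := exists_sum_gen_eq hμ c (mult y (z (Fin.last n))) (h0 (Fin.last n))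
      fun l hl => hv _ l hl
    rw [hrows, det_insertNth, ← hodgeStar_dotProduct, Fin.val_last]
    have : (-1 : ℝ) ^ n * (hodgeStar (genRows μ y) ⬝ᵥ fun i : Fin (n + 1) =>
        gen μ (mult y (z (Fin.last n))) (z (Fin.last n)) i) =
        ∑ i : Fin (n + 1), c i * gen μ (mult y (z (Fin.last n))) (z (Fin.last n)) i := by
      rw [dotProduct, Finset.mul_sum]
      exact Finset.sum_congr rfl fun i _ => by rw [hc, Pi.smul_apply, smul_eq_mul, mul_assoc]
    rw [this, he]
    exact mul_pos ha hpos

lemma gen_zero {μ : ℕ → ℝ} (hμ : StrictMono μ) (h0 : μ 0 = 0) (t : ℝ) (i : ℕ) :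
    gen μ 0 t i = t ^ μ i := by
  rw [gen]
  split_ifs with h hi
  · rw [hi, h0, Real.rpow_zero]
  · rw [h, Real.zero_rpow]
    rw [← h0]
    exact (hμ (Nat.pos_of_ne_zero hi)).ne'
  · simp

lemma gder_zero {μ : ℕ → ℝ} (h0 : μ 0 = 0) {n : ℕ} (c : Fin n → ℝ) (t : ℝ) :
    gder μ c 0 t = c ⬝ᵥ fun i => t ^ μ i := by
  simp [gder, gpow, h0, dotProduct]

/-- The sign of the generalized polynomial with zeros `z`. -/
lemma borderedDet_sign {μ : ℕ → ℝ} (hμ : StrictMono μ) (hμ0 : μ 0 = 0) {n : ℕ} {z : Fin n → ℝ}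
    (hz : Monotone z) (h0 : ∀ k, 0 ≤ z k) {t : ℝ} (ht : 0 ≤ t) (hzt : ∀ k, z k ≠ t) :
    0 < (-1) ^ numBelow z t * borderedDet (fun i : Fin (n + 1) => t ^ μ i) (genRows μ z) := by
  have hpos := det_gen_pos hμ (monotone_insertPos hz t) fun k => by
    induction k using Fin.succAboveCases (insertPos z t) with
    | x => simpa using ht
    | p k => simpa using h0 k
  have h := det_insertNth (insertPos z t) (fun i : Fin (n + 1) => t ^ μ i) (genRows μ z)
  change _ = (-1) ^ numBelow z t * _ at h
  rw [← h]
  convert hpos using 3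
  ext k i
  induction k using Fin.succAboveCases (insertPos z t) with
  | x => simp only [Fin.insertNth_apply_same, earlier_insertPos_same hz,
      gen_zero hμ hμ0]
  | p k =>
    simp only [Fin.insertNth_apply_succAbove, earlier_insertPos_succAbove hz,
      if_neg (hzt k), add_zero]
    rfl

/-- A determinant, bordered by a column `(1, e)` and by the row `(1, a)`, multiples of which are
added to the other rows. -/
lemma det_lift {n : ℕ} (a : Fin n → ℝ) (y : Fin n → Fin n → ℝ) (e : Fin n → ℝ) :
    Matrix.det (Matrix.of (Fin.cons (Fin.cons 1 a) (fun k => Fin.cons (e k) (y k + e k • a)) :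
      Fin (n + 1) → Fin (n + 1) → ℝ)) = Matrix.det (Matrix.of y) := by
  have h := Matrix.det_eq_of_forall_row_eq_smul_add_const
    (A := Matrix.of (Fin.cons (Fin.cons 1 a) (fun k => Fin.cons (e k) (y k + e k • a)) :
      Fin (n + 1) → Fin (n + 1) → ℝ))
    (B := Matrix.of (Fin.cons (Fin.cons 1 a) (fun k => Fin.cons 0 (y k)) :
      Fin (n + 1) → Fin (n + 1) → ℝ)) (Fin.cons 0 e : Fin (n + 1) → ℝ) 0 rfl ?_
  · rw [h, Matrix.det_succ_column_zero, Fin.sum_univ_succ, Finset.sum_eq_zero]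
    · have : ((Matrix.of (Fin.cons (Fin.cons 1 a) (fun k => Fin.cons 0 (y k)) :
          Fin (n + 1) → Fin (n + 1) → ℝ)).submatrix (Fin.succAbove 0) Fin.succ) =
          Matrix.of y := by
        ext k l
        simp
      rw [this]
      simp
    · intro i _
      simp
  · intro i j
    refine Fin.cases ?_ (fun i => ?_) i
    · simp
    · refine Fin.cases ?_ (fun j => ?_) j
      · simp
      · simp

/-! ### Compactness of convex hulls -/

/-- By Carathéodory's theorem, the convex hull is the image of a compact set of weights and
points. -/
lemma isCompact_convexHull_of_isCompact {n : ℕ} {s : Set (Fin n → ℝ)} (hs : IsCompact s) :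
    IsCompact (convexHull ℝ s) := by
  rcases s.eq_empty_or_nonempty with rfl | ⟨s₀, hs₀⟩
  · simp
  have himage : convexHull ℝ s = (fun q : (Fin (n + 1) → ℝ) × (Fin (n + 1) → Fin n → ℝ) =>
      ∑ i, q.1 i • q.2 i) '' (stdSimplex ℝ (Fin (n + 1)) ×ˢ Set.univ.pi fun _ => s) := by
    apply Subset.antisymm
    · intro x hx
      obtain ⟨ι, hι, z, w, hz, hind, hw, hw1, rfl⟩ := eq_pos_convex_span_of_mem_convexHull hx
      have hcard : Fintype.card ι ≤ Fintype.card (Fin (n + 1)) := by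
        have := hind.card_le_finrank_succ
        have h2 := Submodule.finrank_le (vectorSpan ℝ (Set.range z))
        rw [Module.finrank_fin_fun] at h2
        simp only [Fintype.card_fin]
        omega
      obtain ⟨e⟩ := Function.Embedding.nonempty_of_card_le hcard
      have hsum : ∀ {M : Type} [AddCommMonoid M] (f : Fin (n + 1) → M),
          (∀ i, (¬ ∃ a, e a = i) → f i = 0) → ∑ i, f i = ∑ a, f (e a) := by
        intro M _ f hf
        rw [← Finset.sum_map Finset.univ e f]
        symm
        refine Finset.sum_subset (Finset.subset_univ _) fun i _ hi => hf i ?_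
        simpa using hi
      refine ⟨(Function.extend e w 0, Function.extend e z fun _ => s₀), ⟨⟨fun i => ?_, ?_⟩, ?_⟩, ?_⟩
      · by_cases h : ∃ a, e a = i
        · obtain ⟨a, rfl⟩ := h
          simpa [e.injective.extend_apply] using (hw a).le
        · simp [Function.extend_apply' _ _ _ h]
      · rw [hsum _ fun i hi => by simp [Function.extend_apply' _ _ _ hi], ← hw1]
        simp [e.injective.extend_apply]
      · intro i _
        by_cases h : ∃ a, e a = i
        · obtain ⟨a, rfl⟩ := h
          simpa [e.injective.extend_apply] using hz ⟨a, rfl⟩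
        · simpa [Function.extend_apply' _ _ _ h] using hs₀
      · dsimp only
        rw [hsum _ fun i hi => by simp [Function.extend_apply' _ _ _ hi]]
        simp [e.injective.extend_apply]
    · rintro _ ⟨⟨w, z⟩, ⟨hw, hz⟩, rfl⟩
      exact (convex_convexHull ℝ s).sum_mem (fun i _ => hw.1 i) hw.2 fun i _ =>
        subset_convexHull ℝ s (hz i (mem_univ i))
  rw [himage]
  refine ((isCompact_stdSimplex ℝ _).prod (isCompact_univ_pi fun _ => hs)).image ?_
  fun_prop

/-! ### Normal cones of the curve -/

/-- The exponents `0, ν_1, …, ν_N`, continued to a strictly increasing sequence. -/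
structure IsExponents {N : ℕ} (μ : ℕ → ℝ) (ν : Fin N → ℝ) : Prop where
  strictMono : StrictMono μ
  zero : μ 0 = 0
  succ : ∀ i : Fin N, μ (i + 1) = ν i

lemma exists_isExponents {N : ℕ} {ν : Fin N → ℝ} (hν : StrictMono ν) (h0 : ∀ i, 0 < ν i) :
    ∃ μ, IsExponents μ ν := by
  refine ⟨fun k => if h : k < N + 1 then (Fin.cons 0 ν : Fin (N + 1) → ℝ) ⟨k, h⟩
    else (∑ i, ν i) + k, strictMono_nat_of_lt_succ fun k => ?_, ?_, fun i => ?_⟩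
  · rcases lt_trichotomy (k + 1) (N + 1) with h | h | h
    · rw [dif_pos (by omega), dif_pos h]
      cases k with
      | zero => exact h0 ⟨0, by omega⟩
      | succ k => exact hν (show (⟨k, by omega⟩ : Fin N) < ⟨k + 1, by omega⟩ by simp)
    · rw [dif_pos (by omega), dif_neg (by omega)]
      have hpos : 0 ≤ ∑ i, ν i := Finset.sum_nonneg fun i _ => (h0 i).le
      cases k with
      | zero =>
        change (0 : ℝ) < _
        push_cast
        linarith
      | succ k =>
        change ν ⟨k, by omega⟩ < _
        have := Finset.single_le_sum (fun i _ => (h0 i).le) (Finset.mem_univ (⟨k, by omega⟩ : Fin N))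
        push_cast
        have : (0 : ℝ) ≤ k := Nat.cast_nonneg k
        linarith
    · rw [dif_neg (by omega), dif_neg (by omega)]
      push_cast
      linarith
  · rw [dif_pos (by omega)]
    rfl
  · rw [dif_pos (by omega)]
    rfl

/-- The coefficients of the generalized polynomial `t ↦ λ · Π(b) - λ · Π(t)`. -/
def slack {N : ℕ} (ν : Fin N → ℝ) (lam : Fin N → ℝ) (b : ℝ) : Fin (N + 1) → ℝ :=
  Fin.cons (lam ⬝ᵥ curve ν b) (-lam)

lemma gder_eq {N : ℕ} {μ : ℕ → ℝ} {ν : Fin N → ℝ} (hμ : IsExponents μ ν) (c : Fin (N + 1) → ℝ)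
    (t : ℝ) : gder μ c 0 t = c 0 + (fun i : Fin N => c i.succ) ⬝ᵥ curve ν t := by
  rw [gder_zero hμ.zero, dotProduct, Fin.sum_univ_succ]
  simp [hμ.zero, hμ.succ, dotProduct, curve]

lemma gder_slack {N : ℕ} {μ : ℕ → ℝ} {ν : Fin N → ℝ} (hμ : IsExponents μ ν) (lam : Fin N → ℝ)
    (b t : ℝ) : gder μ (slack ν lam b) 0 t = lam ⬝ᵥ curve ν b - lam ⬝ᵥ curve ν t := by
  rw [gder_eq hμ]
  simp only [slack, Fin.cons_zero, Fin.cons_succ]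
  rw [show (fun i : Fin N => (-lam) i) = -lam from rfl, neg_dotProduct, sub_eq_add_neg]

lemma slack_smul {N : ℕ} (ν : Fin N → ℝ) (r : ℝ) (lam : Fin N → ℝ) (b : ℝ) :
    slack ν (r • lam) b = r • slack ν lam b := by
  funext i
  refine Fin.cases ?_ (fun i => ?_) i
  · simp [slack, smul_dotProduct]
  · simp [slack]

lemma slack_add {N : ℕ} (ν : Fin N → ℝ) (v w : Fin N → ℝ) (b : ℝ) :
    slack ν (v + w) b = slack ν v b + slack ν w b := by
  funext i
  refine Fin.cases ?_ (fun i => ?_) i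
  · simp [slack, add_dotProduct]
  · simp [slack]; ring

lemma eq_smul_of_slack {N : ℕ} {ν : Fin N → ℝ} {r : ℝ} {v w : Fin N → ℝ} {b b' : ℝ}
    (h : slack ν v b = r • slack ν w b') : v = r • w := by
  funext i
  have := congrFun h i.succ
  simpa [slack] using this

lemma slack_ne_zero {N : ℕ} (ν : Fin N → ℝ) {v : Fin N → ℝ} (hv : v ≠ 0) (b : ℝ) :
    slack ν v b ≠ 0 := by
  intro h
  refine hv (funext fun i => ?_)
  have := congrFun h i.succ
  simpa [slack] using this

lemma exists_eq_slack {N : ℕ} {μ : ℕ → ℝ} {ν : Fin N → ℝ} (hμ : IsExponents μ ν)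
    {c : Fin (N + 1) → ℝ} {b : ℝ} (h : gder μ c 0 b = 0) : ∃ w, c = slack ν w b := by
  refine ⟨fun i => -c i.succ, funext fun i => ?_⟩
  rw [gder_eq hμ] at h
  refine Fin.cases ?_ (fun i => ?_) i
  · simp only [slack, Fin.cons_zero]
    rw [show (fun i : Fin N => -c i.succ) = -fun i : Fin N => c i.succ from rfl, neg_dotProduct]
    linarith
  · simp [slack]

lemma mem_normalCone_iff {N : ℕ} {μ : ℕ → ℝ} {ν : Fin N → ℝ} (hμ : IsExponents μ ν)
    {lam : Fin N → ℝ} {b : ℝ} : lam ∈ normalCone ν b ↔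
      ∀ t ∈ Icc (0 : ℝ) 1, 0 ≤ gder μ (slack ν lam b) 0 t := by
  simp only [gder_slack hμ, sub_nonneg]
  rfl

lemma smul_mem_normalCone {N : ℕ} {ν : Fin N → ℝ} {lam : Fin N → ℝ} {b r : ℝ} (hr : 0 ≤ r)
    (h : lam ∈ normalCone ν b) : r • lam ∈ normalCone ν b := by
  intro t ht
  have := h ht
  simp only [mem_ofPred_eq, smul_dotProduct, smul_eq_mul] at this ⊢
  exact mul_le_mul_of_nonneg_left this hr

lemma isGreatest_values {N : ℕ} {ν : Fin N → ℝ} {lam : Fin N → ℝ} {b : ℝ}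
    (hb : b ∈ Icc (0 : ℝ) 1) (h : lam ∈ normalCone ν b) :
    IsGreatest (values ν lam) (lam ⬝ᵥ curve ν b) :=
  ⟨⟨b, hb, rfl⟩, by rintro _ ⟨t, ht, rfl⟩; exact h ht⟩

lemma bound_eq {N : ℕ} {ν : Fin N → ℝ} {lam : Fin N → ℝ} {b : ℝ} (hb : b ∈ Icc (0 : ℝ) 1)
    (h : lam ∈ normalCone ν b) : bound ν lam = lam ⬝ᵥ curve ν b :=
  (isGreatest_values hb h).csSup_eq

/-- Equally spaced points of `[0,1]`. -/
def sample {n : ℕ} (k : Fin n) : ℝ := k / n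

lemma sample_mem {n : ℕ} (k : Fin n) : sample k ∈ Icc (0 : ℝ) 1 := by
  have hn : (0 : ℝ) < n := by exact_mod_cast k.pos
  refine ⟨by unfold sample; positivity, (div_le_one hn).2 ?_⟩
  exact_mod_cast k.2.le

lemma strictMono_sample {n : ℕ} : StrictMono (sample : Fin n → ℝ) := by
  intro k l h
  have hn : (0 : ℝ) < n := by exact_mod_cast k.pos
  exact div_lt_div_of_pos_right (by exact_mod_cast h) hn

lemma eq_zero_of_sample {μ : ℕ → ℝ} (hμ : StrictMono μ) {n : ℕ} {c : Fin n → ℝ}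
    (h : ∀ k : Fin n, gder μ c 0 (sample k) = 0) : c = 0 := by
  refine eq_zero_of_vanishesAt hμ (strictMono_sample (n := n)).monotone
    (fun k => (sample_mem k).1) fun a j hj => ?_
  have hle : mult (sample : Fin n → ℝ) a ≤ 1 := Finset.card_le_one.2 fun x hx y hy =>
    strictMono_sample.injective (((Finset.mem_filter.1 hx).2).trans (Finset.mem_filter.1 hy).2.symm)
  obtain rfl : j = 0 := by omega
  obtain ⟨k, rfl⟩ := mult_pos_iff.1 hj
  exact h k

lemma exists_pos_of_nonneg {μ : ℕ → ℝ} (hμ : StrictMono μ) {n : ℕ} {c : Fin n → ℝ}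
    (hc : c ≠ 0) (hnn : ∀ t ∈ Icc (0 : ℝ) 1, 0 ≤ gder μ c 0 t) :
    ∃ t ∈ Icc (0 : ℝ) 1, 0 < gder μ c 0 t := by
  by_contra! h
  exact hc (eq_zero_of_sample hμ fun k => le_antisymm (h _ (sample_mem k)) (hnn _ (sample_mem k)))

/-- The generalized derivative as a linear form in the coefficients. -/
def gderL (μ : ℕ → ℝ) (n : ℕ) (j : ℕ) (t : ℝ) : (Fin n → ℝ) →ₗ[ℝ] ℝ where
  toFun c := gder μ c j t
  map_add' c d := gder_add μ c d j t
  map_smul' r c := gder_smul μ r c j t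

/-- A linear form on generalized polynomials, positive on those that are nonnegative on
`[0,1]`. -/
def sumForm (μ : ℕ → ℝ) (n : ℕ) : (Fin n → ℝ) →ₗ[ℝ] ℝ := ∑ k : Fin n, gderL μ n 0 (sample k)

lemma sumForm_apply (μ : ℕ → ℝ) {n : ℕ} (c : Fin n → ℝ) :
    sumForm μ n c = ∑ k : Fin n, gder μ c 0 (sample k) := by
  simp [sumForm, LinearMap.sum_apply, gderL]

lemma sumForm_pos {μ : ℕ → ℝ} (hμ : StrictMono μ) {n : ℕ} {c : Fin n → ℝ} (hc : c ≠ 0)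
    (hnn : ∀ t ∈ Icc (0 : ℝ) 1, 0 ≤ gder μ c 0 t) : 0 < sumForm μ n c := by
  rw [sumForm_apply]
  refine Finset.sum_pos' (fun k _ => hnn _ (sample_mem k)) ?_
  by_contra! h
  exact hc (eq_zero_of_sample hμ fun k => le_antisymm (h k (Finset.mem_univ k))
    (hnn _ (sample_mem k)))

lemma VanishesAt.congr {F : ℕ → ℝ → ℝ} {n k : ℕ} {y : Fin n → ℝ} {z : Fin k → ℝ}
    (h : VanishesAt F y) (hyz : ∀ a, mult z a = mult y a) : VanishesAt F z :=
  fun a j hj => h a j (hyz a ▸ hj)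

/-- A list of all zeros in `[0,1]`, with multiplicities. -/
lemma exists_all_zeros {μ : ℕ → ℝ} (hμ : StrictMono μ) {N : ℕ} {c : Fin (N + 1) → ℝ}
    (hc : c ≠ 0) : ∃ k ≤ N, ∃ z : Fin k → ℝ, Monotone z ∧ (∀ i, z i ∈ Icc (0 : ℝ) 1) ∧
      VanishesAt (gder μ c) z ∧ ∀ a ∈ Icc (0 : ℝ) 1, gder μ c (mult z a) a ≠ 0 := by
  classical
  let P : ℕ → Prop := fun k => ∃ z : Fin k → ℝ, Monotone z ∧ (∀ i, z i ∈ Icc (0 : ℝ) 1) ∧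
    VanishesAt (gder μ c) z
  have hP0 : P 0 := ⟨Fin.elim0, fun i => i.elim0, fun i => i.elim0, fun a j hj => by
    simp [mult] at hj⟩
  obtain ⟨z, hz, hz1, hv⟩ := Nat.findGreatest_spec (P := P) (Nat.zero_le N) hP0
  refine ⟨_, Nat.findGreatest_le N, z, hz, hz1, hv, fun a ha h => ?_⟩
  have hnext : P (Nat.findGreatest P N + 1) := by
    refine ⟨_, monotone_insertPos hz a, fun k => ?_, fun b j hj => ?_⟩
    · induction k using Fin.succAboveCases (insertPos z a) with
      | x => simpa using ha
      | p k => simpa using hz1 k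
    · rw [mult_insertNth] at hj
      split_ifs at hj with hab
      · subst hab
        rcases Nat.lt_succ_iff_lt_or_eq.1 (by omega : j < mult z a + 1) with hj | rfl
        · exact hv a j hj
        · exact h
      · exact hv b j (by omega)
  rcases Nat.lt_or_ge (Nat.findGreatest P N) N with hlt | hge
  · exact absurd (Nat.le_findGreatest (P := P) hlt hnext) (by omega)
  · have heq : Nat.findGreatest P N = N := le_antisymm (Nat.findGreatest_le N) hge
    rw [heq] at hnext
    obtain ⟨y, hy, hy1, hyv⟩ := hnext
    exact hc (eq_zero_of_vanishesAt hμ hy (fun k => (hy1 k).1) hyv)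

/-- Fewer than `N` conditions and one more zero `a` leave a nonzero generalized polynomial with
`N + 1` terms. -/
lemma exists_ne_zero_vanishesAt (μ : ℕ → ℝ) {N k : ℕ} (hk : k < N) (z : Fin k → ℝ) (a : ℝ) :
    ∃ d : Fin (N + 1) → ℝ, d ≠ 0 ∧ VanishesAt (gder μ d) z ∧ gder μ d 0 a = 0 := by
  let T : (Fin (N + 1) → ℝ) →ₗ[ℝ] (Fin k → ℝ) × ℝ :=
    (LinearMap.pi fun i => gderL μ (N + 1) (earlier z i) (z i)).prod (gderL μ (N + 1) 0 a)
  have hker : LinearMap.ker T ≠ ⊥ := LinearMap.ker_ne_bot_of_finrank_lt (by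
    simp only [Module.finrank_prod, Module.finrank_fin_fun, Module.finrank_self]
    omega)
  obtain ⟨d, hd, hne⟩ := Submodule.exists_mem_ne_zero_of_ne_bot hker
  rw [LinearMap.mem_ker] at hd
  refine ⟨d, hne, fun b j hj => ?_, congrArg Prod.snd hd⟩
  obtain ⟨i, rfl, rfl⟩ := exists_earlier_eq hj
  exact congrFun (congrArg Prod.fst hd) i

/-- The normal vector `λ` of an inequality that is tight at `t = b` and whose slack on the curve
has the zeros `z`, counted with multiplicity: as many as determine `λ` up to a factor. -/
structure Touches {N : ℕ} (μ : ℕ → ℝ) (ν lam : Fin N → ℝ) (b : ℝ) (z : Fin N → ℝ) : Prop where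
  ne_zero : lam ≠ 0
  mem : b ∈ Icc (0 : ℝ) 1
  mem_normalCone : lam ∈ normalCone ν b
  monotone : Monotone z
  mem_Icc : ∀ k, z k ∈ Icc (0 : ℝ) 1
  vanishes : VanishesAt (gder μ (slack ν lam b)) z

section Touches

variable {N : ℕ} {μ : ℕ → ℝ} {ν lam : Fin N → ℝ} {b : ℝ} {z : Fin N → ℝ}

lemma Touches.nonneg (hμ : IsExponents μ ν) (h : Touches μ ν lam b z) :
    ∀ t ∈ Icc (0 : ℝ) 1, 0 ≤ gder μ (slack ν lam b) 0 t := (mem_normalCone_iff hμ).1 h.mem_normalCone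

lemma Touches.exists_eq_smul (hμ : IsExponents μ ν) (h : Touches μ ν lam b z)
    {d : Fin (N + 1) → ℝ} (hd : VanishesAt (gder μ d) z) : ∃ r : ℝ, d = r • slack ν lam b :=
  NoClick.exists_eq_smul hμ.strictMono h.monotone (fun k => (h.mem_Icc k).1)
    (slack_ne_zero ν h.ne_zero b) h.vanishes hd

/-- A nonnegative generalized polynomial with the zeros `z` is a nonnegative multiple of the
slack. -/
lemma Touches.exists_eq_smul_of_nonneg (hμ : IsExponents μ ν) (h : Touches μ ν lam b z)
    {d : Fin (N + 1) → ℝ} (hd : VanishesAt (gder μ d) z)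
    (hnn : ∀ t ∈ Icc (0 : ℝ) 1, 0 ≤ gder μ d 0 t) :
    ∃ r : ℝ, 0 ≤ r ∧ d = r • slack ν lam b := by
  obtain ⟨r, rfl⟩ := h.exists_eq_smul hμ hd
  refine ⟨r, ?_, rfl⟩
  obtain ⟨t, ht, hpos⟩ := exists_pos_of_nonneg hμ.strictMono (slack_ne_zero ν h.ne_zero b)
    (h.nonneg hμ)
  have := hnn t ht
  rw [gder_smul] at this
  exact nonneg_of_mul_nonneg_left this hpos

/-- Extremality of the slack in the cone of all nonnegative generalized polynomials. -/
lemma Touches.exists_eq_smul_of_add (hμ : IsExponents μ ν) (h : Touches μ ν lam b z) {r : ℝ}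
    {d e : Fin (N + 1) → ℝ} (hd : ∀ t ∈ Icc (0 : ℝ) 1, 0 ≤ gder μ d 0 t)
    (he : ∀ t ∈ Icc (0 : ℝ) 1, 0 ≤ gder μ e 0 t) (hde : d + e = r • slack ν lam b) :
    ∃ s : ℝ, 0 ≤ s ∧ d = s • slack ν lam b := by
  refine h.exists_eq_smul_of_nonneg hμ (vanishesAt_of_le hμ.strictMono h.mem_Icc
    (h.vanishes.smul r) hd fun t ht => ?_) hd
  rw [← hde, gder_add]
  linarith [he t ht]

end Touches

/-! ### Extreme rays -/

/-- An extreme ray of a normal cone whose slack has fewer than `N` zeros could be perturbed in both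
directions; hence the slack has `N` zeros, even ones in `(0,1)`. -/
lemma exists_zeros_of_extreme {N : ℕ} {μ : ℕ → ℝ} {ν : Fin N → ℝ} (hμ : IsExponents μ ν)
    {v : Fin N → ℝ} {s : ℝ} (hs : s ∈ Icc (0 : ℝ) 1) (hv : v ∈ extremeRays (normalCone ν s)) :
    ∃ z : Fin N → ℝ, Touches μ ν v s z ∧ ∀ a ∈ Ioo (0 : ℝ) 1, Even (mult z a) := by
  obtain ⟨hv0, hext⟩ := hv
  have hvL : v ∈ normalCone ν s := hext.subset ⟨1, zero_le_one, (one_smul _ _).symm⟩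
  have hnn := (mem_normalCone_iff hμ).1 hvL
  have hc0 := slack_ne_zero ν hv0 s
  obtain ⟨k, hk, z, hz, hz1, hvan, hne⟩ := exists_all_zeros hμ.strictMono hc0
  have heven : ∀ a ∈ Ioo (0 : ℝ) 1, Even (mult z a) := fun a ha =>
    (isChain_gder hμ.strictMono _).even_of_nonneg ha (fun i hi => hvan a i hi)
      (hne a ⟨ha.1.le, ha.2.le⟩) hnn
  rcases hk.eq_or_lt with rfl | hk
  · exact ⟨z, ⟨hv0, hs, hvL, hz, hz1, hvan⟩, heven⟩
  exfalso
  -- the additional zero `a` of `d`, where the slack is positive, keeps `d` from being a multiple of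
  -- the slack
  obtain ⟨a, ha, hapos⟩ := exists_pos_of_nonneg hμ.strictMono hc0 hnn
  obtain ⟨d, hd0, hdv, hda⟩ := exists_ne_zero_vanishesAt μ hk z a
  obtain ⟨C, hC, hle⟩ := exists_abs_le hμ.strictMono hvan hne hnn hdv
  obtain ⟨w, rfl⟩ : ∃ w, d = slack ν w s := by
    refine exists_eq_slack hμ ?_
    have := hle s hs
    rw [gder_slack hμ v, sub_self, mul_zero] at this
    exact abs_eq_zero.1 (le_antisymm this (abs_nonneg _))
  have hmem : ∀ e : ℝ, |e| = 1 → v + (e * C⁻¹) • w ∈ normalCone ν s := by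
    intro e he
    rw [mem_normalCone_iff hμ]
    intro t ht
    rw [slack_add, slack_smul, gder_add, gder_smul]
    have h1 := neg_abs_le (e * C⁻¹ * gder μ (slack ν w s) 0 t)
    rw [abs_mul, abs_mul, he, one_mul, abs_of_pos (inv_pos.2 hC)] at h1
    have h2 : C⁻¹ * |gder μ (slack ν w s) 0 t| ≤ gder μ (slack ν v s) 0 t :=
      (inv_mul_le_iff₀ hC).2 (hle t ht)
    linarith
  have hseg : v ∈ openSegment ℝ (v + (1 * C⁻¹) • w) (v + (-1 * C⁻¹) • w) := by
    refine ⟨1 / 2, 1 / 2, by norm_num, by norm_num, by norm_num, ?_⟩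
    funext i
    simp
    ring
  obtain ⟨r, -, hr⟩ := hext.left_mem_of_mem_openSegment (hmem 1 (by simp)) (hmem (-1) (by simp))
    ⟨1, zero_le_one, (one_smul _ _).symm⟩ hseg
  have hw : w = (C * (r - 1)) • v := by
    funext i
    have := congrFun hr i
    simp only [Pi.add_apply, Pi.smul_apply, smul_eq_mul, one_mul] at this ⊢
    field_simp at this
    linarith
  rw [hw, slack_smul, gder_smul] at hda
  have hz0 := (mul_eq_zero.1 hda).resolve_right hapos.ne'
  rw [hw, hz0, slack_smul, zero_smul] at hd0
  exact hd0 rfl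

lemma Touches.mem_extremeRays {N : ℕ} {μ : ℕ → ℝ} {ν lam : Fin N → ℝ} (hμ : IsExponents μ ν)
    {b : ℝ} {z : Fin N → ℝ} (h : Touches μ ν lam b z) {c : ℝ} (hc : 0 < c) :
    c • lam ∈ extremeRays (normalCone ν b) := by
  refine ⟨smul_ne_zero hc.ne' h.ne_zero, ?_, ?_⟩
  · rintro _ ⟨k, hk, rfl⟩
    exact smul_mem_normalCone hk (smul_mem_normalCone hc.le h.mem_normalCone)
  · rintro x hx y hy _ ⟨k, hk, rfl⟩ ⟨α, β, hα, hβ, -, hsum⟩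
    obtain ⟨s, hs, he⟩ := h.exists_eq_smul_of_add hμ (r := k * c)
      ((mem_normalCone_iff hμ).1 (smul_mem_normalCone hα.le hx))
      ((mem_normalCone_iff hμ).1 (smul_mem_normalCone hβ.le hy)) (by
        rw [← slack_add, hsum, smul_smul, slack_smul])
    have hx' : α • x = s • lam := eq_smul_of_slack he
    refine ⟨α⁻¹ * s * c⁻¹, by positivity, ?_⟩
    rw [smul_smul, mul_assoc, mul_assoc, inv_mul_cancel₀ hc.ne', mul_one, mul_smul, ← hx',
      smul_smul, inv_mul_cancel₀ hα.ne', one_smul]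

/-- The extreme rays are known from their zeros: the slack of each has the zeros of some member, and
these determine it up to a factor. -/
theorem isTightFamily_of_touches {N : ℕ} {ι : Type} {μ : ℕ → ℝ} {ν : Fin N → ℝ}
    (hμ : IsExponents μ ν) {lam : ι → Fin N → ℝ} {b : ι → ℝ} {z : ι → Fin N → ℝ}
    (h : ∀ p, Touches μ ν (lam p) (b p) (z p))
    (hsurj : ∀ y : Fin N → ℝ, Monotone y → (∀ k, y k ∈ Icc (0 : ℝ) 1) →
      (∀ a ∈ Ioo (0 : ℝ) 1, Even (mult y a)) → ∃ p, ∀ a, mult (z p) a = mult y a) :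
    IsTightFamily ν lam := by
  apply Subset.antisymm
  · intro v hv
    simp only [tightSet, mem_iUnion] at hv
    obtain ⟨s, hs, hv⟩ := hv
    obtain ⟨y, hy, heven⟩ := exists_zeros_of_extreme hμ hs hv
    obtain ⟨p, hp⟩ := hsurj y hy.monotone hy.mem_Icc heven
    obtain ⟨r, hr, he⟩ := (h p).exists_eq_smul_of_nonneg hμ (hy.vanishes.congr hp) (hy.nonneg hμ)
    have hvr := eq_smul_of_slack he
    refine ⟨p, r, lt_of_le_of_ne hr fun h0 => hy.ne_zero ?_, hvr⟩
    rw [hvr, ← h0, zero_smul]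
  · rintro _ ⟨p, c, hc, rfl⟩
    simp only [tightSet, mem_iUnion]
    exact ⟨b p, (h p).mem, (h p).mem_extremeRays hμ hc⟩

/-! ### Completeness -/

lemma continuous_curve {N : ℕ} {ν : Fin N → ℝ} (h0 : ∀ i, 0 < ν i) : Continuous (curve ν) :=
  continuous_pi fun i => continuous_id.rpow_const fun _ => Or.inr (h0 i).le

lemma exists_dotProduct_eq {N : ℕ} (f : (Fin N → ℝ) →ₗ[ℝ] ℝ) :
    ∃ v : Fin N → ℝ, ∀ x, f x = v ⬝ᵥ x := by
  refine ⟨fun i => f (Pi.single i 1), fun x => ?_⟩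
  conv_lhs => rw [pi_eq_sum_univ' x]
  simp [dotProduct, mul_comm]

/-- The vectors of a normal cone on which `sumForm` is `1`: a compact base of the cone. -/
def coneBase {N : ℕ} (μ : ℕ → ℝ) (ν : Fin N → ℝ) (s : ℝ) : Set (Fin N → ℝ) :=
  {v | v ∈ normalCone ν s ∧ sumForm μ (N + 1) (slack ν v s) = 1}

/-- `slack` as a linear map. -/
def slackL {N : ℕ} (ν : Fin N → ℝ) (s : ℝ) : (Fin N → ℝ) →ₗ[ℝ] (Fin (N + 1) → ℝ) where
  toFun v := slack ν v s
  map_add' v w := slack_add ν v w s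
  map_smul' r v := slack_smul ν r v s

lemma convex_normalCone {N : ℕ} (ν : Fin N → ℝ) (s : ℝ) : Convex ℝ (normalCone ν s) := by
  intro x hx y hy α β hα hβ _ t ht
  have h1 := smul_mem_normalCone hα hx ht
  have h2 := smul_mem_normalCone hβ hy ht
  simp only [mem_ofPred_eq, add_dotProduct] at h1 h2 ⊢
  linarith

lemma isClosed_normalCone {N : ℕ} (ν : Fin N → ℝ) (s : ℝ) : IsClosed (normalCone ν s) := by
  have : normalCone ν s = ⋂ t ∈ Icc (0 : ℝ) 1, {v | v ⬝ᵥ curve ν t ≤ v ⬝ᵥ curve ν s} := by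
    ext v
    simp only [mem_iInter]
    rfl
  rw [this]
  refine isClosed_biInter fun t _ => isClosed_le ?_ ?_ <;>
  · unfold dotProduct
    fun_prop

lemma convex_coneBase {N : ℕ} (μ : ℕ → ℝ) (ν : Fin N → ℝ) (s : ℝ) :
    Convex ℝ (coneBase μ ν s) := by
  intro x hx y hy α β hα hβ hαβ
  refine ⟨convex_normalCone ν s hx.1 hy.1 hα hβ hαβ, ?_⟩
  rw [slack_add, slack_smul, slack_smul, map_add, map_smul, map_smul, hx.2, hy.2]
  simpa using hαβ

/-- The values of the slack at the sample points embed the base into a cube. -/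
lemma isCompact_coneBase {N : ℕ} {μ : ℕ → ℝ} {ν : Fin N → ℝ} (hμ : IsExponents μ ν) (s : ℝ) :
    IsCompact (coneBase μ ν s) := by
  let T : (Fin N → ℝ) →ₗ[ℝ] (Fin (N + 1) → ℝ) :=
    (LinearMap.pi fun k => gderL μ (N + 1) 0 (sample k)) ∘ₗ slackL ν s
  have hT : ∀ v k, T v k = gder μ (slack ν v s) 0 (sample k) := fun v k => rfl
  have hinj : LinearMap.ker T = ⊥ := by
    rw [LinearMap.ker_eq_bot']
    intro v hv
    by_contra hne
    refine slack_ne_zero ν hne s (eq_zero_of_sample hμ.strictMono fun k => ?_)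
    rw [← hT, hv]
    rfl
  have hcomp := (LinearMap.isClosedEmbedding_of_injective hinj).isCompact_preimage
    (isCompact_univ_pi fun _ : Fin (N + 1) => isCompact_Icc (a := (0 : ℝ)) (b := 1))
  refine hcomp.of_isClosed_subset ?_ ?_
  · refine (isClosed_normalCone ν s).inter (isClosed_eq ?_ continuous_const)
    exact (LinearMap.continuous_of_finiteDimensional (sumForm μ (N + 1) ∘ₗ slackL ν s))
  · intro v hv k _
    have hnn := (mem_normalCone_iff hμ).1 hv.1
    rw [hT]
    refine ⟨hnn _ (sample_mem k), ?_⟩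
    rw [← hv.2, sumForm_apply]
    exact Finset.single_le_sum (f := fun k : Fin (N + 1) => gder μ (slack ν v s) 0 (sample k))
      (fun k _ => hnn _ (sample_mem k)) (Finset.mem_univ k)

/-- The extreme points of a base of the cone span extreme rays: the summands `α x` and `β y` of a
point of the ray, scaled to the base, represent `v` as a convex combination. -/
lemma mem_extremeRays_of_mem_extremePoints {N : ℕ} {μ : ℕ → ℝ} {ν : Fin N → ℝ}
    (hμ : IsExponents μ ν) {s : ℝ} {v : Fin N → ℝ} (hv : v ∈ (coneBase μ ν s).extremePoints ℝ) :
    v ∈ extremeRays (normalCone ν s) := by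
  obtain ⟨⟨hvL, hv1⟩, hext⟩ := hv
  have hpos : ∀ x ∈ normalCone ν s, x ≠ 0 → 0 < sumForm μ (N + 1) (slack ν x s) :=
    fun x hx hne => sumForm_pos hμ.strictMono (slack_ne_zero ν hne s) ((mem_normalCone_iff hμ).1 hx)
  have hscale : ∀ x ∈ normalCone ν s, x ≠ 0 →
      (sumForm μ (N + 1) (slack ν x s))⁻¹ • x ∈ coneBase μ ν s := fun x hx hne =>
    ⟨smul_mem_normalCone (inv_nonneg.2 (hpos x hx hne).le) hx, by
      rw [slack_smul, map_smul, smul_eq_mul, inv_mul_cancel₀ (hpos x hx hne).ne']⟩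
  refine ⟨?_, ?_, ?_⟩
  · rintro rfl
    have h0 : slack ν 0 s = 0 := (slackL ν s).map_zero
    rw [h0, map_zero] at hv1
    exact zero_ne_one hv1
  · rintro _ ⟨k, hk, rfl⟩
    exact smul_mem_normalCone hk hvL
  · rintro x hx y hy _ ⟨k, hk, rfl⟩ ⟨α, β, hα, hβ, -, hsum⟩
    by_cases hx0 : x = 0
    · exact ⟨0, le_rfl, by rw [hx0, zero_smul]⟩
    have hφ : α * sumForm μ (N + 1) (slack ν x s) + β * sumForm μ (N + 1) (slack ν y s) = k := by
      have := congrArg (fun x => sumForm μ (N + 1) (slack ν x s)) hsum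
      simpa [slack_add, slack_smul, hv1] using this
    set X := sumForm μ (N + 1) (slack ν x s)
    set Y := sumForm μ (N + 1) (slack ν y s)
    have hX : 0 < X := hpos x hx hx0
    by_cases hy0 : y = 0
    · refine ⟨α⁻¹ * k, by positivity, ?_⟩
      rw [hy0, smul_zero, add_zero] at hsum
      rw [mul_smul, ← hsum, smul_smul, inv_mul_cancel₀ hα.ne', one_smul]
    have hY : 0 < Y := hpos y hy hy0
    have hkpos : 0 < k := by rw [← hφ]; positivity
    have heq := hext (hscale x hx hx0) (hscale y hy hy0) ⟨α * X / k, β * Y / k, by positivity,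
      by positivity, by rw [← add_div, hφ, div_self hkpos.ne'], by
        rw [smul_smul, smul_smul, show α * X / k * X⁻¹ = k⁻¹ * α by field_simp,
          show β * Y / k * Y⁻¹ = k⁻¹ * β by field_simp, mul_smul, mul_smul, ← smul_add, hsum,
          smul_smul, inv_mul_cancel₀ hkpos.ne', one_smul]⟩
    refine ⟨X, hX.le, ?_⟩
    rw [← heq, smul_smul, mul_inv_cancel₀ hX.ne', one_smul]

/-- A separating linear form lies in the normal cone of a point `s` of the curve; by the
Krein–Milman theorem, it suffices to consider the extreme rays of this cone. -/
theorem isCompleteFamily_of_tight {N : ℕ} {ι : Type} {μ : ℕ → ℝ} {ν : Fin N → ℝ}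
    (hμ : IsExponents μ ν) (h0 : ∀ i, 0 < ν i) {lam : ι → Fin N → ℝ} (h : IsTightFamily ν lam) :
    IsCompleteFamily ν lam := by
  have hcont := continuous_curve h0
  have hcompact : IsCompact (curve ν '' Icc 0 1) := isCompact_Icc.image hcont
  have hdot : ∀ v : Fin N → ℝ, Continuous fun x => v ⬝ᵥ x := fun v => by
    unfold dotProduct; fun_prop
  apply Subset.antisymm
  · intro x hx p
    have hconv : Convex ℝ {x | Satisfies ν (lam p) x} := by
      intro x hx y hy α β hα hβ hαβ
      simp only [Satisfies, mem_ofPred_eq, dotProduct_add, dotProduct_smul, smul_eq_mul] at hx hy ⊢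
      calc α * (lam p ⬝ᵥ x) + β * (lam p ⬝ᵥ y) ≤ α * bound ν (lam p) + β * bound ν (lam p) := by
            gcongr
        _ = bound ν (lam p) := by rw [← add_mul, hαβ, one_mul]
    refine convexHull_min ?_ hconv hx
    rintro _ ⟨t, ht, rfl⟩
    change lam p ⬝ᵥ curve ν t ≤ sSup (values ν (lam p))
    refine le_csSup ?_ (mem_image_of_mem _ ht)
    exact (isCompact_Icc.image ((hdot (lam p)).comp hcont)).bddAbove
  · intro x hx
    by_contra hnot
    obtain ⟨f, u, hf, hfx⟩ := geometric_hahn_banach_closed_point (convex_convexHull ℝ _)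
      (isCompact_convexHull_of_isCompact hcompact).isClosed hnot
    obtain ⟨v, hv⟩ := exists_dotProduct_eq (f : (Fin N → ℝ) →ₗ[ℝ] ℝ)
    have hfv : ∀ y, f y = v ⬝ᵥ y := hv
    obtain ⟨s, hs, hmax⟩ := isCompact_Icc.exists_isMaxOn (nonempty_Icc.2 zero_le_one)
      ((hdot v).comp hcont).continuousOn
    have hvL : v ∈ normalCone ν s := hmax
    have hlt : v ⬝ᵥ curve ν s < v ⬝ᵥ x := by
      rw [← hfv, ← hfv]
      exact (hf _ (subset_convexHull ℝ _ ⟨s, hs, rfl⟩)).trans hfx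
    have hv0 : v ≠ 0 := by rintro rfl; simp at hlt
    -- all members tight at `s` fail to separate `x`, hence so does the whole normal cone of `s`
    have hsub : coneBase μ ν s ⊆ {v | v ⬝ᵥ x ≤ v ⬝ᵥ curve ν s} := by
      rw [← closure_convexHull_extremePoints (isCompact_coneBase hμ s) (convex_coneBase μ ν s)]
      refine closure_minimal (convexHull_min ?_ ?_) (isClosed_le ?_ ?_)
      · intro w hw
        have hwE := mem_extremeRays_of_mem_extremePoints hμ hw
        have hwT : w ∈ tightSet ν := by
          simp only [tightSet, mem_iUnion]
          exact ⟨s, hs, hwE⟩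
        rw [h] at hwT
        obtain ⟨p, c, hc, rfl⟩ := hwT
        have hpL : lam p ∈ normalCone ν s := by
          have := smul_mem_normalCone (inv_nonneg.2 hc.le) hw.1.1
          rwa [smul_smul, inv_mul_cancel₀ hc.ne', one_smul] at this
        have hxp := hx p
        rw [Satisfies, bound_eq hs hpL] at hxp
        simp only [mem_ofPred_eq, smul_dotProduct, smul_eq_mul]
        exact mul_le_mul_of_nonneg_left hxp hc.le
      · intro y hy y' hy' α β hα hβ _
        simp only [mem_ofPred_eq, add_dotProduct, smul_dotProduct, smul_eq_mul] at hy hy' ⊢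
        exact add_le_add (mul_le_mul_of_nonneg_left hy hα) (mul_le_mul_of_nonneg_left hy' hβ)
      all_goals
        unfold dotProduct
        fun_prop
    have hφ := sumForm_pos hμ.strictMono (slack_ne_zero ν hv0 s) ((mem_normalCone_iff hμ).1 hvL)
    have hmem := hsub (show (sumForm μ (N + 1) (slack ν v s))⁻¹ • v ∈ coneBase μ ν s from
      ⟨smul_mem_normalCone (inv_nonneg.2 hφ.le) hvL, by
        rw [slack_smul, map_smul, smul_eq_mul, inv_mul_cancel₀ hφ.ne']⟩)
    simp only [mem_ofPred_eq, smul_dotProduct, smul_eq_mul] at hmem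
    exact absurd (le_of_mul_le_mul_left hmem (inv_pos.2 hφ)) (not_le.2 hlt)

/-! ### Independence -/

/-- Two slacks that are multiples of each other have the same zeros. -/
lemma Touches.mult_eq {N : ℕ} {μ : ℕ → ℝ} {ν : Fin N → ℝ} (hμ : IsExponents μ ν)
    {v w : Fin N → ℝ} {b b' : ℝ} {y z : Fin N → ℝ} (hy : Touches μ ν v b y)
    (hz : Touches μ ν w b' z) {r : ℝ} (h : slack ν v b = r • slack ν w b') (a : ℝ) :
    mult y a = mult z a := by
  have hvz : VanishesAt (gder μ (slack ν v b)) z := h ▸ hz.vanishes.smul r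
  have h0 := slack_ne_zero ν hy.ne_zero b
  rcases lt_or_ge a 0 with ha | ha
  · have : ∀ y : Fin N → ℝ, (∀ k, y k ∈ Icc (0 : ℝ) 1) → mult y a = 0 := fun y hy =>
      Nat.eq_zero_of_not_pos fun hp => by
        obtain ⟨k, rfl⟩ := mult_pos_iff.1 hp
        linarith [(hy k).1]
    rw [this y hy.mem_Icc, this z hz.mem_Icc]
  · have h1 := gder_mult_ne_zero hμ.strictMono hy.monotone (fun k => (hy.mem_Icc k).1) h0
      hy.vanishes ha
    have h2 := gder_mult_ne_zero hμ.strictMono hz.monotone (fun k => (hz.mem_Icc k).1) h0 hvz ha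
    exact le_antisymm (not_lt.1 fun hlt => h2 (hy.vanishes a _ hlt))
      (not_lt.1 fun hlt => h1 (hvz a _ hlt))

/-- The slack of a member is an extreme point of the normalized nonnegative generalized
polynomials, hence not in the convex hull of finitely many other members and the constant; a
separating linear form is the evaluation at a point that violates only this one inequality. -/
theorem isIndependentFamily_of_touches {N : ℕ} {ι : Type} {μ : ℕ → ℝ} {ν : Fin N → ℝ}
    (hμ : IsExponents μ ν) {lam : ι → Fin N → ℝ} {b : ι → ℝ} {z : ι → Fin N → ℝ}
    (h : ∀ p, Touches μ ν (lam p) (b p) (z p))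
    (hinj : ∀ p q, (∀ a, mult (z p) a = mult (z q) a) → p = q) :
    IsIndependentFamily ν lam := by
  classical
  intro p F hp
  -- `φ` normalizes, `sl q` is the slack of the member `q`, `K` a base of the cone of nonnegative
  -- generalized polynomials
  let φ := sumForm μ (N + 1)
  let unit : (Fin (N + 1) → ℝ) → Fin (N + 1) → ℝ := fun c => (φ c)⁻¹ • c
  let sl : ι → Fin (N + 1) → ℝ := fun q => slack ν (lam q) (b q)
  let one : Fin (N + 1) → ℝ := Pi.single 0 1
  let K : Set (Fin (N + 1) → ℝ) := {c | (∀ t ∈ Icc (0 : ℝ) 1, 0 ≤ gder μ c 0 t) ∧ φ c = 1}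
  have hone : ∀ t, gder μ one 0 t = 1 := fun t => by
    rw [gder_eq hμ]
    simp [one, dotProduct]
  have hone0 : one ≠ 0 := fun h0 => by simpa [one] using congrFun h0 0
  have hunit : ∀ c, c ≠ 0 → (∀ t ∈ Icc (0 : ℝ) 1, 0 ≤ gder μ c 0 t) → 0 < φ c ∧ unit c ∈ K := by
    intro c hc hnn
    have hpos : 0 < φ c := sumForm_pos hμ.strictMono hc hnn
    refine ⟨hpos, fun t ht => ?_, ?_⟩
    · rw [gder_smul]
      exact mul_nonneg (inv_nonneg.2 hpos.le) (hnn t ht)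
    · simp only [unit, map_smul, smul_eq_mul, inv_mul_cancel₀ hpos.ne']
  have hsl : ∀ q, 0 < φ (sl q) ∧ unit (sl q) ∈ K := fun q =>
    hunit _ (slack_ne_zero ν (h q).ne_zero _) ((h q).nonneg hμ)
  have ho := hunit one hone0 fun t _ => by rw [hone]; exact zero_le_one
  have hKconv : Convex ℝ K := by
    intro x hx y hy α β hα hβ hαβ
    refine ⟨fun t ht => ?_, ?_⟩
    · rw [gder_add, gder_smul, gder_smul]
      exact add_nonneg (mul_nonneg hα (hx.1 t ht)) (mul_nonneg hβ (hy.1 t ht))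
    · rw [map_add, map_smul, map_smul, hx.2, hy.2]
      simpa using hαβ
  have hext : unit (sl p) ∈ K.extremePoints ℝ := by
    refine ⟨(hsl p).2, ?_⟩
    rintro x hx y hy ⟨α, β, hα, hβ, -, hsum⟩
    obtain ⟨s, -, he⟩ := (h p).exists_eq_smul_of_add hμ (r := (φ (sl p))⁻¹) (d := α • x)
      (e := β • y) (fun t ht => by rw [gder_smul]; exact mul_nonneg hα.le (hx.1 t ht))
      (fun t ht => by rw [gder_smul]; exact mul_nonneg hβ.le (hy.1 t ht)) hsum
    have hx' : x = (α⁻¹ * s) • sl p := by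
      rw [mul_smul, ← he, smul_smul, inv_mul_cancel₀ hα.ne', one_smul]
    have h1 := hx.2
    rw [hx', map_smul, smul_eq_mul] at h1
    rw [hx', eq_inv_of_mul_eq_one_left h1]
  let A : Set (Fin (N + 1) → ℝ) := insert (unit one) ((fun q => unit (sl q)) '' (F : Set ι))
  have hAfin : A.Finite := (F.finite_toSet.image _).insert _
  have hAK : A ⊆ K := by
    rintro _ (rfl | ⟨q, -, rfl⟩)
    · exact ho.2
    · exact (hsl q).2
  have hnot : unit (sl p) ∉ convexHull ℝ A := by
    intro hmem
    have hsub : convexHull ℝ A ⊆ K := convexHull_min hAK hKconv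
    have hmem' : unit (sl p) ∈ (convexHull ℝ A).extremePoints ℝ :=
      inter_extremePoints_subset_extremePoints_of_subset hsub ⟨hmem, hext⟩
    have hA : unit (sl p) ∈ A := extremePoints_convexHull_subset hmem'
    rcases hA with heq | ⟨q, hq, heq⟩
    · have h1 := congrArg (fun c => gder μ c 0 (b p)) heq
      simp only [unit, sl, gder_smul, gder_slack hμ, sub_self, mul_zero, hone, mul_one] at h1
      exact (inv_pos.2 ho.1).ne h1
    · have h1 : sl p = (φ (sl p) * (φ (sl q))⁻¹) • sl q := by
        have : (φ (sl q))⁻¹ • sl q = (φ (sl p))⁻¹ • sl p := heq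
        rw [mul_smul, this, smul_smul, mul_inv_cancel₀ (hsl p).1.ne', one_smul]
      have := hinj p q ((h p).mult_eq hμ (h q) h1)
      exact hp (this ▸ hq)
  obtain ⟨f, u, hfp, hfA⟩ := geometric_hahn_banach_point_closed (convex_convexHull ℝ A)
    (hAfin.isClosed_convexHull ℝ) hnot
  -- subtracting `u • φ` replaces the level `u` on the base `φ = 1` by the level `0` on the cone
  let g : (Fin (N + 1) → ℝ) →ₗ[ℝ] ℝ := (f : (Fin (N + 1) → ℝ) →ₗ[ℝ] ℝ) - u • φ
  have hg : ∀ c, 0 < φ c → g c = φ c * (f (unit c) - u) := by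
    intro c hc
    simp only [g, unit, LinearMap.sub_apply, LinearMap.smul_apply, smul_eq_mul, map_smul]
    have : φ c * ((φ c)⁻¹ * f c - u) = f c - u * φ c := by
      field_simp
    rw [this]
    rfl
  have hgpos : ∀ c, 0 < φ c → unit c ∈ A → 0 < g c := fun c hc hA => by
    rw [hg c hc]
    exact mul_pos hc (sub_pos.2 (hfA _ (subset_convexHull ℝ A hA)))
  have hg1 : 0 < g one := hgpos one ho.1 (mem_insert _ _)
  -- divided by its value on the constant `1`, the form `g` maps the slack of every `λ` to
  -- `λ · Π(b) - λ · x`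
  obtain ⟨w, hw⟩ := exists_dotProduct_eq g
  have hw0 : g one = w 0 := by
    rw [hw]
    simp [one]
  let x : Fin N → ℝ := fun i => w i.succ / w 0
  have hx : ∀ q, lam q ⬝ᵥ curve ν (b q) - lam q ⬝ᵥ x = g (sl q) / w 0 := by
    intro q
    have hw0' : w 0 ≠ 0 := hw0 ▸ hg1.ne'
    rw [hw, show w ⬝ᵥ sl q = _ from Fin.sum_univ_succ _]
    simp only [sl, slack, Fin.cons_zero, Fin.cons_succ, x, dotProduct, Pi.neg_apply]
    rw [add_div, mul_div_cancel_left₀ _ hw0', sub_eq_add_neg, Finset.sum_div,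
      ← Finset.sum_neg_distrib]
    congr 1
    exact Finset.sum_congr rfl fun i _ => by ring
  rw [hw0] at hg1
  refine ⟨x, fun q hq => ?_, fun hsat => ?_⟩
  · rw [Satisfies, bound_eq (h q).mem (h q).mem_normalCone]
    have := div_pos (hgpos (sl q) (hsl q).1 (mem_insert_of_mem _ ⟨q, hq, rfl⟩)) hg1
    rw [← hx q] at this
    linarith
  · rw [Satisfies, bound_eq (h p).mem (h p).mem_normalCone] at hsat
    have hneg : g (sl p) < 0 := by
      rw [hg _ (hsl p).1]
      exact mul_neg_of_pos_of_neg (hsl p).1 (sub_neg.2 hfp)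
    have := div_neg_of_neg_of_pos hneg hg1
    rw [← hx p] at this
    linarith

/-! ### Limits -/

/-- The normalized normal vector depends continuously on the zeros of the slack: a cluster point
has the limiting zeros, which determine it. -/
theorem tendsto_normalized_of_touches {N : ℕ} {α : Type*} {μ : ℕ → ℝ} {ν : Fin N → ℝ}
    (hμ : IsExponents μ ν) (h0 : ∀ i, 0 < ν i) {l : Filter α} {lam : α → Fin N → ℝ} {b : α → ℝ}
    {z : α → Fin N → ℝ} (h : ∀ᶠ s in l, Touches μ ν (lam s) (b s) (z s)) {lam₀ : Fin N → ℝ}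
    {b₀ : ℝ} {z₀ : Fin N → ℝ} (h₀ : Touches μ ν lam₀ b₀ z₀) (hb : Tendsto b l (𝓝 b₀))
    (hz : Tendsto z l (𝓝 z₀)) :
    Tendsto (fun s => normalized (lam s)) l (𝓝 (normalized lam₀)) := by
  have hcurve := continuous_curve h0
  have hnorm : ∀ v : Fin N → ℝ, v ≠ 0 → 0 < ‖WithLp.toLp 2 v‖ := fun v hv =>
    norm_pos_iff.2 fun h => hv (by simpa using congrArg WithLp.ofLp h)
  let S : Set (Fin N → ℝ) := WithLp.ofLp '' Metric.sphere (0 : EuclideanSpace ℝ (Fin N)) 1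
  have hS : IsCompact S := (isCompact_sphere _ _).image (PiLp.continuous_ofLp 2 _)
  have hmemS : ∀ v : Fin N → ℝ, v ≠ 0 → normalized v ∈ S := fun v hv =>
    ⟨WithLp.toLp 2 (normalized v), by
      rw [mem_sphere_zero_iff_norm, normalized, WithLp.toLp_smul, norm_smul, norm_inv, norm_norm,
        inv_mul_cancel₀ (hnorm v hv).ne'], rfl⟩
  refine hS.tendsto_nhds_of_unique_mapClusterPt (h.mono fun s hs => hmemS _ hs.ne_zero) ?_
  intro v hvS hcl
  have hnormv : ‖WithLp.toLp 2 v‖ = 1 := by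
    obtain ⟨v', hv', rfl⟩ := hvS
    exact mem_sphere_zero_iff_norm.1 hv'
  -- along an ultrafilter the interlacing zeros of the derivatives converge, too
  obtain ⟨U, hU, hlim⟩ := mapClusterPt_iff_ultrafilter.1 hcl
  have hbU := hb.mono_left hU
  have hslack : Tendsto (fun s => slack ν (normalized (lam s)) (b s)) U (𝓝 (slack ν v b₀)) := by
    have hcont : Continuous fun q : (Fin N → ℝ) × ℝ => slack ν q.1 q.2 := by
      refine continuous_pi fun i => ?_
      refine Fin.cases ?_ (fun i => ?_) i
      · simp only [slack, Fin.cons_zero, dotProduct]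
        exact continuous_finsetSum _ fun i _ => ((continuous_apply i).comp continuous_fst).mul
          ((continuous_apply i).comp (hcurve.comp continuous_snd))
      · simp only [slack, Fin.cons_succ, Pi.neg_apply]
        exact ((continuous_apply i).comp continuous_fst).neg
    have hpair : Tendsto (fun s => (normalized (lam s), b s)) U (𝓝 (v, b₀)) :=
      hlim.prodMk_nhds hbU
    exact (hcont.tendsto _).comp hpair
  have hvan : VanishesAt (gder μ (slack ν v b₀)) z₀ := by
    refine VanishesAt.of_tendsto (U := U)
      (F := fun s => gder μ (slack ν (normalized (lam s)) (b s)))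
      (fun s => isChain_gder hμ.strictMono _)
      (fun j p p₀ _ hp => tendsto_gder hμ.strictMono hslack j hp) (z := z) ?_ (hz.mono_left hU)
    filter_upwards [hU h] with s hs
    refine ⟨hs.monotone, fun k => (hs.mem_Icc k).1, ?_⟩
    rw [normalized, slack_smul]
    exact hs.vanishes.smul _
  have hnn : ∀ t ∈ Icc (0 : ℝ) 1, 0 ≤ gder μ (slack ν v b₀) 0 t := by
    intro t ht
    refine ge_of_tendsto (tendsto_gder hμ.strictMono hslack 0 tendsto_const_nhds) ?_
    filter_upwards [hU h] with s hs
    rw [normalized, slack_smul, gder_smul]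
    exact mul_nonneg (inv_nonneg.2 (norm_nonneg _)) (hs.nonneg hμ t ht)
  obtain ⟨r, hr, he⟩ := h₀.exists_eq_smul_of_nonneg hμ hvan hnn
  have hvr : v = r • lam₀ := eq_smul_of_slack he
  have hr1 : r * ‖WithLp.toLp 2 lam₀‖ = 1 := by
    rw [← hnormv, hvr, WithLp.toLp_smul, norm_smul, Real.norm_of_nonneg hr]
  rw [hvr, normalized, eq_inv_of_mul_eq_one_left hr1]

/-! ### Signs of bordered determinants -/

lemma borderedDet_insertNth {n : ℕ} (p : Fin (n + 1)) (x w : Fin (n + 2) → ℝ)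
    (P : Fin n → Fin (n + 2) → ℝ) :
    borderedDet x (p.insertNth w P : Fin (n + 1) → Fin (n + 2) → ℝ) =
      (-1) ^ ((p : ℕ) + 1) * borderedDet w (Fin.cons x P : Fin (n + 1) → Fin (n + 2) → ℝ) := by
  have h := det_insertNth p.succ w (Fin.cons x P : Fin (n + 1) → Fin (n + 2) → ℝ)
  rw [Fin.val_succ] at h
  rw [← h, borderedDet]
  congr 2
  exact (Fin.insertNth_succ_cons p w x P).symm

/-- The position of a row matters only up to parity. -/
lemma borderedDet_insertNth_congr {n : ℕ} {p q : Fin (n + 1)} (hpq : Even ((p : ℕ) + q))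
    (x w : Fin (n + 2) → ℝ) (P : Fin n → Fin (n + 2) → ℝ) :
    borderedDet x (p.insertNth w P : Fin (n + 1) → Fin (n + 2) → ℝ) =
      borderedDet x (q.insertNth w P : Fin (n + 1) → Fin (n + 2) → ℝ) := by
  rw [borderedDet_insertNth, borderedDet_insertNth]
  congr 1
  rw [pow_succ, pow_succ]
  congr 1
  rcases Nat.even_or_odd (p : ℕ) with hp | hp
  · rw [hp.neg_one_pow, ((Nat.even_add.1 hpq).1 hp).neg_one_pow]
  · have hq : Odd (q : ℕ) := Nat.not_even_iff_odd.1 fun hq =>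
      Nat.not_even_iff_odd.2 hp ((Nat.even_add.1 hpq).2 hq)
    rw [hp.neg_one_pow, hq.neg_one_pow]

/-- The rows `v`, completed by a column of entries `e`, after adding `e` times the row `a`. -/
def liftRow {n : ℕ} (a : Fin n → ℝ) (e : ℝ) (v : Fin n → ℝ) : Fin (n + 1) → ℝ :=
  Fin.cons e (v + e • a)

lemma borderedDet_lift {n : ℕ} (p : Fin (n + 1)) (a : Fin (n + 1) → ℝ)
    (v : Fin n → Fin (n + 1) → ℝ) (e : Fin n → ℝ) (x : Fin (n + 1) → ℝ) (e₀ : ℝ) :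
    borderedDet (liftRow a e₀ x) (p.insertNth (liftRow a 1 0) (fun k => liftRow a (e k) (v k)) :
      Fin (n + 1) → Fin (n + 2) → ℝ) = (-1) ^ ((p : ℕ) + 1) * borderedDet x v := by
  rw [borderedDet_insertNth]
  congr 1
  have h := det_lift a (Fin.cons x v : Fin (n + 1) → Fin (n + 1) → ℝ) (Fin.cons e₀ e)
  rw [borderedDet, borderedDet, ← h]
  congr 2
  funext k
  refine Fin.cases ?_ (fun k => ?_) k
  · simp [liftRow]
  · refine Fin.cases ?_ (fun k => ?_) k
    · simp [liftRow]
    · simp [liftRow]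

/-! ### Inequalities from determinants -/

/-- An inequality whose normal vector is, up to the factor `σ`, the expansion of the determinant with
rows of derivatives at the nodes `z`, written with the rows lifted by `Π(b)`. The sign condition says
that the determinant, whose sign is that of `(-1) ^ numBelow z t`, makes the slack positive. -/
lemma touches_of_det {N : ℕ} {μ : ℕ → ℝ} {ν lam : Fin N → ℝ} (hμ : IsExponents μ ν)
    {z : Fin N → ℝ} (hz : Monotone z) (hz1 : ∀ k, z k ∈ Icc (0 : ℝ) 1) {b σ : ℝ}
    (hb : b ∈ Icc (0 : ℝ) 1)
    (hlam : ∀ e y, lam ⬝ᵥ y = σ * borderedDet (liftRow (curve ν b) e y) (genRows μ z))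
    (hpar : ∀ t ∈ Icc (0 : ℝ) 1, (∀ k, z k ≠ t) → σ * (-1) ^ numBelow z t = -1) :
    Touches μ ν lam b z := by
  have hslack : slack ν lam b = (-σ) • hodgeStar (genRows μ z) := by
    funext i
    refine Fin.cases ?_ (fun i => ?_) i
    · have h := hlam 1 (-curve ν b)
      rw [dotProduct_neg] at h
      simp only [slack, Fin.cons_zero, Pi.smul_apply, smul_eq_mul, neg_mul]
      rw [← neg_neg (lam ⬝ᵥ curve ν b), h, hodgeStar]
      congr 3
      funext j
      refine Fin.cases ?_ (fun j => ?_) j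
      · simp [liftRow]
      · simp [liftRow]
    · have h := hlam 0 (Pi.single i 1)
      rw [dotProduct_single, mul_one] at h
      simp only [slack, Fin.cons_succ, Pi.neg_apply, Pi.smul_apply, smul_eq_mul, neg_mul]
      rw [h, hodgeStar]
      congr 3
      funext j
      refine Fin.cases ?_ (fun j => ?_) j
      · simp [liftRow]
      · simp [liftRow, Pi.single_apply]
  have hv : VanishesAt (gder μ (slack ν lam b)) z := by
    rw [hslack]
    exact (vanishesAt_hodgeStar hμ.strictMono fun k => (hz1 k).1).smul _
  have hpos : ∀ t ∈ Icc (0 : ℝ) 1, (∀ k, z k ≠ t) → 0 < gder μ (slack ν lam b) 0 t := by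
    intro t ht htz
    rw [hslack, gder_smul, gder_zero hμ.zero, hodgeStar_dotProduct]
    have h1 := borderedDet_sign hμ.strictMono hμ.zero hz (fun k => (hz1 k).1) ht.1 htz
    have h2 := hpar t ht htz
    set q := (-1 : ℝ) ^ numBelow z t with hq
    have hqq : q * q = 1 := by rw [hq, ← mul_pow]; simp
    have hσ : σ = -q := by
      calc σ = σ * (q * q) := by rw [hqq, mul_one]
        _ = (σ * q) * q := by ring
        _ = -q := by rw [h2]; ring
    rw [hσ, neg_neg]
    exact h1
  refine ⟨?_, hb, ?_, hz, hz1, hv⟩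
  · rintro rfl
    obtain ⟨t, ht, htz⟩ := (Icc_infinite (zero_lt_one' ℝ)).exists_notMem_finite
      (finite_range z)
    have := hpos t ht fun k hk => htz ⟨k, hk⟩
    rw [gder_slack hμ] at this
    simp at this
  · rw [mem_normalCone_iff hμ]
    intro t ht
    by_cases h : ∃ k, z k = t
    · exact (hv t 0 (mult_pos_iff.2 h)).ge
    · push Not at h
      exact (hpos t ht h).le

lemma gen_zero_row {N : ℕ} {μ : ℕ → ℝ} {ν : Fin N → ℝ} (hμ : IsExponents μ ν) (t t' : ℝ) :
    (fun i : Fin (N + 1) => gen μ 0 t i) = liftRow (curve ν t') 1 (curve ν t - curve ν t') := by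
  funext i
  rw [gen_zero hμ.strictMono hμ.zero]
  refine Fin.cases ?_ (fun i => ?_) i
  · simp [liftRow, hμ.zero]
  · simp [liftRow, hμ.succ, curve]

lemma curveDeriv_eq_gen {N : ℕ} {μ : ℕ → ℝ} {ν : Fin N → ℝ} (hμ : IsExponents μ ν) (h1 : μ 1 = 1)
    {j : ℕ} (hj : j ≠ 0) (t : ℝ) (i : Fin N) : curveDeriv ν j t i = gen μ j t (i + 1) := by
  rw [curveDeriv, gen]
  by_cases ht : t = 0
  · subst ht
    simp only [true_and, if_true]
    split_ifs with h2 h3 h3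
    · rfl
    · rfl
    · obtain rfl : j = 1 := by omega
      have hi : ν i = 1 := by rw [← hμ.succ, h3, h1]
      rw [iteratedDeriv_one, hi]
      simp
    · obtain rfl : j = 1 := by omega
      have hi : 1 < ν i := by
        rw [← hμ.succ, ← h1]
        exact hμ.strictMono (by omega)
      rw [iteratedDeriv_one, (Real.hasDerivAt_rpow_const (Or.inr hi.le)).deriv,
        Real.zero_rpow (by linarith), mul_zero]
  · rw [if_neg (fun h => ht h.1), if_neg ht, iteratedDeriv_eq_iterate, Real.iter_deriv_rpow_const,
      hμ.succ]

/-- The rows of derivatives in the two settings: with and without the constant function `1`. -/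
lemma gen_row {N : ℕ} {μ : ℕ → ℝ} {ν : Fin N → ℝ} (hμ : IsExponents μ ν) (h1 : μ 1 = 1) (j : ℕ)
    (t t' : ℝ) : (fun i : Fin (N + 1) => gen μ j t i) =
      liftRow (curve ν t') (if j = 0 then 1 else 0) (deltaDeriv ν j t t') := by
  by_cases hj : j = 0
  · subst hj
    simpa [deltaDeriv] using gen_zero_row hμ t t'
  · funext i
    rw [deltaDeriv, if_neg hj, if_neg hj]
    refine Fin.cases ?_ (fun i => ?_) i
    · simp only [liftRow, Fin.cons_zero, Fin.val_zero, gen, hμ.zero]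
      split_ifs with h h'
      · exact absurd h'.symm hj
      · exact if_neg ‹_›
      · obtain ⟨j, rfl⟩ := Nat.exists_eq_succ_of_ne_zero hj
        rw [descPochhammer_succ_left]
        simp
    · simp [liftRow, curveDeriv_eq_gen hμ h1 hj]

lemma earlier_dbl {m : ℕ} (t : Fin m → ℝ) (i : Fin (2 * m)) :
    earlier (dbl t) i = 2 * earlier t ⟨i / 2, by omega⟩ + i % 2 := by
  rcases Nat.mod_two_eq_zero_or_one i with h | h
  · have := earlier_dbl_even t ⟨i / 2, by omega⟩ (by dsimp only; omega)
    rw [← this, h, add_zero]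
    congr 1
    ext
    dsimp only
    omega
  · have := earlier_dbl_odd t ⟨i / 2, by omega⟩ (by dsimp only; omega)
    rw [h, ← this]
    congr 1
    ext
    dsimp only
    omega

lemma interleave_deltaDeriv {N m : ℕ} (ν : Fin N → ℝ) (t : Fin m → ℝ) (d : Fin m → ℕ) (t' : ℝ)
    (i : Fin (2 * m)) :
    interleave (fun k => deltaDeriv ν (2 * earlier t k + d k) (t k) t')
      (fun k => deltaDeriv ν (2 * earlier t k + 1 + d k) (t k) t') i =
      deltaDeriv ν (earlier (dbl t) i + d ⟨i / 2, by omega⟩) (dbl t i) t' := by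
  rw [interleave, earlier_dbl, dbl]
  split_ifs with h
  · rw [h, add_zero]
  · rw [Nat.mod_two_ne_zero.1 h]

lemma genRows_apply (μ : ℕ → ℝ) {n : ℕ} (z : Fin n → ℝ) (k : Fin n) :
    genRows μ z k = fun i : Fin (n + 1) => gen μ (earlier z k) (z k) i := rfl

/-! ### Odd dimension -/

/-- The zeros `τ, t_1, t_1, …, t_m, t_m`, in nondecreasing order. -/
def zOdd {m : ℕ} (t : Fin m → ℝ) (τ : Fin 2) : Fin (2 * m + 1) → ℝ :=
  (if τ = 0 then 0 else Fin.last (2 * m)).insertNth (τ : ℝ) (dbl t)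

lemma mult_zOdd {m : ℕ} (t : Fin m → ℝ) (τ : Fin 2) (a : ℝ) :
    mult (zOdd t τ) a = (if (τ : ℝ) = a then 1 else 0) + 2 * mult t a := by
  rw [zOdd, mult_insertNth, mult_dbl]

lemma fin_two_cases (τ : Fin 2) : (τ = 0 ∧ ((τ : ℕ) : ℝ) = 0) ∨ (τ = 1 ∧ ((τ : ℕ) : ℝ) = 1) := by
  fin_cases τ <;> simp

lemma insertNth_mem_Icc {n : ℕ} {z : Fin n → ℝ} (hz : ∀ k, z k ∈ Icc (0 : ℝ) 1) {a : ℝ}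
    (ha : a ∈ Icc (0 : ℝ) 1) (p k : Fin (n + 1)) :
    (p.insertNth a z : Fin (n + 1) → ℝ) k ∈ Icc (0 : ℝ) 1 := by
  induction k using Fin.succAboveCases p with
  | x => simpa using ha
  | p k => simpa using hz k

lemma dbl_mem_Icc {m : ℕ} {t : Fin m → ℝ} (ht : t ∈ closedSimplex m) (k : Fin (2 * m)) :
    dbl t k ∈ Icc (0 : ℝ) 1 := ht.2 _

lemma zOdd_eq {m : ℕ} {t : Fin m → ℝ} (ht : t ∈ closedSimplex m) (τ : Fin 2) :
    zOdd t τ = ((insertPos (dbl t) (τ : ℝ)).insertNth (τ : ℝ) (dbl t) : Fin (2 * m + 1) → ℝ) := by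
  have hd := monotone_dbl ht.1
  refine eq_of_mult_eq ?_ (monotone_insertPos hd _) fun a => by
    rw [zOdd, mult_insertNth, mult_insertNth]
  rcases fin_two_cases τ with ⟨rfl, h⟩ | ⟨rfl, h⟩
  · rw [zOdd, if_pos rfl]
    exact monotone_insertNth hd (fun i hi => absurd hi (Fin.not_lt_zero _)) fun i _ => by
      rw [h]; exact (dbl_mem_Icc ht i).1
  · rw [zOdd, if_neg (by simp)]
    exact monotone_insertNth hd (fun i _ => by rw [h]; exact (dbl_mem_Icc ht i).2)
      fun i hi => absurd hi (not_le.2 (Fin.castSucc_lt_last i))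

lemma tau_mem_Icc (τ : Fin 2) : ((τ : ℕ) : ℝ) ∈ Icc (0 : ℝ) 1 := by
  rcases fin_two_cases τ with ⟨-, h⟩ | ⟨-, h⟩ <;> simp [h]

/-- The first row `Π(τ)` of the generalized Vandermonde determinant is subtracted from the rows of
order `0`, which yields the rows of the general form. -/
lemma touches_lamOddGen {m : ℕ} {μ : ℕ → ℝ} {ν : Fin (2 * m + 1) → ℝ} (hμ : IsExponents μ ν)
    (h1 : μ 1 = 1) {t : Fin m → ℝ} (ht : t ∈ closedSimplex m) (τ : Fin 2) :
    Touches μ ν (lamOddGen ν t τ) ((τ : ℕ) : ℝ) (zOdd t τ) := by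
  have hd := monotone_dbl ht.1
  set T : ℝ := ((τ : ℕ) : ℝ) with hT
  set p := insertPos (dbl t) T with hp
  have hrows : genRows μ (zOdd t τ) = (p.insertNth (liftRow (curve ν T) 1 0)
      (fun k => liftRow (curve ν T) (if earlier (dbl t) k + kron (dbl t k) T = 0 then 1 else 0)
        (oddRowsGen ν t τ k)) : Fin (2 * m + 1) → Fin (2 * m + 2) → ℝ) := by
    rw [zOdd_eq ht]
    funext k
    induction k using Fin.succAboveCases p with
    | x =>
      rw [Fin.insertNth_apply_same, genRows_apply, earlier_insertPos_same hd, Fin.insertNth_apply_same,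
        gen_zero_row hμ T T, sub_self]
    | p k =>
      rw [Fin.insertNth_apply_succAbove, genRows_apply, earlier_insertPos_succAbove hd,
        Fin.insertNth_apply_succAbove, gen_row hμ h1 _ _ T, oddRowsGen,
        interleave_deltaDeriv ν t (fun k => kron (t k) T) T]
      rfl
  have hpeven : Even (p : ℕ) := by
    change Even (numBelow (dbl t) T)
    rw [numBelow_dbl]
    exact even_two_mul _
  refine touches_of_det hμ (σ := (-1) ^ (τ : ℕ)) ?_ ?_ (tau_mem_Icc τ) (fun e y => ?_) ?_
  · rw [zOdd_eq ht]
    exact monotone_insertPos hd _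
  · exact insertNth_mem_Icc (dbl_mem_Icc ht) (tau_mem_Icc τ) _
  · rw [hrows, borderedDet_lift, pow_succ, hpeven.neg_one_pow, lamOddGen, smul_dotProduct,
      hodgeStar_dotProduct, smul_eq_mul, pow_succ]
    ring
  · intro s hs hsz
    have hsT : T ≠ s := by
      have := hsz (if τ = 0 then 0 else Fin.last (2 * m))
      rwa [zOdd, Fin.insertNth_apply_same] at this
    rw [zOdd, numBelow_insertNth, numBelow_dbl, pow_add, pow_mul]
    rcases fin_two_cases τ with ⟨rfl, h⟩ | ⟨rfl, h⟩
    · rw [if_pos]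
      · simp
      · rw [h]
        exact lt_of_le_of_ne hs.1 (by rwa [hT, h] at hsT)
    · rw [if_neg]
      · simp
      · rw [h]
        exact not_lt.2 hs.2

/-! ### Even dimension -/

/-- Here the row subtracted is that of order `0` at `t_1`; what remains of the node `t_1` begins with
the row of order `1`, which is moved to the end past an even number of rows. -/
lemma touches_lamEvenGen {l : ℕ} {μ : ℕ → ℝ} {ν : Fin (2 * l + 2) → ℝ} (hμ : IsExponents μ ν)
    (h1 : μ 1 = 1) {t : Fin (l + 1) → ℝ} (ht : t ∈ closedSimplex (l + 1)) :
    Touches μ ν (lamEvenGen ν t) (t 0) (dbl t : Fin (2 * l + 2) → ℝ) := by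
  have hd := monotone_dbl ht.1
  set a := curve ν (t 0) with ha
  let P : Fin (2 * l) → Fin (2 * l + 2) → ℝ := interleave
    (fun k : Fin l => deltaDeriv ν (2 * earlier t k.succ) (t k.succ) (t 0))
    (fun k : Fin l => deltaDeriv ν (2 * earlier t k.succ + 1) (t k.succ) (t 0))
  let ord : Fin (2 * l + 1) → ℕ := fun k => earlier (dbl t) (k.succ : Fin (2 * l + 2))
  have hrows : genRows μ (dbl t : Fin (2 * l + 2) → ℝ) =
      ((0 : Fin (2 * l + 2)).insertNth (liftRow a 1 0) (fun k => liftRow a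
        (if ord k = 0 then 1 else 0)
        ((Fin.cons (curveDeriv ν 1 (t 0)) P : Fin (2 * l + 1) → Fin (2 * l + 2) → ℝ) k)) :
        Fin (2 * l + 2) → Fin (2 * l + 3) → ℝ) := by
    rw [Fin.insertNth_zero']
    refine funext fun k : Fin (2 * l + 2) => ?_
    refine Fin.cases ?_ (fun k : Fin (2 * l + 1) => ?_) k
    · have hi : (⟨((0 : Fin (2 * l + 2)) : ℕ) / 2, by simp⟩ : Fin (l + 1)) = 0 := by
        ext
        simp
      have h0 : earlier (dbl t) (0 : Fin (2 * l + 2)) = 0 := by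
        rw [earlier_dbl, hi, earlier]
        simp
      rw [Fin.cons_zero, genRows_apply μ (n := 2 * l + 2), h0, gen_zero_row hμ _ (t 0),
        show dbl t (0 : Fin (2 * l + 2)) = t 0 from congrArg t hi, sub_self]
    · rw [Fin.cons_succ, genRows_apply μ (n := 2 * l + 2), gen_row hμ h1 _ _ (t 0)]
      congr 1
      refine Fin.cases ?_ (fun k => ?_) k
      · have hv1 : (((0 : Fin (2 * l + 1)).succ : Fin (2 * l + 2)) : ℕ) = 1 := by
          rw [Fin.val_succ, Fin.val_zero]
        have hi : (⟨(((0 : Fin (2 * l + 1)).succ : Fin (2 * l + 2)) : ℕ) / 2, by omega⟩ :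
            Fin (l + 1)) = 0 := by
          ext
          dsimp only
          rw [hv1, Fin.val_zero]
        have h0 : earlier (dbl t) ((0 : Fin (2 * l + 1)).succ : Fin (2 * l + 2)) = 1 := by
          rw [earlier_dbl, hi, hv1, earlier]
          simp
        rw [h0, Fin.cons_zero, deltaDeriv, if_neg one_ne_zero,
          show dbl t ((0 : Fin (2 * l + 1)).succ : Fin (2 * l + 2)) = t 0 from congrArg t hi]
      · rw [Fin.cons_succ, earlier_dbl]
        have hk : (⟨((k.succ.succ : Fin (2 * l + 2)) : ℕ) / 2, by omega⟩ : Fin (l + 1)) =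
            (⟨(k : ℕ) / 2, by omega⟩ : Fin l).succ := by
          ext
          simp only [Fin.val_succ]
          omega
        have hv : dbl t (k.succ.succ : Fin (2 * l + 2)) = t (⟨(k : ℕ) / 2, by omega⟩ : Fin l).succ :=
          congrArg t hk
        have hm : ((k.succ.succ : Fin (2 * l + 2)) : ℕ) % 2 = (k : ℕ) % 2 := by
          simp only [Fin.val_succ]
          omega
        rw [hk, hv, hm]
        simp only [P, interleave]
        split_ifs with h
        · rw [h, add_zero]
        · rw [Nat.mod_two_ne_zero.1 h]
  refine touches_of_det hμ (σ := -1) hd (dbl_mem_Icc ht) (ht.2 0) (fun e y => ?_) ?_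
  · rw [hrows, borderedDet_lift, lamEvenGen, hodgeStar_dotProduct, evenRowsGen, Fin.val_zero,
      ← Fin.insertNth_last', ← Fin.insertNth_zero',
      borderedDet_insertNth_congr (p := Fin.last (2 * l)) (q := 0) (by simp)]
    simp only [zero_add, pow_one, neg_mul, one_mul, neg_neg]
    rfl
  · intro s _ _
    rw [show numBelow (dbl t : Fin (2 * l + 2) → ℝ) s = _ from numBelow_dbl t s, pow_mul]
    simp

/-- The zeros `0, t_1, t_1, …, t_l, t_l, 1`. -/
def zEnd {l : ℕ} (t : Fin l → ℝ) : Fin (2 * l + 2) → ℝ :=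
  (Fin.last (2 * l + 1)).insertNth 1 ((0 : Fin (2 * l + 1)).insertNth 0 (dbl t) :
    Fin (2 * l + 1) → ℝ)

lemma mult_zEnd {l : ℕ} (t : Fin l → ℝ) (a : ℝ) :
    mult (zEnd t) a = (if 1 = a then 1 else 0) + ((if 0 = a then 1 else 0) + 2 * mult t a) := by
  rw [zEnd, mult_insertNth, mult_insertNth, mult_dbl]

/-- Here the row subtracted is that of order `0` at the node `0`. The node `1` takes the position after
all smaller zeros, an odd one as is the last position, so that moving it there keeps the sign; the
`t_k` equal to `0` or `1` continue with the higher orders. -/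
lemma touches_lamEvenEndGen {l : ℕ} {μ : ℕ → ℝ} {ν : Fin (2 * l + 2) → ℝ} (hμ : IsExponents μ ν)
    (h1 : μ 1 = 1) {t : Fin l → ℝ} (ht : t ∈ closedSimplex l) :
    Touches μ ν (lamEvenEndGen ν t) 0 (zEnd t) := by
  have hd := monotone_dbl ht.1
  have hpos0 : insertPos (dbl t) 0 = 0 := by
    ext
    simp only [insertPos, numBelow, Fin.val_zero, Finset.card_eq_zero]
    exact Finset.filter_eq_empty_iff.2 fun k _ => not_lt.2 (dbl_mem_Icc ht k).1
  set y : Fin (2 * l + 1) → ℝ := (0 : Fin (2 * l + 1)).insertNth 0 (dbl t) with hy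
  have hy' : y = (insertPos (dbl t) 0).insertNth 0 (dbl t) := by rw [hpos0]
  have hymono : Monotone y := by rw [hy']; exact monotone_insertPos hd 0
  have hymem : ∀ k, y k ∈ Icc (0 : ℝ) 1 := insertNth_mem_Icc (dbl_mem_Icc ht) (by simp) _
  set p := insertPos y 1 with hp
  have hz : zEnd t = (p.insertNth 1 y : Fin (2 * l + 2) → ℝ) := by
    refine eq_of_mult_eq ?_ (monotone_insertPos hymono _) fun a => by
      rw [zEnd, mult_insertNth _ (Fin.last _), mult_insertNth _ p]
    exact monotone_insertNth hymono (fun i _ => (hymem i).2)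
      fun i hi => absurd hi (not_le.2 (Fin.castSucc_lt_last i))
  set a := curve ν 0 with ha
  let P : Fin (2 * l) → Fin (2 * l + 2) → ℝ := interleave
    (fun k => deltaDeriv ν (2 * earlier t k + (kron (t k) 0 + kron (t k) 1)) (t k) 0)
    (fun k => deltaDeriv ν (2 * earlier t k + 1 + (kron (t k) 0 + kron (t k) 1)) (t k) 0)
  let ord : Fin (2 * l) → ℕ := fun k =>
    earlier (dbl t) k + (kron (dbl t k) 0 + kron (dbl t k) 1)
  let e : Fin (2 * l) → ℝ := fun k => if ord k = 0 then 1 else 0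
  have hyearlier : earlier y (0 : Fin (2 * l + 1)) = 0 ∧ ∀ k : Fin (2 * l),
      earlier y k.succ = earlier (dbl t) k + kron (dbl t k) 0 := by
    constructor
    · simp [earlier]
    · intro k
      have h := earlier_insertPos_succAbove hd 0 k
      rw [hpos0, Fin.succAbove_zero] at h
      exact h
  have hrows : genRows μ (zEnd t) = (p.insertNth (liftRow a 1 (curve ν 1 - curve ν 0))
      (Fin.cons (liftRow a 1 0) (fun k => liftRow a (e k) (P k)) :
        Fin (2 * l + 1) → Fin (2 * l + 3) → ℝ) : Fin (2 * l + 2) → Fin (2 * l + 3) → ℝ) := by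
    rw [hz]
    funext k
    induction k using Fin.succAboveCases p with
    | x =>
      rw [Fin.insertNth_apply_same, genRows_apply, earlier_insertPos_same hymono,
        Fin.insertNth_apply_same, gen_zero_row hμ 1 0]
    | p k =>
      rw [Fin.insertNth_apply_succAbove, genRows_apply, earlier_insertPos_succAbove hymono,
        Fin.insertNth_apply_succAbove]
      refine Fin.cases ?_ (fun k => ?_) k
      · have hy0 : y 0 = 0 := by rw [hy, Fin.insertNth_apply_same]
        rw [hyearlier.1, hy0, if_neg (by norm_num), add_zero, gen_zero_row hμ 0 0, sub_self,
          Fin.cons_zero]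
      · have hyk : y k.succ = dbl t k := by
          rw [hy, Fin.insertNth_zero', Fin.cons_succ]
        rw [hyearlier.2, hyk, Fin.cons_succ, gen_row hμ h1 _ _ 0]
        simp only [P]
        rw [interleave_deltaDeriv ν t (fun k => kron (t k) 0 + kron (t k) 1) 0]
        simp only [e, ord, add_assoc]
        rfl
  have hpodd : Odd (p : ℕ) := by
    change Odd (numBelow y 1)
    rw [hy, numBelow_insertNth, numBelow_dbl, if_pos one_pos, add_comm]
    exact odd_two_mul_add_one _
  refine touches_of_det hμ (σ := 1) ?_ ?_ (by simp) (fun e₀ x => ?_) ?_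
  · rw [hz]; exact monotone_insertPos hymono _
  · exact insertNth_mem_Icc hymem (by simp) _
  · have hsnoc : (Fin.snoc (fun k => liftRow a (e k) (P k)) (liftRow a 1 (curve ν 1 - curve ν 0)) :
        Fin (2 * l + 1) → Fin (2 * l + 3) → ℝ) = fun k => liftRow a
          ((Fin.snoc e 1 : Fin (2 * l + 1) → ℝ) k) ((Fin.snoc P (curve ν 1 - curve ν 0) :
            Fin (2 * l + 1) → Fin (2 * l + 2) → ℝ) k) := by
      funext k
      refine Fin.lastCases ?_ (fun k => ?_) k
      · simp
      · simp
    have hlift := borderedDet_lift 0 a (Fin.snoc P (curve ν 1 - curve ν 0) :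
      Fin (2 * l + 1) → Fin (2 * l + 2) → ℝ) (Fin.snoc e 1) x e₀
    rw [← hsnoc, Fin.insertNth_zero', Fin.cons_snoc_eq_snoc_cons, ← Fin.insertNth_last',
      borderedDet_insertNth_congr (p := Fin.last (2 * l + 1)) (q := p)
        (by rw [Fin.val_last]; exact (odd_two_mul_add_one l).add_odd hpodd)] at hlift
    rw [one_mul, hrows, hlift, lamEvenEndGen, neg_dotProduct, hodgeStar_dotProduct]
    simp only [Fin.val_zero, zero_add, pow_one, neg_mul, one_mul]
    rfl
  · intro s hs hsz
    have hs1 : s ≠ 1 := by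
      have := hsz (Fin.last (2 * l + 1))
      rw [zEnd, Fin.insertNth_apply_same] at this
      exact this.symm
    have hs0 : s ≠ 0 := by
      have := hsz (Fin.succAbove (Fin.last (2 * l + 1)) 0)
      rw [zEnd, Fin.insertNth_apply_succAbove, Fin.insertNth_apply_same] at this
      exact this.symm
    rw [zEnd, numBelow_insertNth, numBelow_insertNth, numBelow_dbl, if_neg (not_lt.2 hs.2),
      if_pos (lt_of_le_of_ne hs.1 hs0.symm), zero_add, pow_add, pow_mul]
    simp

/-! ### Parameters and multiplicities -/

lemma mult_eq_zero_of_notMem {n : ℕ} {y : Fin n → ℝ} (hy : ∀ k, y k ∈ Icc (0 : ℝ) 1) {a : ℝ}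
    (ha : a ∉ Icc (0 : ℝ) 1) : mult y a = 0 :=
  Nat.eq_zero_of_not_pos fun hp => by
    obtain ⟨k, rfl⟩ := mult_pos_iff.1 hp
    exact ha (hy k)

/-- Halving the multiplicities of a sequence in `[0,1]` whose multiplicities in `(0,1)` are
even. -/
lemma exists_half {N : ℕ} {y : Fin N → ℝ} (hy : ∀ k, y k ∈ Icc (0 : ℝ) 1)
    (heven : ∀ a ∈ Ioo (0 : ℝ) 1, Even (mult y a)) : ∃ m, N = 2 * m + mult y 0 % 2 + mult y 1 % 2 ∧
      ∃ t ∈ closedSimplex m, ∀ a, mult t a = mult y a / 2 := by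
  let S : Finset ℝ := insert 0 (insert 1 (Finset.univ.image y))
  let M : Multiset ℝ := ∑ a ∈ S, Multiset.replicate (mult y a / 2) a
  have hmem : ∀ k, y k ∈ S := fun k => by simp [S]
  have hcount : ∀ a, M.count a = mult y a / 2 := by
    intro a
    simp only [M, Multiset.count_sum', Multiset.count_replicate, Finset.sum_ite_eq']
    split_ifs with h
    · rfl
    · rw [Nat.eq_zero_of_not_pos fun hp : 0 < mult y a => by
        obtain ⟨k, rfl⟩ := mult_pos_iff.1 hp
        exact h (hmem k), Nat.zero_div]
  have hodd : ∀ a, a ≠ 0 → a ≠ 1 → mult y a % 2 = 0 := by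
    intro a h0 h1
    by_cases ha : a ∈ Icc (0 : ℝ) 1
    · exact Nat.even_iff.1 (heven a ⟨lt_of_le_of_ne ha.1 h0.symm, lt_of_le_of_ne ha.2 h1⟩)
    · rw [mult_eq_zero_of_notMem hy ha]
  have hcard : N = 2 * M.card + mult y 0 % 2 + mult y 1 % 2 := by
    have h2 : ∑ a ∈ S, mult y a % 2 = mult y 0 % 2 + mult y 1 % 2 := by
      have hsub : ({0, 1} : Finset ℝ) ⊆ S := by
        intro a ha
        simp only [Finset.mem_insert, Finset.mem_singleton] at ha
        rcases ha with rfl | rfl <;> simp [S]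
      rw [← Finset.sum_subset hsub, Finset.sum_pair zero_ne_one]
      intro a _ ha
      simp only [Finset.mem_insert, Finset.mem_singleton, not_or] at ha
      exact hodd a ha.1 ha.2
    have h3 : M.card = ∑ a ∈ S, mult y a / 2 := by
      simp [M, Multiset.card_sum]
    rw [add_assoc, ← h2, h3, Finset.mul_sum, ← Finset.sum_add_distrib]
    conv_lhs => rw [← sum_mult y hmem]
    exact Finset.sum_congr rfl fun a _ => (Nat.div_add_mod _ _).symm
  obtain ⟨t, ht, hmult⟩ := exists_monotone_mult_eq M rfl
  refine ⟨_, hcard, t, ⟨ht, fun k => ?_⟩, fun a => (hmult a).trans (hcount a)⟩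
  by_contra h
  have h1 : 0 < mult t (t k) := mult_pos_iff.2 ⟨k, rfl⟩
  rw [hmult, hcount, mult_eq_zero_of_notMem hy h] at h1
  exact lt_irrefl _ h1

/-- The total `2 m + 1` being odd, exactly one of the multiplicities of `0` and `1` is odd; this is
`τ`. -/
lemma exists_mult_zOdd {m : ℕ} {y : Fin (2 * m + 1) → ℝ} (hy : ∀ k, y k ∈ Icc (0 : ℝ) 1)
    (heven : ∀ a ∈ Ioo (0 : ℝ) 1, Even (mult y a)) :
    ∃ p : closedSimplex m × Fin 2, ∀ a, mult (zOdd p.1.1 p.2) a = mult y a := by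
  obtain ⟨m', hm, t, ht, hmult⟩ := exists_half hy heven
  obtain rfl : m' = m := by omega
  have hother : ∀ a, a ≠ 0 → a ≠ 1 → mult y a % 2 = 0 := by
    intro a h0 h1
    by_cases ha : a ∈ Icc (0 : ℝ) 1
    · exact Nat.even_iff.1 (heven a ⟨lt_of_le_of_ne ha.1 h0.symm, lt_of_le_of_ne ha.2 h1⟩)
    · rw [mult_eq_zero_of_notMem hy ha]
  rcases Nat.mod_two_eq_zero_or_one (mult y 0) with h | h
  · refine ⟨(⟨t, ht⟩, 1), fun a => ?_⟩
    rw [mult_zOdd, hmult]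
    by_cases h0 : a = 0
    · subst h0
      norm_num
      omega
    · by_cases h1 : a = 1
      · subst h1
        norm_num
        omega
      · have := hother a h0 h1
        rw [if_neg (by simpa using Ne.symm h1)]
        omega
  · refine ⟨(⟨t, ht⟩, 0), fun a => ?_⟩
    rw [mult_zOdd, hmult]
    by_cases h0 : a = 0
    · subst h0
      norm_num
      omega
    · by_cases h1 : a = 1
      · subst h1
        norm_num
        omega
      · have := hother a h0 h1
        rw [if_neg (by simpa using Ne.symm h0)]
        omega

lemma zOdd_injective {m : ℕ} (p q : closedSimplex m × Fin 2)
    (h : ∀ a, mult (zOdd p.1.1 p.2) a = mult (zOdd q.1.1 q.2) a) : p = q := by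
  obtain ⟨⟨s, hs⟩, σ⟩ := p
  obtain ⟨⟨t, ht⟩, τ⟩ := q
  simp only [mult_zOdd] at h
  obtain rfl : σ = τ := by
    have h0 := h 0
    rcases fin_two_cases σ with ⟨rfl, h1⟩ | ⟨rfl, h1⟩ <;>
    rcases fin_two_cases τ with ⟨rfl, h2⟩ | ⟨rfl, h2⟩
    · rfl
    · norm_num at h0
      omega
    · norm_num at h0
      omega
    · rfl
  have hst : s = t := eq_of_mult_eq hs.1 ht.1 fun a => by
    have := h a
    omega
  subst hst
  rfl

/-- The zeros of the slacks of the even family. -/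
def zEven {l : ℕ} : closedSimplex (l + 1) ⊕ closedSimplex l → Fin (2 * l + 2) → ℝ :=
  Sum.elim (fun t => dbl t.1) fun t => zEnd t.1

lemma mult_zEven_inl {l : ℕ} (t : closedSimplex (l + 1)) (a : ℝ) :
    mult (zEven (Sum.inl t : closedSimplex (l + 1) ⊕ closedSimplex l)) a = 2 * mult t.1 a :=
  mult_dbl t.1 a

lemma mult_zEven_inr {l : ℕ} (t : closedSimplex l) (a : ℝ) :
    mult (zEven (Sum.inr t : closedSimplex (l + 1) ⊕ closedSimplex l)) a =
      (if 1 = a then 1 else 0) + ((if 0 = a then 1 else 0) + 2 * mult t.1 a) :=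
  mult_zEnd t.1 a

/-- The total `2 l + 2` being even, the multiplicities of `0` and `1` have the same parity; it
distinguishes the two kinds of members. -/
lemma exists_mult_zEven {l : ℕ} {y : Fin (2 * l + 2) → ℝ} (hy : ∀ k, y k ∈ Icc (0 : ℝ) 1)
    (heven : ∀ a ∈ Ioo (0 : ℝ) 1, Even (mult y a)) :
    ∃ p : closedSimplex (l + 1) ⊕ closedSimplex l, ∀ a, mult (zEven p) a = mult y a := by
  obtain ⟨m', hm, t, ht, hmult⟩ := exists_half hy heven
  have hother : ∀ a, a ≠ 0 → a ≠ 1 → mult y a % 2 = 0 := by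
    intro a h0 h1
    by_cases ha : a ∈ Icc (0 : ℝ) 1
    · exact Nat.even_iff.1 (heven a ⟨lt_of_le_of_ne ha.1 h0.symm, lt_of_le_of_ne ha.2 h1⟩)
    · rw [mult_eq_zero_of_notMem hy ha]
  rcases Nat.mod_two_eq_zero_or_one (mult y 0) with h | h
  · obtain rfl : m' = l + 1 := by omega
    refine ⟨Sum.inl ⟨t, ht⟩, fun a => ?_⟩
    rw [mult_zEven_inl, hmult]
    by_cases h0 : a = 0
    · subst h0
      omega
    · by_cases h1 : a = 1
      · subst h1
        omega
      · have := hother a h0 h1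
        omega
  · obtain rfl : m' = l := by omega
    refine ⟨Sum.inr ⟨t, ht⟩, fun a => ?_⟩
    rw [mult_zEven_inr, hmult]
    by_cases h0 : a = 0
    · subst h0
      norm_num
      omega
    · by_cases h1 : a = 1
      · subst h1
        norm_num
        omega
      · have := hother a h0 h1
        rw [if_neg (Ne.symm h0), if_neg (Ne.symm h1)]
        omega

lemma zEven_injective {l : ℕ} (p q : closedSimplex (l + 1) ⊕ closedSimplex l)
    (h : ∀ a, mult (zEven p) a = mult (zEven q) a) : p = q := by
  rcases p with s | s <;> rcases q with t | t
  · simp only [mult_zEven_inl] at h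
    congr 1
    exact Subtype.ext (eq_of_mult_eq s.2.1 t.2.1 fun a => by have := h a; omega)
  · have h0 := h 0
    rw [mult_zEven_inl, mult_zEven_inr] at h0
    norm_num at h0
    omega
  · have h0 := h 0
    rw [mult_zEven_inl, mult_zEven_inr] at h0
    norm_num at h0
    omega
  · simp only [mult_zEven_inr] at h
    congr 1
    exact Subtype.ext (eq_of_mult_eq s.2.1 t.2.1 fun a => by have := h a; omega)

/-! ### Plain and general forms -/

lemma openSimplex_subset (m : ℕ) : openSimplex m ⊆ closedSimplex m := fun _ ht =>
  ⟨ht.1.monotone, fun k => ⟨(ht.2 k).1.le, (ht.2 k).2.le⟩⟩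

lemma earlier_eq_zero {m : ℕ} {t : Fin m → ℝ} (ht : Function.Injective t) (k : Fin m) :
    earlier t k = 0 :=
  Finset.card_eq_zero.2 (Finset.filter_eq_empty_iff.2 fun _ _ h => h.1.ne (ht h.2))

lemma lamOddGen_eq {m : ℕ} (ν : Fin (2 * m + 1) → ℝ) {t : Fin m → ℝ} (ht : Function.Injective t)
    {τ : Fin 2} (hτ : ∀ k, t k ≠ ((τ : ℕ) : ℝ)) : lamOddGen ν t τ = lamOdd ν t τ := by
  have : oddRowsGen ν t τ = oddRows ν t τ := by
    simp [oddRowsGen, oddRows, earlier_eq_zero ht, kron, hτ, deltaDeriv]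
  rw [lamOddGen, lamOdd, this]

lemma lamEvenGen_eq {l : ℕ} (ν : Fin (2 * l + 2) → ℝ) {t : Fin (l + 1) → ℝ}
    (ht : Function.Injective t) : lamEvenGen ν t = lamEven ν t := by
  have : evenRowsGen ν t = evenRows ν t := by
    simp [evenRowsGen, evenRows, earlier_eq_zero ht, deltaDeriv]
  rw [lamEvenGen, lamEven, this]

lemma lamEvenEndGen_eq {l : ℕ} (ν : Fin (2 * l + 2) → ℝ) {t : Fin l → ℝ}
    (ht : Function.Injective t) (h : ∀ k, t k ≠ 0 ∧ t k ≠ 1) :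
    lamEvenEndGen ν t = lamEvenEnd ν t := by
  have : evenEndRowsGen ν t = evenEndRows ν t := by
    simp [evenEndRowsGen, evenEndRows, earlier_eq_zero ht, kron, h, deltaDeriv]
  rw [lamEvenEndGen, lamEvenEnd, this]

lemma continuous_dbl (m : ℕ) : Continuous (dbl : (Fin m → ℝ) → Fin (2 * m) → ℝ) :=
  continuous_pi fun _ => continuous_apply _

lemma continuous_insertNth_const {n : ℕ} {X : Type*} [TopologicalSpace X] (p : Fin (n + 1)) (a : ℝ)
    {f : X → Fin n → ℝ} (hf : Continuous f) :
    Continuous fun x => (p.insertNth a (f x) : Fin (n + 1) → ℝ) := by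
  refine continuous_pi fun k => ?_
  induction k using Fin.succAboveCases p with
  | x => simpa using continuous_const
  | p k => simpa using continuous_pi_iff.1 hf k

/-- If the rows are linearly dependent for the trivial reason that a row is zero or that two rows
coincide, the Hodge star vanishes. -/
lemma hodgeStar_eq_zero {n : ℕ} {v : Fin n → Fin (n + 1) → ℝ}
    (h : (∃ k, v k = 0) ∨ ∃ k l, k ≠ l ∧ v k = v l) : hodgeStar v = 0 := by
  funext i
  rw [hodgeStar, borderedDet]
  rcases h with ⟨k, hk⟩ | ⟨k, l, hkl, h⟩
  · refine Matrix.det_eq_zero_of_row_eq_zero k.succ fun j => ?_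
    simp [hk]
  · refine Matrix.det_zero_of_row_eq (i := k.succ) (j := l.succ)
      (fun h => hkl (Fin.succ_injective _ h)) ?_
    funext j
    simp [h]

lemma isGreatest_values_zero {N : ℕ} (ν : Fin N → ℝ) : IsGreatest (values ν 0) 0 := by
  have : values ν 0 = {0} := by
    simp [values]
  rw [this]
  exact isGreatest_singleton

lemma interleave_even {N m : ℕ} (a b : Fin m → Fin N → ℝ) (k : Fin m) (h : 2 * (k : ℕ) < 2 * m) :
    interleave a b ⟨2 * k, h⟩ = a k := by
  simp [interleave]

lemma interleave_odd {N m : ℕ} (a b : Fin m → Fin N → ℝ) (k : Fin m)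
    (h : 2 * (k : ℕ) + 1 < 2 * m) : interleave a b ⟨2 * k + 1, h⟩ = b k := by
  have : (2 * (k : ℕ) + 1) / 2 = k := by omega
  simp [interleave, this]

lemma not_injective_iff {m : ℕ} {t : Fin m → ℝ} (ht : ¬ Function.Injective t) :
    ∃ k l, k ≠ l ∧ t k = t l := by
  simp only [Function.Injective, not_forall] at ht
  obtain ⟨k, l, h, hne⟩ := ht
  exact ⟨k, l, hne, h⟩

/-- The plain form vanishes unless it coincides with the general form. -/
lemma lamOdd_eq_zero {m : ℕ} (ν : Fin (2 * m + 1) → ℝ) {t : Fin m → ℝ} {τ : Fin 2}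
    (h : ¬ (Function.Injective t ∧ ∀ k, t k ≠ ((τ : ℕ) : ℝ))) : lamOdd ν t τ = 0 := by
  rw [lamOdd, hodgeStar_eq_zero, smul_zero]
  rw [not_and_or] at h
  rcases h with h | h
  · obtain ⟨k, l, hkl, h⟩ := not_injective_iff h
    refine Or.inr ⟨⟨2 * k, by omega⟩, ⟨2 * l, by omega⟩, fun h => ?_, ?_⟩
    · simp only [Fin.mk.injEq] at h
      omega
    · rw [oddRows, interleave_even, interleave_even, h]
  · push Not at h
    obtain ⟨k, h⟩ := h
    exact Or.inl ⟨⟨2 * k, by omega⟩, by rw [oddRows, interleave_even, h, sub_self]⟩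

lemma lamEven_eq_zero {l : ℕ} (ν : Fin (2 * l + 2) → ℝ) {t : Fin (l + 1) → ℝ}
    (h : ¬ Function.Injective t) : lamEven ν t = 0 := by
  rw [lamEven, hodgeStar_eq_zero]
  have aux : ∀ k : Fin l, t k.succ = t 0 → ∃ i, evenRows ν t i = 0 := fun k hk =>
    ⟨(⟨2 * k, by omega⟩ : Fin (2 * l)).castSucc, by
      rw [evenRows, Fin.snoc_castSucc, interleave_even, hk, sub_self]⟩
  obtain ⟨k, j, hkj, h⟩ := not_injective_iff h
  rcases Fin.eq_zero_or_eq_succ k with rfl | ⟨k, rfl⟩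
  · obtain ⟨j, rfl⟩ := Fin.exists_succ_eq.2 hkj.symm
    exact Or.inl (aux j h.symm)
  · rcases Fin.eq_zero_or_eq_succ j with rfl | ⟨j, rfl⟩
    · exact Or.inl (aux k h)
    · refine Or.inr ⟨(⟨2 * k, by omega⟩ : Fin (2 * l)).castSucc,
        (⟨2 * j, by omega⟩ : Fin (2 * l)).castSucc, fun h => ?_, ?_⟩
      · refine hkj (congrArg Fin.succ (Fin.ext ?_))
        have := congrArg Fin.val h
        simp only [Fin.val_castSucc] at this
        omega
      · rw [evenRows, Fin.snoc_castSucc, Fin.snoc_castSucc, interleave_even, interleave_even, h]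

lemma lamEvenEnd_eq_zero {l : ℕ} (ν : Fin (2 * l + 2) → ℝ) {t : Fin l → ℝ}
    (h : ¬ (Function.Injective t ∧ ∀ k, t k ≠ 0 ∧ t k ≠ 1)) : lamEvenEnd ν t = 0 := by
  rw [lamEvenEnd, hodgeStar_eq_zero, neg_zero]
  rw [not_and_or] at h
  rcases h with h | h
  · obtain ⟨k, j, hkj, h⟩ := not_injective_iff h
    refine Or.inr ⟨(⟨2 * k, by omega⟩ : Fin (2 * l)).castSucc,
      (⟨2 * j, by omega⟩ : Fin (2 * l)).castSucc, fun h => ?_, ?_⟩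
    · refine hkj (Fin.ext ?_)
      have := congrArg Fin.val h
      simp only [Fin.val_castSucc] at this
      omega
    · rw [evenEndRows, Fin.snoc_castSucc, Fin.snoc_castSucc, interleave_even, interleave_even, h]
  · push Not at h
    obtain ⟨k, h⟩ := h
    by_cases h0 : t k = 0
    · exact Or.inl ⟨(⟨2 * k, by omega⟩ : Fin (2 * l)).castSucc, by
        rw [evenEndRows, Fin.snoc_castSucc, interleave_even, h0, sub_self]⟩
    · refine Or.inr ⟨(⟨2 * k, by omega⟩ : Fin (2 * l)).castSucc, Fin.last _,
        (Fin.castSucc_lt_last _).ne, ?_⟩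
      rw [evenEndRows, Fin.snoc_castSucc, Fin.snoc_last, interleave_even, h h0]

/-! ### Confluent Vandermonde determinants -/

/-- In an alternating map, `a k` may be subtracted from the row following it. -/
lemma map_interleave_add_smul {N m : ℕ} (f : (Fin N → ℝ) [⋀^Fin (2 * m)]→ₗ[ℝ] ℝ)
    (a d : Fin m → Fin N → ℝ) (h : ℝ) :
    f (interleave a fun k => a k + h • d k) = h ^ m * f (interleave a d) := by
  have key : ∀ S : Finset (Fin m), f (interleave a fun k => if k ∈ S then a k + h • d k else d k) =
      h ^ S.card * f (interleave a d) := by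
    intro S
    induction S using Finset.induction_on with
    | empty => simp
    | insert k S hk ih =>
      set L := interleave a fun k => if k ∈ S then a k + h • d k else d k with hL
      set i : Fin (2 * m) := ⟨2 * k, by omega⟩ with hi
      set j : Fin (2 * m) := ⟨2 * k + 1, by omega⟩ with hj
      have hij : i ≠ j := fun h => by
        have := congrArg Fin.val h
        simp only [hi, hj] at this
        omega
      have h1 : (interleave a fun k' => if k' ∈ insert k S then a k' + h • d k' else d k') =
          Function.update L j (a k + h • d k) := by
        funext x
        by_cases hx : x = j
        · subst hx
          rw [Function.update_self, interleave_odd, if_pos (Finset.mem_insert_self _ _)]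
        · rw [Function.update_of_ne hx, hL, interleave, interleave]
          by_cases h2 : (x : ℕ) % 2 = 0
          · rw [if_pos h2, if_pos h2]
          · rw [if_neg h2, if_neg h2]
            have hne : (⟨(x : ℕ) / 2, by omega⟩ : Fin m) ≠ k := by
              intro he
              apply hx
              have := congrArg Fin.val he
              ext
              simp only [hj] at this ⊢
              omega
            simp only [Finset.mem_insert, hne, false_or]
      have h2 : f (Function.update L j (a k)) = 0 := by
        refine f.map_eq_zero_of_eq _ (i := i) (j := j) ?_ hij
        rw [Function.update_self, Function.update_of_ne hij, hL, hi, interleave_even]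
      have h3 : Function.update L j (d k) = L := by
        rw [Function.update_eq_self_iff, hL, hj, interleave_odd, if_neg hk]
      rw [h1, f.map_update_add, f.map_update_smul, h2, h3, ih, Finset.card_insert_of_notMem hk,
        zero_add, smul_eq_mul, pow_succ]
      ring
  simpa using key Finset.univ

/-- The row of powers `1, x, x², …`. -/
def powRow (n : ℕ) (x : ℝ) : Fin n → ℝ := fun i => x ^ (i : ℕ)

/-- The row of derivatives of powers. -/
def powRowDeriv (n : ℕ) (x : ℝ) : Fin n → ℝ := fun i => (i : ℕ) * x ^ ((i : ℕ) - 1)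

/-- Confluence: if an alternating function of the rows of powers at `t_k` and `t_k + h` is divisible
by `h ^ m`, the quotient at `h = 0` is its value at the rows of powers and of their derivatives. -/
lemma map_interleave_powRowDeriv {N m : ℕ} (f : (Fin N → ℝ) [⋀^Fin (2 * m)]→ₗ[ℝ] ℝ)
    (hf : Continuous f) (t : Fin m → ℝ) {G : ℝ → ℝ} (hG : ContinuousAt G 0)
    (h : ∀ h : ℝ, f (interleave (fun k => powRow N (t k)) fun k => powRow N (t k + h)) =
      h ^ m * G h) :
    f (interleave (fun k => powRow N (t k)) fun k => powRowDeriv N (t k)) = G 0 := by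
  let d : ℝ → Fin m → Fin N → ℝ := fun h k i => dslope (fun x : ℝ => x ^ (i : ℕ)) (t k) (t k + h)
  have hd0 : d 0 = fun k => powRowDeriv N (t k) := by
    funext k i
    simp [d, powRowDeriv, dslope_same]
  have hd : ∀ h k, powRow N (t k + h) = powRow N (t k) + h • d h k := by
    intro h k
    funext i
    have := sub_smul_dslope (fun x : ℝ => x ^ (i : ℕ)) (t k) (t k + h)
    simp only [add_sub_cancel_left, smul_eq_mul] at this
    simp only [powRow, d, Pi.add_apply, Pi.smul_apply, smul_eq_mul, this]
    ring
  have hcont : ContinuousAt (fun h => f (interleave (fun k => powRow N (t k)) (d h))) 0 := by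
    refine hf.continuousAt.comp ?_
    refine continuousAt_pi.2 fun x => ?_
    unfold interleave
    split_ifs
    · exact continuousAt_const
    · refine continuousAt_pi.2 fun i => ?_
      have h1 : ContinuousAt (dslope (fun x : ℝ => x ^ (i : ℕ)) (t ⟨(x : ℕ) / 2, by omega⟩))
          (t ⟨(x : ℕ) / 2, by omega⟩ + 0) := by
        rw [add_zero]
        exact continuousAt_dslope_same.2 (differentiableAt_pow _)
      exact h1.comp (f := fun h => t ⟨(x : ℕ) / 2, by omega⟩ + h)
        (continuousAt_const.add continuousAt_id)
  -- `d h` are the rows of difference quotients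
  have heq : ∀ᶠ h in 𝓝[≠] (0 : ℝ), f (interleave (fun k => powRow N (t k)) (d h)) = G h := by
    filter_upwards [self_mem_nhdsWithin] with x hx
    have h1 := h x
    simp only [hd] at h1
    rw [map_interleave_add_smul] at h1
    exact mul_left_cancel₀ (pow_ne_zero m hx) h1
  rw [← hd0]
  exact tendsto_nhds_unique_of_eventuallyEq (hcont.tendsto.mono_left nhdsWithin_le_nhds)
    (hG.tendsto.mono_left nhdsWithin_le_nhds) heq

lemma det_vandermonde_cons {n : ℕ} (x : ℝ) (v : Fin n → ℝ) :
    (Matrix.vandermonde (Fin.cons x v : Fin (n + 1) → ℝ)).det =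
      (∏ i, (v i - x)) * (Matrix.vandermonde v).det := by
  rw [Matrix.det_vandermonde, Matrix.det_vandermonde, Fin.prod_univ_succ, Fin.prod_Ioi_zero]
  congr 1
  refine Finset.prod_congr rfl fun i _ => ?_
  rw [Fin.prod_Ioi_succ]
  rfl

/-- The nodes `t_1, t_1 + h, t_2, t_2 + h, …`. -/
def pairNodes {m : ℕ} (t : Fin m → ℝ) (h : ℝ) : Fin (2 * m) → ℝ := fun i =>
  if (i : ℕ) % 2 = 0 then t ⟨i / 2, by omega⟩ else t ⟨i / 2, by omega⟩ + h

lemma prod_pairNodes {m : ℕ} (t : Fin m → ℝ) (h : ℝ) (f : ℝ → ℝ) :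
    ∏ i, f (pairNodes t h i) = ∏ k, f (t k) * f (t k + h) := by
  rw [prod_dbl]
  refine Finset.prod_congr rfl fun k _ => ?_
  have : (2 * (k : ℕ) + 1) / 2 = k := by omega
  simp [pairNodes, this]

lemma pairNodes_succ {m : ℕ} (t : Fin (m + 1) → ℝ) (h : ℝ) :
    (pairNodes t h : Fin (2 * m + 2) → ℝ) =
      Fin.cons (t 0) (Fin.cons (t 0 + h) (pairNodes (fun k : Fin m => t k.succ) h)) := by
  refine funext fun i : Fin (2 * m + 2) => ?_
  refine Fin.cases ?_ (fun i : Fin (2 * m + 1) => Fin.cases ?_ (fun i => ?_) i) i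
  · rw [Fin.cons_zero, pairNodes, if_pos (by simp)]
    exact congrArg t (Fin.ext (by simp))
  · rw [Fin.cons_succ, Fin.cons_zero, pairNodes,
      if_neg (by rw [Fin.val_succ, Fin.val_zero]; norm_num)]
    have hv : (((0 : Fin (2 * m + 1)).succ : Fin (2 * m + 2)) : ℕ) = 1 := by
      rw [Fin.val_succ, Fin.val_zero]
    have hi : (⟨(((0 : Fin (2 * m + 1)).succ : Fin (2 * m + 2)) : ℕ) / 2, by omega⟩ :
        Fin (m + 1)) = 0 := by
      ext
      dsimp only
      rw [hv, Fin.val_zero]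
    exact congrArg (t · + h) hi
  · rw [Fin.cons_succ, Fin.cons_succ, pairNodes, pairNodes]
    have h1 : ((i.succ.succ : Fin (2 * m + 2)) : ℕ) % 2 = (i : ℕ) % 2 := by
      simp only [Fin.val_succ]; omega
    have h2 : (⟨((i.succ.succ : Fin (2 * m + 2)) : ℕ) / 2, by omega⟩ : Fin (m + 1)) =
        (⟨(i : ℕ) / 2, by omega⟩ : Fin m).succ := by
      ext; simp only [Fin.val_succ]; omega
    rw [h1, h2]

/-- The contribution of the pairs of different nodes. -/
def pairProd {m : ℕ} (t : Fin m → ℝ) (h : ℝ) : ℝ :=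
  ∏ i, ∏ j ∈ Finset.Ioi i, ((t j - t i) ^ 2 * ((t j + h - t i) * (t j - t i - h)))

lemma pairProd_zero {m : ℕ} (t : Fin m → ℝ) : pairProd t 0 = gPoly t := by
  refine Finset.prod_congr rfl fun i _ => Finset.prod_congr rfl fun j _ => ?_
  ring

lemma continuous_pairProd {m : ℕ} (t : Fin m → ℝ) : Continuous (pairProd t) :=
  continuous_finsetProd _ fun i _ => continuous_finsetProd _ fun j _ => by fun_prop

lemma det_vandermonde_pairNodes {m : ℕ} : ∀ (t : Fin m → ℝ) (h : ℝ),
    (Matrix.vandermonde (pairNodes t h)).det = h ^ m * pairProd t h := by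
  induction m with
  | zero => intro t h; simp [pairProd]
  | succ m ih =>
    intro t h
    have h1 : (Matrix.vandermonde (pairNodes t h)).det =
        (Matrix.vandermonde (pairNodes t h : Fin (2 * m + 2) → ℝ)).det := rfl
    rw [h1, pairNodes_succ, det_vandermonde_cons, det_vandermonde_cons, ih, Fin.prod_univ_succ,
      Fin.cons_zero]
    simp only [Fin.cons_succ]
    have e1 := prod_pairNodes (fun k : Fin m => t k.succ) h fun x => x - t 0
    have e2 := prod_pairNodes (fun k : Fin m => t k.succ) h fun x => x - (t 0 + h)
    change ((t 0 + h - t 0) * ∏ i, (pairNodes (fun k : Fin m => t k.succ) h i - t 0)) *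
      ((∏ i, (pairNodes (fun k : Fin m => t k.succ) h i - (t 0 + h))) *
        (h ^ m * pairProd (fun k : Fin m => t k.succ) h)) = _
    rw [e1, e2, pairProd, pairProd, Fin.prod_univ_succ, Fin.prod_Ioi_zero]
    have h2 : ∏ j : Fin m, ((t j.succ - t 0) ^ 2 * ((t j.succ + h - t 0) * (t j.succ - t 0 - h))) =
        (∏ j : Fin m, (t j.succ - t 0) * (t j.succ + h - t 0)) *
          ∏ j : Fin m, (t j.succ - (t 0 + h)) * (t j.succ + h - (t 0 + h)) := by
      rw [← Finset.prod_mul_distrib]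
      exact Finset.prod_congr rfl fun j _ => by ring
    rw [h2]
    simp only [Fin.prod_Ioi_succ]
    ring

lemma interleave_powRow {N m : ℕ} (t : Fin m → ℝ) (h : ℝ) :
    interleave (fun k => powRow N (t k)) (fun k => powRow N (t k + h)) =
      fun i => powRow N (pairNodes t h i) := by
  funext i
  simp only [interleave, pairNodes]
  split_ifs <;> rfl

/-- The confluent Vandermonde determinant with the simple node `0` and double nodes `t_k`. -/
lemma det_confluent_one {m : ℕ} (t : Fin m → ℝ) :
    Matrix.det (Matrix.of (Fin.cons (powRow (2 * m + 1) 0)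
      (interleave (fun k => powRow _ (t k)) fun k => powRowDeriv _ (t k)) :
        Fin (2 * m + 1) → Fin (2 * m + 1) → ℝ)) = fPoly t 0 * gPoly t := by
  have key := map_interleave_powRowDeriv
    ((Matrix.detRowAlternating (n := Fin (2 * m + 1)) (R := ℝ)).curryLeft (powRow _ 0)) ?_ t
    (G := fun h => (∏ k, t k * (t k + h)) * pairProd t h) ?_ fun h => ?_
  · refine Eq.trans key ?_
    simp only [add_zero, pairProd_zero, fPoly, sub_zero]
    congr 1
    exact Finset.prod_congr rfl fun k _ => (sq _).symm
  · change Continuous fun L : Fin (2 * m) → Fin (2 * m + 1) → ℝ =>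
      Matrix.det (Matrix.of (Fin.cons (powRow (2 * m + 1) 0) L : Fin (2 * m + 1) → _))
    refine Continuous.matrix_det (continuous_pi fun i => ?_)
    refine Fin.cases ?_ (fun i => ?_) i
    · exact continuous_const
    · exact continuous_apply i
  · exact ((continuous_finsetProd _ fun k _ => by fun_prop).mul
      (continuous_pairProd t)).continuousAt
  · rw [interleave_powRow]
    have h1 := det_vandermonde_cons 0 (pairNodes t h)
    rw [det_vandermonde_pairNodes, prod_pairNodes t h fun x => x - 0] at h1
    simp only [sub_zero] at h1
    rw [← mul_assoc, mul_comm (h ^ m), mul_assoc, ← h1]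
    change Matrix.det _ = _
    congr 1
    funext i j
    refine Fin.cases ?_ (fun i => ?_) i <;> rfl

/-- The confluent Vandermonde determinant with simple nodes `0` and `1` and double nodes `t_k`. -/
lemma det_confluent_two {m : ℕ} (t : Fin m → ℝ) :
    Matrix.det (Matrix.of (Fin.cons (powRow (2 * m + 2) 0) (Fin.cons (powRow (2 * m + 2) 1)
      (interleave (fun k => powRow _ (t k)) fun k => powRowDeriv _ (t k)) :
        Fin (2 * m + 1) → Fin (2 * m + 2) → ℝ) : Fin (2 * m + 2) → Fin (2 * m + 2) → ℝ)) =
      fPoly t 0 * fPoly t 1 * gPoly t := by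
  have key := map_interleave_powRowDeriv
    (((Matrix.detRowAlternating (n := Fin (2 * m + 2)) (R := ℝ)).curryLeft
      (powRow _ 0)).curryLeft (powRow _ 1)) ?_ t
    (G := fun h => (∏ k, t k * (t k + h)) * (∏ k, (t k - 1) * (t k + h - 1)) * pairProd t h) ?_
    fun h => ?_
  · refine Eq.trans key ?_
    simp only [add_zero, pairProd_zero, fPoly, sub_zero]
    congr 2
    · exact Finset.prod_congr rfl fun k _ => (sq _).symm
    · exact Finset.prod_congr rfl fun k _ => (sq _).symm
  · change Continuous fun L : Fin (2 * m) → Fin (2 * m + 2) → ℝ =>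
      Matrix.det (Matrix.of (Fin.cons (powRow (2 * m + 2) 0) (Fin.cons (powRow (2 * m + 2) 1) L :
        Fin (2 * m + 1) → Fin (2 * m + 2) → ℝ) : Fin (2 * m + 2) → _))
    refine Continuous.matrix_det (continuous_pi fun i => ?_)
    refine Fin.cases ?_ (fun i => Fin.cases ?_ (fun i => ?_) i) i
    · exact continuous_const
    · exact continuous_const
    · exact continuous_apply i
  · exact (((continuous_finsetProd _ fun k _ => by fun_prop).mul
      (continuous_finsetProd _ fun k _ => by fun_prop)).mul (continuous_pairProd t)).continuousAt
  · rw [interleave_powRow]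
    have h1 := det_vandermonde_cons 0 (Fin.cons 1 (pairNodes t h) : Fin (2 * m + 1) → ℝ)
    rw [det_vandermonde_cons 1 (pairNodes t h), det_vandermonde_pairNodes,
      prod_pairNodes t h fun x => x - 1,
      Fin.prod_univ_succ, Fin.cons_zero] at h1
    simp only [Fin.cons_succ] at h1
    rw [prod_pairNodes t h fun x => x - 0] at h1
    simp only [sub_zero, one_mul] at h1
    have h2 : h ^ m * ((∏ k, t k * (t k + h)) * (∏ k, (t k - 1) * (t k + h - 1)) * pairProd t h) =
        (Matrix.vandermonde (Fin.cons 0 (Fin.cons 1 (pairNodes t h) : Fin (2 * m + 1) → ℝ) :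
          Fin (2 * m + 2) → ℝ)).det := by
      rw [h1]
      ring
    rw [h2]
    change Matrix.det _ = _
    congr 1
    funext i j
    refine Fin.cases ?_ (fun i => Fin.cases ?_ (fun i => ?_) i) i <;> rfl

/-! ### Consecutive integer exponents -/

lemma liftRow_curve_sub {N : ℕ} {ν : Fin N → ℝ} (hν : ∀ i, ν i = (i : ℕ) + 1) (t b : ℝ) :
    liftRow (curve ν b) 1 (curve ν t - curve ν b) = powRow (N + 1) t := by
  funext i
  refine Fin.cases ?_ (fun i => ?_) i
  · simp [liftRow, powRow]
  · simp only [liftRow, powRow, Fin.cons_succ, one_smul,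
      sub_add_cancel, curve, hν, Fin.val_succ]
    exact_mod_cast Real.rpow_natCast t (i + 1)

lemma liftRow_curve_zero {N : ℕ} {ν : Fin N → ℝ} (hν : ∀ i, ν i = (i : ℕ) + 1) (b : ℝ) :
    liftRow (curve ν b) 1 0 = powRow (N + 1) b := by
  rw [← liftRow_curve_sub hν b b, sub_self]

lemma liftRow_curve_self {N : ℕ} (ν : Fin N → ℝ) (b : ℝ) :
    liftRow (curve ν b) (-1) (curve ν b) = -powRow (N + 1) 0 := by
  funext i
  refine Fin.cases ?_ (fun i => ?_) i
  · simp [liftRow, powRow]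
  · simp [liftRow, powRow]

lemma liftRow_curveDeriv_one {N : ℕ} {ν : Fin N → ℝ} (hν : ∀ i, ν i = (i : ℕ) + 1) (t b : ℝ) :
    liftRow (curve ν b) 0 (curveDeriv ν 1 t) = powRowDeriv (N + 1) t := by
  funext i
  refine Fin.cases ?_ (fun i => ?_) i
  · simp [liftRow, powRowDeriv]
  · have h1 : (fun s : ℝ => s ^ ν i) = fun s => s ^ ((i : ℕ) + 1) := by
      funext s
      rw [hν]
      exact_mod_cast Real.rpow_natCast s (i + 1)
    simp only [liftRow, powRowDeriv, Fin.cons_succ, zero_smul, add_zero, curveDeriv,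
      Fin.val_succ]
    rw [if_neg (by omega), iteratedDeriv_one, h1]
    simp

/-- The entries completing `a_1, b_1, a_2, b_2, …` in `liftRow`: `1` for `a_k` and `0` for
`b_k`. -/
def altEntry {m : ℕ} (k : Fin (2 * m)) : ℝ := if (k : ℕ) % 2 = 0 then 1 else 0

lemma liftRow_interleave {N m : ℕ} {ν : Fin N → ℝ} (hν : ∀ i, ν i = (i : ℕ) + 1) (b : ℝ)
    (t : Fin m → ℝ) :
    (fun k => liftRow (curve ν b) (altEntry k) (interleave (fun k => curve ν (t k) - curve ν b)
      (fun k => curveDeriv ν 1 (t k)) k)) =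
      interleave (fun k => powRow (N + 1) (t k)) fun k => powRowDeriv (N + 1) (t k) := by
  funext k
  simp only [interleave, altEntry]
  split_ifs
  · exact liftRow_curve_sub hν _ _
  · exact liftRow_curveDeriv_one hν _ _

lemma borderedDet_neg {n : ℕ} (x : Fin (n + 1) → ℝ) (v : Fin n → Fin (n + 1) → ℝ) :
    borderedDet (-x) v = -borderedDet x v := by
  rw [← hodgeStar_dotProduct, ← hodgeStar_dotProduct, dotProduct_neg]

/-- Subtracting the row of powers at `1` has removed the constant column; undoing this gives a
confluent Vandermonde determinant. -/
lemma borderedDet_oddRows_one {m : ℕ} {ν : Fin (2 * m + 1) → ℝ} (hν : ∀ i, ν i = (i : ℕ) + 1)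
    (t : Fin m → ℝ) : borderedDet (curve ν 1) (oddRows ν t 1) =
      fPoly t 0 * fPoly t 1 * gPoly t := by
  have h := borderedDet_lift 0 (curve ν 1) (oddRows ν t 1) altEntry (curve ν 1) (-1)
  have hrows : oddRows ν t 1 = interleave (fun k => curve ν (t k) - curve ν 1)
      (fun k => curveDeriv ν 1 (t k)) := by
    simp [oddRows]
  rw [hrows, liftRow_interleave hν, liftRow_curve_zero hν, liftRow_curve_self, borderedDet_neg,
    Fin.insertNth_zero', Fin.val_zero, zero_add, pow_one, neg_one_mul, neg_inj] at h
  rw [hrows, ← h, ← det_confluent_two]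
  rfl

lemma interleave_succ {N m : ℕ} (a b : Fin (m + 1) → Fin N → ℝ) :
    (interleave a b : Fin (2 * m + 2) → Fin N → ℝ) =
      Fin.cons (a 0) (Fin.cons (b 0) (interleave (fun k => a k.succ) fun k => b k.succ) :
        Fin (2 * m + 1) → Fin N → ℝ) := by
  refine funext fun i : Fin (2 * m + 2) => ?_
  refine Fin.cases ?_ (fun i : Fin (2 * m + 1) => Fin.cases ?_ (fun i => ?_) i) i
  · rw [Fin.cons_zero, interleave, if_pos (by simp)]
    exact congrArg a (Fin.ext (by simp))
  · have hv : (((0 : Fin (2 * m + 1)).succ : Fin (2 * m + 2)) : ℕ) = 1 := by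
      rw [Fin.val_succ, Fin.val_zero]
    have hi : (⟨(((0 : Fin (2 * m + 1)).succ : Fin (2 * m + 2)) : ℕ) / 2, by omega⟩ :
        Fin (m + 1)) = 0 := by
      ext
      dsimp only
      rw [hv, Fin.val_zero]
    rw [Fin.cons_succ, Fin.cons_zero, interleave, if_neg (by rw [hv]; norm_num)]
    exact congrArg b hi
  · rw [Fin.cons_succ, Fin.cons_succ, interleave, interleave]
    have h1 : ((i.succ.succ : Fin (2 * m + 2)) : ℕ) % 2 = (i : ℕ) % 2 := by
      simp only [Fin.val_succ]; omega
    have h2 : (⟨((i.succ.succ : Fin (2 * m + 2)) : ℕ) / 2, by omega⟩ : Fin (m + 1)) =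
        (⟨(i : ℕ) / 2, by omega⟩ : Fin m).succ := by
      ext; simp only [Fin.val_succ]; omega
    rw [h1, h2]

lemma borderedDet_evenRows {l : ℕ} {ν : Fin (2 * l + 2) → ℝ} (hν : ∀ i, ν i = (i : ℕ) + 1)
    (t : Fin (l + 1) → ℝ) : borderedDet (curve ν (t 0)) (evenRows ν t) = fPoly t 0 * gPoly t := by
  have h := borderedDet_lift 0 (curve ν (t 0)) (evenRows ν t)
    (Fin.snoc altEntry 0 : Fin (2 * l + 1) → ℝ) (curve ν (t 0)) (-1)
  have hrows : (fun k => liftRow (curve ν (t 0)) ((Fin.snoc altEntry 0 : Fin (2 * l + 1) → ℝ) k)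
      (evenRows ν t k)) = Fin.snoc (interleave (fun k : Fin l => powRow (2 * l + 3) (t k.succ))
        fun k : Fin l => powRowDeriv (2 * l + 3) (t k.succ)) (powRowDeriv (2 * l + 3) (t 0)) := by
    rw [← liftRow_interleave hν (t 0) fun k : Fin l => t k.succ,
      ← liftRow_curveDeriv_one hν (t 0) (t 0)]
    funext k
    refine Fin.lastCases ?_ (fun k => ?_) k
    · simp [evenRows]
    · simp [evenRows]
  rw [hrows, liftRow_curve_zero hν, liftRow_curve_self, borderedDet_neg,
    Fin.insertNth_zero', Fin.val_zero, zero_add, pow_one, neg_one_mul, neg_inj,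
    Fin.cons_snoc_eq_snoc_cons, ← Fin.insertNth_last',
    borderedDet_insertNth_congr (p := Fin.last (2 * l + 1)) (q := (0 : Fin (2 * l + 1)).succ)
      (by rw [Fin.val_last, Fin.val_succ, Fin.val_zero]; exact ⟨l + 1, by ring⟩),
    Fin.insertNth_succ_cons, Fin.insertNth_zero'] at h
  have h2 := interleave_succ (fun k => powRow (2 * l + 3) (t k))
    (fun k => powRowDeriv (2 * l + 3) (t k))
  rw [← h, ← h2, ← det_confluent_one]
  rfl

/-! ### Right-hand sides and limits -/

lemma exponents_pos {n : ℕ} {ν : Fin (n + 1) → ℝ} (h1 : ν 0 = 1) (hν : StrictMono ν)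
    (i : Fin (n + 1)) : 0 < ν i :=
  zero_lt_one.trans_le (h1 ▸ hν.monotone (Fin.zero_le i))

lemma exists_isExponents_one {n : ℕ} {ν : Fin (n + 1) → ℝ} (h1 : ν 0 = 1) (hν : StrictMono ν) :
    ∃ μ, IsExponents μ ν ∧ μ 1 = 1 := by
  obtain ⟨μ, hμ⟩ := exists_isExponents hν (exponents_pos h1 hν)
  exact ⟨μ, hμ, by simpa [h1] using hμ.succ 0⟩

lemma curve_zero {N : ℕ} {ν : Fin N → ℝ} (h0 : ∀ i, 0 < ν i) : curve ν 0 = 0 :=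
  funext fun i => Real.zero_rpow (h0 i).ne'

lemma curve_tau {N : ℕ} {ν : Fin N → ℝ} (h0 : ∀ i, 0 < ν i) (τ : Fin 2) :
    curve ν ((τ : ℕ) : ℝ) = fun _ => ((τ : ℕ) : ℝ) := by
  rcases fin_two_cases τ with ⟨-, h⟩ | ⟨-, h⟩ <;> rw [h]
  · exact curve_zero h0
  · exact funext fun i => Real.one_rpow _

lemma lamOdd_dotProduct {m : ℕ} {ν : Fin (2 * m + 1) → ℝ} (h0 : ∀ i, 0 < ν i) (t : Fin m → ℝ)
    (τ : Fin 2) : lamOdd ν t τ ⬝ᵥ curve ν ((τ : ℕ) : ℝ) =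
      (-1) ^ ((τ : ℕ) + 1) * borderedDet (fun _ => ((τ : ℕ) : ℝ)) (oddRows ν t τ) := by
  rw [lamOdd, smul_dotProduct, hodgeStar_dotProduct, curve_tau h0, smul_eq_mul]

lemma lamOddGen_dotProduct {m : ℕ} {ν : Fin (2 * m + 1) → ℝ} (h0 : ∀ i, 0 < ν i) (t : Fin m → ℝ)
    (τ : Fin 2) : lamOddGen ν t τ ⬝ᵥ curve ν ((τ : ℕ) : ℝ) =
      (-1) ^ ((τ : ℕ) + 1) * borderedDet (fun _ => ((τ : ℕ) : ℝ)) (oddRowsGen ν t τ) := by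
  rw [lamOddGen, smul_dotProduct, hodgeStar_dotProduct, curve_tau h0, smul_eq_mul]

lemma lamEven_dotProduct {l : ℕ} (ν : Fin (2 * l + 2) → ℝ) (t : Fin (l + 1) → ℝ) :
    lamEven ν t ⬝ᵥ curve ν (t 0) = borderedDet (curve ν (t 0)) (evenRows ν t) :=
  hodgeStar_dotProduct _ _

lemma lamEvenGen_dotProduct {l : ℕ} (ν : Fin (2 * l + 2) → ℝ) (t : Fin (l + 1) → ℝ) :
    lamEvenGen ν t ⬝ᵥ curve ν (t 0) = borderedDet (curve ν (t 0)) (evenRowsGen ν t) :=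
  hodgeStar_dotProduct _ _

lemma isGreatest_values_of_eq_zero {N : ℕ} (ν : Fin N → ℝ) {lam : Fin N → ℝ} (h : lam = 0)
    (x : Fin N → ℝ) : IsGreatest (values ν lam) (lam ⬝ᵥ x) := by
  subst h
  rw [zero_dotProduct]
  exact isGreatest_values_zero ν

/-- Where the plain form differs from the general form it vanishes, and so does the right-hand
side. -/
lemma isGreatest_values_lamOdd {m : ℕ} {μ : ℕ → ℝ} {ν : Fin (2 * m + 1) → ℝ}
    (hμ : IsExponents μ ν) (h1 : μ 1 = 1) {t : Fin m → ℝ} (ht : t ∈ closedSimplex m) (τ : Fin 2) :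
    IsGreatest (values ν (lamOdd ν t τ)) (lamOdd ν t τ ⬝ᵥ curve ν ((τ : ℕ) : ℝ)) := by
  by_cases h : Function.Injective t ∧ ∀ k, t k ≠ ((τ : ℕ) : ℝ)
  · rw [← lamOddGen_eq ν h.1 h.2]
    exact isGreatest_values (tau_mem_Icc τ) (touches_lamOddGen hμ h1 ht τ).mem_normalCone
  · exact isGreatest_values_of_eq_zero ν (lamOdd_eq_zero ν h) _

lemma isGreatest_values_lamEven {l : ℕ} {μ : ℕ → ℝ} {ν : Fin (2 * l + 2) → ℝ}
    (hμ : IsExponents μ ν) (h1 : μ 1 = 1) {t : Fin (l + 1) → ℝ} (ht : t ∈ closedSimplex (l + 1)) :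
    IsGreatest (values ν (lamEven ν t)) (lamEven ν t ⬝ᵥ curve ν (t 0)) := by
  by_cases h : Function.Injective t
  · rw [← lamEvenGen_eq ν h]
    exact isGreatest_values (ht.2 0) (touches_lamEvenGen hμ h1 ht).mem_normalCone
  · exact isGreatest_values_of_eq_zero ν (lamEven_eq_zero ν h) _

lemma isGreatest_values_lamEvenEnd {l : ℕ} {μ : ℕ → ℝ} {ν : Fin (2 * l + 2) → ℝ}
    (hμ : IsExponents μ ν) (h1 : μ 1 = 1) {t : Fin l → ℝ} (ht : t ∈ closedSimplex l) :
    IsGreatest (values ν (lamEvenEnd ν t)) (lamEvenEnd ν t ⬝ᵥ curve ν 0) := by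
  by_cases h : Function.Injective t ∧ ∀ k, t k ≠ 0 ∧ t k ≠ 1
  · rw [← lamEvenEndGen_eq ν h.1 h.2]
    exact isGreatest_values (by simp) (touches_lamEvenEndGen hμ h1 ht).mem_normalCone
  · exact isGreatest_values_of_eq_zero ν (lamEvenEnd_eq_zero ν h) _

lemma ne_of_mem_openSimplex {m : ℕ} {t : Fin m → ℝ} (ht : t ∈ openSimplex m) (k : Fin m) :
    t k ≠ 0 ∧ t k ≠ 1 :=
  ⟨(ht.2 k).1.ne', (ht.2 k).2.ne⟩

/-- On the open simplex the plain form is a general form, whose zeros depend continuously on the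
parameters. -/
lemma tendsto_normalized_lamOdd {m : ℕ} {μ : ℕ → ℝ} {ν : Fin (2 * m + 1) → ℝ}
    (hμ : IsExponents μ ν) (h0 : ∀ i, 0 < ν i) (h1 : μ 1 = 1) {t : Fin m → ℝ}
    (ht : t ∈ closedSimplex m) (τ : Fin 2) :
    Tendsto (fun s => normalized (lamOdd ν s τ)) (𝓝[openSimplex m] t)
      (𝓝 (normalized (lamOddGen ν t τ))) := by
  refine tendsto_normalized_of_touches hμ h0 (b := fun _ => ((τ : ℕ) : ℝ)) (z := fun s => zOdd s τ)
    ?_ (touches_lamOddGen hμ h1 ht τ) tendsto_const_nhds ?_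
  · filter_upwards [self_mem_nhdsWithin] with s hs
    rw [← lamOddGen_eq ν hs.1.injective fun k => ?_]
    · exact touches_lamOddGen hμ h1 (openSimplex_subset m hs) τ
    · rcases fin_two_cases τ with ⟨-, h⟩ | ⟨-, h⟩ <;> rw [h]
      exacts [(ne_of_mem_openSimplex hs k).1, (ne_of_mem_openSimplex hs k).2]
  · exact (continuous_insertNth_const _ _ (continuous_dbl m)).continuousWithinAt

lemma tendsto_normalized_lamEven {l : ℕ} {μ : ℕ → ℝ} {ν : Fin (2 * l + 2) → ℝ}
    (hμ : IsExponents μ ν) (h0 : ∀ i, 0 < ν i) (h1 : μ 1 = 1) {t : Fin (l + 1) → ℝ}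
    (ht : t ∈ closedSimplex (l + 1)) :
    Tendsto (fun s => normalized (lamEven ν s)) (𝓝[openSimplex (l + 1)] t)
      (𝓝 (normalized (lamEvenGen ν t))) := by
  refine tendsto_normalized_of_touches hμ h0 (b := fun s => s 0)
    (z := fun s => (dbl s : Fin (2 * l + 2) → ℝ)) ?_ (touches_lamEvenGen hμ h1 ht) ?_ ?_
  · filter_upwards [self_mem_nhdsWithin] with s hs
    rw [← lamEvenGen_eq ν hs.1.injective]
    exact touches_lamEvenGen hμ h1 (openSimplex_subset _ hs)
  · exact (continuous_apply 0).continuousWithinAt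
  · exact (continuous_dbl (l + 1)).continuousWithinAt

lemma tendsto_normalized_lamEvenEnd {l : ℕ} {μ : ℕ → ℝ} {ν : Fin (2 * l + 2) → ℝ}
    (hμ : IsExponents μ ν) (h0 : ∀ i, 0 < ν i) (h1 : μ 1 = 1) {t : Fin l → ℝ}
    (ht : t ∈ closedSimplex l) :
    Tendsto (fun s => normalized (lamEvenEnd ν s)) (𝓝[openSimplex l] t)
      (𝓝 (normalized (lamEvenEndGen ν t))) := by
  refine tendsto_normalized_of_touches hμ h0 (b := fun _ => 0) (z := fun s => zEnd s)
    ?_ (touches_lamEvenEndGen hμ h1 ht) tendsto_const_nhds ?_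
  · filter_upwards [self_mem_nhdsWithin] with s hs
    rw [← lamEvenEndGen_eq ν hs.1.injective (ne_of_mem_openSimplex hs)]
    exact touches_lamEvenEndGen hμ h1 (openSimplex_subset l hs)
  · exact (continuous_insertNth_const _ _
      (continuous_insertNth_const _ _ (continuous_dbl l))).continuousWithinAt

/-- A point of contact of the inequalities in even dimension. -/
def bEven {l : ℕ} : closedSimplex (l + 1) ⊕ closedSimplex l → ℝ :=
  Sum.elim (fun t => t.1 0) fun _ => 0

lemma touches_evenFamily {l : ℕ} {μ : ℕ → ℝ} {ν : Fin (2 * l + 2) → ℝ} (hμ : IsExponents μ ν)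
    (h1 : μ 1 = 1) (p : closedSimplex (l + 1) ⊕ closedSimplex l) :
    Touches μ ν (evenFamily ν p) (bEven p) (zEven p) := by
  rcases p with t | t
  · exact touches_lamEvenGen hμ h1 t.2
  · exact touches_lamEvenEndGen hμ h1 t.2

end

end NoClick

theorem mainTheorem1 :
    -- odd number of settings `N = 2 m + 1`
    (∀ (m : ℕ) (ν : Fin (2 * m + 1) → ℝ), ν 0 = 1 → StrictMono ν →
      IsTightFamily ν (oddFamily ν) ∧
      IsCompleteFamily ν (oddFamily ν) ∧
      IsIndependentFamily ν (oddFamily ν) ∧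
      ∀ t ∈ closedSimplex m, ∀ τ : Fin 2,
        -- the plain form for distinct `t_k ≠ τ`, and the general form as its limit
        (StrictMono t → (∀ k, t k ≠ (τ : ℕ)) → lamOddGen ν t τ = lamOdd ν t τ) ∧
        Tendsto (fun s => normalized (lamOdd ν s τ)) (𝓝[openSimplex m] t)
          (𝓝 (normalized (lamOddGen ν t τ))) ∧
        -- the right-hand sides
        IsGreatest (values ν (lamOdd ν t τ))
          ((-1) ^ ((τ : ℕ) + 1) * borderedDet (fun _ => ((τ : ℕ) : ℝ)) (oddRows ν t τ)) ∧
        IsGreatest (values ν (lamOddGen ν t τ))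
          ((-1) ^ ((τ : ℕ) + 1) * borderedDet (fun _ => ((τ : ℕ) : ℝ)) (oddRowsGen ν t τ)) ∧
        ((∀ i, ν i = (i : ℕ) + 1) →
          bound ν (lamOdd ν t τ) = ((τ : ℕ) : ℝ) * (fPoly t 0 * fPoly t 1 * gPoly t))) ∧
    -- even number of settings `N = 2 m`, `m = l + 1`
    (∀ (l : ℕ) (ν : Fin (2 * l + 2) → ℝ), ν 0 = 1 → StrictMono ν →
      IsTightFamily ν (evenFamily ν) ∧
      IsCompleteFamily ν (evenFamily ν) ∧
      IsIndependentFamily ν (evenFamily ν) ∧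
      (∀ t ∈ closedSimplex (l + 1),
        (StrictMono t → lamEvenGen ν t = lamEven ν t) ∧
        Tendsto (fun s => normalized (lamEven ν s)) (𝓝[openSimplex (l + 1)] t)
          (𝓝 (normalized (lamEvenGen ν t))) ∧
        IsGreatest (values ν (lamEven ν t)) (borderedDet (curve ν (t 0)) (evenRows ν t)) ∧
        IsGreatest (values ν (lamEvenGen ν t)) (borderedDet (curve ν (t 0)) (evenRowsGen ν t)) ∧
        ((∀ i, ν i = (i : ℕ) + 1) → bound ν (lamEven ν t) = fPoly t 0 * gPoly t)) ∧
      (∀ t ∈ closedSimplex l,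
        (StrictMono t → (∀ k, t k ≠ 0 ∧ t k ≠ 1) → lamEvenEndGen ν t = lamEvenEnd ν t) ∧
        Tendsto (fun s => normalized (lamEvenEnd ν s)) (𝓝[openSimplex l] t)
          (𝓝 (normalized (lamEvenEndGen ν t))) ∧
        IsGreatest (values ν (lamEvenEnd ν t)) 0 ∧
        IsGreatest (values ν (lamEvenEndGen ν t)) 0)) := by
  refine ⟨fun m ν hν1 hν => ?_, fun l ν hν1 hν => ?_⟩
  · obtain ⟨μ, hμ, h1⟩ := exists_isExponents_one hν1 hν
    have h0 := exponents_pos hν1 hν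
    have htouch : ∀ p : closedSimplex m × Fin 2,
        Touches μ ν (oddFamily ν p) ((p.2 : ℕ) : ℝ) (zOdd p.1.1 p.2) :=
      fun p => touches_lamOddGen hμ h1 p.1.2 p.2
    have htight : IsTightFamily ν (oddFamily ν) :=
      isTightFamily_of_touches hμ htouch fun _ _ hy heven => exists_mult_zOdd hy heven
    refine ⟨htight, isCompleteFamily_of_tight hμ h0 htight,
      isIndependentFamily_of_touches hμ htouch zOdd_injective, fun t ht τ => ?_⟩
    have hplain := isGreatest_values_lamOdd hμ h1 ht τ
    refine ⟨fun hs hτ => lamOddGen_eq ν hs.injective hτ, tendsto_normalized_lamOdd hμ h0 h1 ht τ,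
      lamOdd_dotProduct h0 t τ ▸ hplain, ?_, fun hint => ?_⟩
    · rw [← lamOddGen_dotProduct h0]
      exact isGreatest_values (tau_mem_Icc τ) (htouch ⟨⟨t, ht⟩, τ⟩).mem_normalCone
    · rw [bound, hplain.csSup_eq]
      rcases fin_two_cases τ with ⟨rfl, h⟩ | ⟨rfl, h⟩
      · rw [h, curve_zero h0, dotProduct_zero, zero_mul]
      · rw [h, lamOdd, smul_dotProduct, hodgeStar_dotProduct, borderedDet_oddRows_one hint]
        simp
  · obtain ⟨μ, hμ, h1⟩ := exists_isExponents_one hν1 hν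
    have h0 := exponents_pos hν1 hν
    have htouch := touches_evenFamily hμ h1
    have htight : IsTightFamily ν (evenFamily ν) :=
      isTightFamily_of_touches hμ htouch fun _ _ hy heven => exists_mult_zEven hy heven
    refine ⟨htight, isCompleteFamily_of_tight hμ h0 htight,
      isIndependentFamily_of_touches hμ htouch zEven_injective, fun t ht => ?_, fun t ht => ?_⟩
    · have hplain := isGreatest_values_lamEven hμ h1 ht
      rw [lamEven_dotProduct] at hplain
      refine ⟨fun hs => lamEvenGen_eq ν hs.injective, tendsto_normalized_lamEven hμ h0 h1 ht,
        hplain, ?_, fun hint => ?_⟩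
      · rw [← lamEvenGen_dotProduct]
        exact isGreatest_values (ht.2 0) (touches_lamEvenGen hμ h1 ht).mem_normalCone
      · rw [bound, hplain.csSup_eq, borderedDet_evenRows hint]
    · have hplain := isGreatest_values_lamEvenEnd hμ h1 ht
      have hgen := isGreatest_values (by simp) (touches_lamEvenEndGen hμ h1 ht).mem_normalCone
      rw [curve_zero h0, dotProduct_zero] at hplain hgen
      exact ⟨fun hs h => lamEvenEndGen_eq ν hs.injective h,
        tendsto_normalized_lamEvenEnd hμ h0 h1 ht, hplain, hgen⟩
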